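/- Let $A$ be a finite alphabet. An infinite word $W\colon\mathbb N\to A$ is recurrent if each of its subwords (finite factors) occurs in $W$ infinitely many times. Write $u\sqsubseteq w$ if $u$ is a subword of $w$, and $u\sqsubseteq_k w$ if $u$ occurs in $w$ at least $k$ times (at different positions; occurrences may overlap). A \emph{graph with words} is a finite strongly connected directed graph (loops and parallel edges allowed) in which every vertex is either \emph{distributing} (in-degree $1$, out-degree $>1$) or \emph{collecting} (in-degree $>1$, out-degree $1$), and in which every edge $e$ carries a front word $F(e)\in A^*$ and a back word $B(e)\in A^*$. A path is a nonempty sequence of consecutive edges; the relations $\sqsubseteq$, $\sqsubseteq_k$ for paths are those for their edge sequences. For a path $s=v_1\dots v_n$ the word $F(s)$ is the concatenation, in order, of the front words of $v_1$ and of all $v_i$, $i>1$, that leave distributing vertices; $B(s)$ is the concatenation, in order, of the back words of all $v_i$, $i<n$, that enter collecting vertices and of $v_n$. A path is \emph{symmetric} if it starts in a collecting vertex and ends in a distributing vertex. The \emph{natural continuation} of a path $s$ to the right is the shortest path that begins with $s$ and ends in a distributing vertex; to the left, the shortest path that ends with $s$ and starts in a collecting vertex. A graph with words $S$ is a \emph{Rauzy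 scheme} for the recurrent infinite word $W$ if 1. it is strongly connected and has more than one edge; 2. the front words of the edges leaving any one distributing vertex have pairwise distinct first letters, and the back words of the edges entering any one collecting vertex have pairwise distinct last letters (in particular these words are nonempty); 3. $F(s)=B(s)$ for every symmetric path $s$; 4. if $s_1,s_2$ are symmetric paths and $F(s_1)\sqsubseteq_k F(s_2)$, then $s_1\sqsubseteq_k s_2$; 5. all front and back words of edges are subwords of $W$; 6. for every subword $u$ of $W$ there is a symmetric path $s$ with $u\sqsubseteq F(s)$; 7. for every edge $e$ there is a subword $u_e$ of $W$ such that every symmetric path $s$ with $u_e\sqsubseteq F(s)$ passes through $e$. Let $S$ be a Rauzy scheme for the recurrent infinite word $W$ and let $v$ be a \emph{support edge} of $S$, i.e. an edge from a collecting vertex to a distributing vertex. Let $\{x_i\}$ be the edges entering the beginning of $v$ and $\{y_j\}$ the edges leaving the end of $v$ (the two sets may intersect); put $X_i=B(x_i)$, $Y_j=F(y_j)$, $V=F(v)$. Let $S'$ be the graph obtained from $S$ by deleting $v$, replacing its beginning by vertices $A_i$ (so that $x_i$ enters $A_i$) and its end by vertices $B_j$ (so that $y_j$ leaves $B_j$),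 and adding an edge $v_{ij}$ from $A_i$ to $B_j$ for all $i,j$. In $S'$ put $F(y_j)=VY_j$, $F(v_{ij})=Y_j$, $B(x_i)=X_iV$, $B(v_{ij})=X_i$, and keep all other front and back words. Call $v_{ij}$ \emph{bad} if $X_iVY_j$ is not a subword of $W$; all other edges of $S'$ are \emph{good}. If the graph formed by the vertices of $S'$ and its good edges is a directed cycle, we say that the evolution \emph{reveals periodicity}. The \emph{elementary evolution} $(W,S,v)$ is the graph $S''$ whose vertices are the vertices of $S'$ that more than one good edge leaves or more than one good edge enters, and whose edges are the paths in $S'$ along good edges that start and end in such vertices and have no such vertex strictly inside. The front word of an edge $d$ of $S''$ is the front word (computed in $S'$) of the path of $S'$ corresponding to the natural continuation of $d$ to the right in $S''$; its back word is the back word (computed in $S'$) of the path of $S'$ corresponding to the natural continuation of $d$ to the left in $S''$. \textbf{Theorem.} Let $W$ be a recurrent infinite word, $S$ a Rauzy scheme for $W$, and $v$ a support edge of $S$. If the elementary evolution $(W,S,v)$ does not reveal periodicity, then it is a Rauzy scheme for $W$, i.e. it is a graph with words and has properties 1–7. -/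

import Mathlib

namespace Rauzy

/-! ### Finite and infinite words -/

section Words

variable {α : Type*}

/-- The word `u` occurs at least `k` times in the word `w`. An occurrence is a decomposition
`w = a u b`, so overlapping occurrences are counted separately. -/
def OccursAtLeast (k : ℕ) (u w : List α) : Prop :=
  (k : ℕ∞) ≤ {q : List α × List α | q.1 ++ u ++ q.2 = w}.encard

/-- The finite word `u` occurs in the infinite word `W` at position `i`. -/
def OccursAt (W : ℕ → α) (u : List α) (i : ℕ) : Prop :=
  u = (List.range u.length).map fun j => W (i + j)

/-- `u` is a subword of the infinite word `W`. -/
def IsSubword (u : List α) (W : ℕ → α) : Prop :=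
  ∃ i, OccursAt W u i

/-- Every subword of `W` occurs in `W` infinitely many times. -/
def IsRecurrent (W : ℕ → α) : Prop :=
  ∀ u : List α, IsSubword u W → {i | OccursAt W u i}.Infinite

end Words

/-! ### Directed graphs (loops and parallel edges are allowed) -/

/-- A directed multigraph with vertex set `V` and edge set `E`. -/
structure MultiDigraph (V E : Type*) where
  src : E → V
  tgt : E → V

namespace MultiDigraph

variable {V E : Type*} (G : MultiDigraph V E)

/-- From every vertex there is a directed path to every vertex. -/
def StronglyConnected : Prop :=
  ∀ a b : V, Relation.ReflTransGen (fun a b => ∃ e, G.src e = a ∧ G.tgt e = b) a b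

/-- The graph is one directed cycle. -/
def IsCycle : Prop :=
  G.StronglyConnected ∧ ∀ a : V, (∃! e, G.src e = a) ∧ (∃! e, G.tgt e = a)

/-- Incoming degree `1`, outgoing degree greater than `1`. -/
def IsDistributing (a : V) : Prop :=
  (∃! e, G.tgt e = a) ∧ {e | G.src e = a}.Nontrivial

/-- Incoming degree greater than `1`, outgoing degree `1`. -/
def IsCollecting (a : V) : Prop :=
  {e | G.tgt e = a}.Nontrivial ∧ (∃! e, G.src e = a)

/-- A path, given by its nonempty sequence of edges. -/
def IsPath (p : List E) : Prop :=
  p ≠ [] ∧ p.IsChain fun e f => G.tgt e = G.src f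

/-- The first edge of `p` leaves a collecting vertex. -/
def StartsCollecting (p : List E) : Prop :=
  ∃ e ∈ p.head?, G.IsCollecting (G.src e)

/-- The last edge of `p` enters a distributing vertex. -/
def EndsDistributing (p : List E) : Prop :=
  ∃ e ∈ p.getLast?, G.IsDistributing (G.tgt e)

/-- A symmetric path: it starts in a collecting vertex and ends in a distributing one. -/
def IsSymmetricPath (p : List E) : Prop :=
  G.IsPath p ∧ G.StartsCollecting p ∧ G.EndsDistributing p

/-- A support edge goes from a collecting vertex to a distributing vertex. -/
def IsSupportEdge (v : E) : Prop :=
  G.IsCollecting (G.src v) ∧ G.IsDistributing (G.tgt v)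

/-- `q` is a natural continuation of `p` to the right: a shortest path that begins with `p`
and ends in a distributing vertex. -/
def IsRightContinuation (p q : List E) : Prop :=
  (G.IsPath q ∧ p <+: q ∧ G.EndsDistributing q) ∧
    ∀ r, G.IsPath r → p <+: r → G.EndsDistributing r → q.length ≤ r.length

/-- `q` is a natural continuation of `p` to the left: a shortest path that ends with `p`
and starts in a collecting vertex. -/
def IsLeftContinuation (p q : List E) : Prop :=
  (G.IsPath q ∧ p <:+ q ∧ G.StartsCollecting q) ∧
    ∀ r, G.IsPath r → p <:+ r → G.StartsCollecting r → q.length ≤ r.length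

open Classical in
/-- The natural continuation to the right. It exists and is unique for every path of a finite
strongly connected graph whose vertices are all distributing or collecting. -/
noncomputable def rightContinuation (p : List E) : List E :=
  if h : ∃ q, G.IsRightContinuation p q then h.choose else p

open Classical in
/-- The natural continuation to the left. -/
noncomputable def leftContinuation (p : List E) : List E :=
  if h : ∃ q, G.IsLeftContinuation p q then h.choose else p

/-- The subgraph with the same vertices and only the edges that satisfy `P`. -/
def restrict (P : E → Prop) : MultiDigraph V {e : E // P e} where
  src e := G.src e.1
  tgt e := G.tgt e.1

/-- More than one edge leaves `a` or more than one edge enters `a`. -/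
def IsBranching (a : V) : Prop :=
  {e | G.src e = a}.Nontrivial ∨ {e | G.tgt e = a}.Nontrivial

/-- The paths from a branching vertex to a branching vertex with no branching vertex strictly
inside. -/
def IsBranchPath (p : List E) : Prop :=
  G.IsPath p ∧ (∃ e ∈ p.head?, G.IsBranching (G.src e)) ∧
    (∃ e ∈ p.getLast?, G.IsBranching (G.tgt e)) ∧ ∀ e ∈ p.tail, ¬ G.IsBranching (G.src e)

theorem IsBranchPath.src_head {G : MultiDigraph V E} {p : List E} (h : G.IsBranchPath p) :
    G.IsBranching (G.src (p.head h.1.1)) := by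
  obtain ⟨e, he, hb⟩ := h.2.1
  rw [List.head?_eq_some_head h.1.1, Option.mem_some_iff] at he
  rwa [he]

theorem IsBranchPath.tgt_getLast {G : MultiDigraph V E} {p : List E} (h : G.IsBranchPath p) :
    G.IsBranching (G.tgt (p.getLast h.1.1)) := by
  obtain ⟨e, he, hb⟩ := h.2.2.1
  rw [List.getLast?_eq_some_getLast h.1.1, Option.mem_some_iff] at he
  rwa [he]

/-- The graph obtained by keeping only the branching vertices and turning each path between
consecutive branching vertices into one edge. -/
def contract : MultiDigraph {a : V // G.IsBranching a} {p : List E // G.IsBranchPath p} where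
  src d := ⟨G.src (d.1.head d.2.1.1), d.2.src_head⟩
  tgt d := ⟨G.tgt (d.1.getLast d.2.1.1), d.2.tgt_getLast⟩

end MultiDigraph

/-! ### Graphs with words and Rauzy schemes -/

/-- A directed multigraph with a front word and a back word written on each edge. -/
structure LabeledGraph (A V E : Type*) extends MultiDigraph V E where
  front : E → List A
  back : E → List A

namespace LabeledGraph

variable {A V E : Type*} (S : LabeledGraph A V E)

/-- A graph with words: finite, strongly connected, and each vertex is distributing or
collecting. -/
structure IsGraphWithWords : Prop where
  finite_vertices : Finite V
  finite_edges : Finite E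
  stronglyConnected : S.StronglyConnected
  distributing_or_collecting : ∀ a, S.IsDistributing a ∨ S.IsCollecting a

open Classical in
/-- The front word of a path: concatenate the front words of its first edge and of those of its
other edges that leave distributing vertices. -/
noncomputable def frontWord : List E → List A
  | [] => []
  | e :: p => S.front e ++ (p.filter fun f => S.IsDistributing (S.src f)).flatMap S.front

open Classical in
/-- The back word of a path: concatenate the back words of those of its non-last edges that enter
collecting vertices and of its last edge. -/
noncomputable def backWord (p : List E) : List A :=
  (p.dropLast.filter fun f => S.IsCollecting (S.tgt f)).flatMap S.back ++
    p.getLast?.toList.flatMap S.back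

/-- `S` is a Rauzy scheme for the infinite word `W`. -/
structure IsRauzyScheme (W : ℕ → A) : Prop where
  isGraphWithWords : S.IsGraphWithWords
  /-- Strongly connected, with more than one edge. -/
  connected_nontrivial : S.StronglyConnected ∧ Nontrivial E
  /-- The front words of the edges leaving a distributing vertex have pairwise distinct first
  letters (in particular, these letters exist). -/
  front_letters : ∀ a, S.IsDistributing a →
    (∀ e, S.src e = a → S.front e ≠ []) ∧
    ∀ e f, S.src e = a → S.src f = a → e ≠ f → (S.front e).head? ≠ (S.front f).head?
  /-- The back words of the edges entering a collecting vertex have pairwise distinct last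
  letters (in particular, these letters exist). -/
  back_letters : ∀ a, S.IsCollecting a →
    (∀ e, S.tgt e = a → S.back e ≠ []) ∧
    ∀ e f, S.tgt e = a → S.tgt f = a → e ≠ f → (S.back e).getLast? ≠ (S.back f).getLast?
  /-- The front and back words of a symmetric path coincide. -/
  front_eq_back : ∀ s, S.IsSymmetricPath s → S.frontWord s = S.backWord s
  /-- If the word of `s` occurs at least `k` times in the word of `t`, then `s` occurs at least
  `k` times in `t` (as sequences of edges). -/
  occurs_of_occurs : ∀ (k : ℕ) (s t : List E), S.IsSymmetricPath s → S.IsSymmetricPath t →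
    OccursAtLeast k (S.frontWord s) (S.frontWord t) → OccursAtLeast k s t
  /-- All words on edges are subwords of `W`. -/
  labels_subword : ∀ e, IsSubword (S.front e) W ∧ IsSubword (S.back e) W
  /-- Every subword of `W` is contained in the word of a symmetric path. -/
  exists_symmetric : ∀ u, IsSubword u W → ∃ s, S.IsSymmetricPath s ∧ u <:+: S.frontWord s
  /-- Every edge `e` has a subword `u` of `W` such that all symmetric paths whose word contains `u`
  pass through `e`. -/
  exists_witness : ∀ e, ∃ u, IsSubword u W ∧
    ∀ s, S.IsSymmetricPath s → u <:+: S.frontWord s → e ∈ s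

/-! ### Elementary evolution -/

section Evolution

variable (v : E)

/-- The edges `x` that enter the beginning of `v`. -/
abbrev InEdge : Type _ := {x : E // S.tgt x = S.src v}

/-- The edges `y` that leave the end of `v`. -/
abbrev OutEdge : Type _ := {y : E // S.src y = S.tgt v}

/-- The vertices of the split graph: the vertices other than the ends of `v`, a vertex for each
edge entering the beginning of `v`, and a vertex for each edge leaving the end of `v`. -/
abbrev SplitVertex : Type _ :=
  {a : V // a ≠ S.src v ∧ a ≠ S.tgt v} ⊕ (S.InEdge v ⊕ S.OutEdge v)

/-- The edges of the split graph: the edges other than `v`, and an edge for each pair `(x, y)`. -/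
abbrev SplitEdge : Type _ :=
  {e : E // e ≠ v} ⊕ (S.InEdge v × S.OutEdge v)

variable {S v}

theorem src_ne_of_ne (hv : S.IsSupportEdge v) {e : E} (he : e ≠ v) : S.src e ≠ S.src v :=
  fun h => he (hv.1.2.unique h rfl)

theorem tgt_ne_of_ne (hv : S.IsSupportEdge v) {e : E} (he : e ≠ v) : S.tgt e ≠ S.tgt v :=
  fun h => he (hv.2.1.unique h rfl)

variable (S v)

open Classical in
/-- The split graph: the support edge `v` is replaced by a complete bipartite graph. -/
noncomputable def split (hv : S.IsSupportEdge v) :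
    LabeledGraph A (S.SplitVertex v) (S.SplitEdge v) where
  src
    | .inl e =>
      if h : S.src e.1 = S.tgt v then .inr (.inr ⟨e.1, h⟩)
      else .inl ⟨S.src e.1, src_ne_of_ne hv e.2, h⟩
    | .inr (x, _) => .inr (.inl x)
  tgt
    | .inl e =>
      if h : S.tgt e.1 = S.src v then .inr (.inl ⟨e.1, h⟩)
      else .inl ⟨S.tgt e.1, h, tgt_ne_of_ne hv e.2⟩
    | .inr (_, y) => .inr (.inr y)
  front
    | .inl e => if S.src e.1 = S.tgt v then S.front v ++ S.front e.1 else S.front e.1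
    | .inr (_, y) => S.front y.1
  back
    | .inl e => if S.tgt e.1 = S.src v then S.back e.1 ++ S.front v else S.back e.1
    | .inr (x, _) => S.back x.1

/-- The good edges of the split graph: all old edges, and those new edges `(x, y)` for which
`B(x) F(v) F(y)` is a subword of `W`. -/
def IsGood (W : ℕ → A) : S.SplitEdge v → Prop
  | .inl _ => True
  | .inr (x, y) => IsSubword (S.back x.1 ++ S.front v ++ S.front y.1) W

/-- The split graph without its bad edges. -/
noncomputable def goodGraph (W : ℕ → A) (hv : S.IsSupportEdge v) :
    MultiDigraph (S.SplitVertex v) {e : S.SplitEdge v // S.IsGood v W e} :=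
  (S.split v hv).toMultiDigraph.restrict (S.IsGood v W)

/-- The elementary evolution reveals periodicity: after the bad edges are removed from the split
graph, only a cycle is left. -/
def RevealsPeriodicity (W : ℕ → A) (hv : S.IsSupportEdge v) : Prop :=
  (S.goodGraph v W hv).IsCycle

/-- The edges of the elementary evolution: paths along good edges between consecutive branching
vertices of the graph of good edges. -/
abbrev EvolutionEdge (W : ℕ → A) (hv : S.IsSupportEdge v) : Type _ :=
  {p : List {e : S.SplitEdge v // S.IsGood v W e} // (S.goodGraph v W hv).IsBranchPath p}

variable {S v} in
/-- The path of the split graph that corresponds to a path of the elementary evolution. -/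
def toSplitPath {W : ℕ → A} {hv : S.IsSupportEdge v} (p : List (S.EvolutionEdge v W hv)) :
    List (S.SplitEdge v) :=
  p.flatMap fun d => d.1.map Subtype.val

/-- The elementary evolution `(W, S, v)`. The front (back) word of an edge is the front (back)
word, in the split graph, of its natural continuation to the right (left). -/
noncomputable def evolution (W : ℕ → A) (hv : S.IsSupportEdge v) :
    LabeledGraph A {a : S.SplitVertex v // (S.goodGraph v W hv).IsBranching a}
      (S.EvolutionEdge v W hv) where
  toMultiDigraph := (S.goodGraph v W hv).contract
  front d := (S.split v hv).frontWord
    (toSplitPath ((S.goodGraph v W hv).contract.rightContinuation [d]))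
  back d := (S.split v hv).backWord
    (toSplitPath ((S.goodGraph v W hv).contract.leftContinuation [d]))

end Evolution

end LabeledGraph

end Rauzy

/-!
The proof compares symmetric paths of the evolution with symmetric paths of the original scheme
`S`.

Forgetting which copy of `v` is passed gives a projection `proj` from the edges of the split graph
to the edges of `S`. It turns paths into paths, and a path of `S` that does not begin or end with
`v` has exactly one lift (`exists_lift`, `eq_of_map_proj_eq`). A symmetric path `p` of the
evolution, expanded to good edges, projected, and completed by `v` at those ends that are copies
of ends of `v`, becomes a symmetric path `completion a b p` of `S`. Both paths have the same front
word and the same back word (`frontWord_completion`, `backWord_completion`): in the split graph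
the words of a path differ from those in `S` only by the moment at which `F(y)` and `B(x)` are
read, and the words of the evolution, being defined by natural continuations, are those of the
expanded paths. Hence the equality of front and back words, the comparison of occurrences, and the
existence of witnesses carry over from `S`; occurrences of completions are lifted back by unique
lifting and by the fact that an expanded path starts in a branching vertex
(`occursAtLeast_of_completion`).

The other properties need paths whose words really occur in `W`. A path of `S` is called
admissible if it lies in a symmetric path whose word is a subword of `W`. Every subword of `W`
lies in the word of such a symmetric path: apply the covering property to a longer subword and cut
off the ends (`exists_symmetric_isSubword`). Recurrence together with the comparison of numbers of
occurrences shows that any two admissible paths can be joined to an admissible path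
(`exists_admissible_append`). Admissible paths lift to good edges, since `B(x) F(v) F(y)` is part
of the word of every symmetric path through `x`, `v`, `y`. Therefore the graph of good edges is
strongly connected; without periodicity it has a branching vertex, and then the contracted graph
is a graph with words. Finally, a natural continuation in the evolution is forced edge by edge
once its first good edge is chosen, so it is part of every sufficiently long admissible path
through that edge, and its word is a subword of `W`.

Statements about back words that mirror statements about front words are in part deduced by
reversing all edges.
-/

namespace Rauzy

/-! ### Subwords of an infinite word and occurrences -/

section Words

variable {α : Type*}

/-- The factor of length `n` of the infinite word `W` that starts at position `i`. -/
def factor (W : ℕ → α) (i n : ℕ) : List α :=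
  (List.range n).map fun j => W (i + j)

@[simp] theorem length_factor (W : ℕ → α) (i n : ℕ) : (factor W i n).length = n := by
  simp [factor]

theorem factor_add (W : ℕ → α) (i m n : ℕ) :
    factor W i (m + n) = factor W i m ++ factor W (i + m) n := by
  simp [factor, List.range_add, Function.comp_def, add_assoc]

theorem occursAt_iff {W : ℕ → α} {u : List α} {i : ℕ} :
    OccursAt W u i ↔ u = factor W i u.length := Iff.rfl

theorem occursAt_factor (W : ℕ → α) (i n : ℕ) : OccursAt W (factor W i n) i := by
  rw [occursAt_iff, length_factor]

theorem isSubword_factor (W : ℕ → α) (i n : ℕ) : IsSubword (factor W i n) W :=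
  ⟨i, occursAt_factor W i n⟩

theorem occursAt_append {W : ℕ → α} {u w : List α} {i : ℕ} :
    OccursAt W (u ++ w) i ↔ OccursAt W u i ∧ OccursAt W w (i + u.length) := by
  rw [occursAt_iff, occursAt_iff, occursAt_iff, List.length_append, factor_add]
  constructor
  · intro h
    exact List.append_inj h (by simp)
  · rintro ⟨h1, h2⟩
    rw [← h1, ← h2]

theorem IsSubword.of_infix {W : ℕ → α} {u w : List α} (h : u <:+: w) (hw : IsSubword w W) :
    IsSubword u W := by
  obtain ⟨a, b, rfl⟩ := h
  obtain ⟨i, hi⟩ := hw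
  exact ⟨_, (occursAt_append.1 (occursAt_append.1 hi).1).2⟩

/-- In a recurrent word every subword extends by prescribed lengths on both sides. -/
theorem IsRecurrent.exists_extension {W : ℕ → α} (hW : IsRecurrent W) {u : List α}
    (hu : IsSubword u W) (m n : ℕ) :
    ∃ a b : List α, a.length = m ∧ b.length = n ∧ IsSubword (a ++ u ++ b) W := by
  obtain ⟨i, hi, hmi⟩ := (hW u hu).exists_gt m
  obtain ⟨j, rfl⟩ := Nat.exists_eq_add_of_le hmi.le
  refine ⟨factor W j m, factor W (m + j + u.length) n, by simp, by simp, j, ?_⟩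
  rw [occursAt_append, occursAt_append]
  refine ⟨⟨occursAt_factor _ _ _, ?_⟩, ?_⟩
  · rw [length_factor, add_comm]
    exact hi
  · rw [List.length_append, length_factor, show j + (m + u.length) = m + j + u.length by omega]
    exact occursAt_factor _ _ _

theorem infix_factor_zero {W : ℕ → α} {u : List α} {i n : ℕ} (hu : OccursAt W u i)
    (hn : i + u.length ≤ n) : u <:+: factor W 0 n := by
  obtain ⟨k, rfl⟩ := Nat.exists_eq_add_of_le hn
  refine ⟨factor W 0 i, factor W (i + u.length) k, ?_⟩
  rw [factor_add, factor_add, zero_add, zero_add, ← occursAt_iff.1 hu]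

theorem IsSubword.exists_common {W : ℕ → α} {u w : List α} (hu : IsSubword u W)
    (hw : IsSubword w W) : ∃ z, IsSubword z W ∧ u <:+: z ∧ w <:+: z := by
  obtain ⟨i, hi⟩ := hu
  obtain ⟨j, hj⟩ := hw
  exact ⟨factor W 0 (i + u.length + (j + w.length)), isSubword_factor _ _ _,
    infix_factor_zero hi (by omega), infix_factor_zero hj (by omega)⟩

theorem occursAtLeast_one {u w : List α} : OccursAtLeast 1 u w ↔ u <:+: w := by
  rw [OccursAtLeast, Nat.cast_one, Set.one_le_encard_iff_nonempty]
  constructor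
  · rintro ⟨q, hq⟩
    exact ⟨q.1, q.2, hq⟩
  · rintro ⟨a, b, h⟩
    exact ⟨(a, b), h⟩

theorem OccursAtLeast.of_injOn {β : Type*} {k : ℕ} {u w : List α} {u' w' : List β}
    (h : OccursAtLeast k u w) (f : List α × List α → List β × List β)
    (hf : ∀ a b, a ++ u ++ b = w → (f (a, b)).1 ++ u' ++ (f (a, b)).2 = w')
    (hinj : Set.InjOn f {q | q.1 ++ u ++ q.2 = w}) : OccursAtLeast k u' w' :=
  le_trans h (Set.encard_le_encard_of_injOn (fun q hq => hf q.1 q.2 hq) hinj)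

/-- If every occurrence of `u` in `w` is obtained by a fixed recipe from an occurrence of `u'`
in `w'`, then `u'` occurs in `w'` at least as often as `u` in `w`. -/
theorem OccursAtLeast.of_surjOn {β : Type*} {k : ℕ} {u w : List α} {u' w' : List β}
    (h : OccursAtLeast k u w) (f : List β × List β → List α × List α)
    (hf : ∀ a b, a ++ u ++ b = w → ∃ a' b', a' ++ u' ++ b' = w' ∧ f (a', b') = (a, b)) :
    OccursAtLeast k u' w' := by
  refine le_trans h (le_trans (Set.encard_le_encard ?_) (Set.encard_image_le f _))
  rintro ⟨a, b⟩ hq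
  obtain ⟨a', b', h1, h2⟩ := hf a b hq
  exact ⟨(a', b'), h1, h2⟩

theorem OccursAtLeast.mono_right {k : ℕ} {u w z : List α} (h : OccursAtLeast k u w)
    (hwz : w <:+: z) : OccursAtLeast k u z := by
  obtain ⟨p, q, rfl⟩ := hwz
  refine h.of_injOn (fun r => (p ++ r.1, r.2 ++ q)) ?_ ?_
  · rintro a b rfl
    simp
  · rintro ⟨a, b⟩ _ ⟨a', b'⟩ _ h
    simpa using h

theorem IsRecurrent.exists_occursAtLeast {W : ℕ → α} (hW : IsRecurrent W) {u : List α}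
    (hu : IsSubword u W) (k : ℕ) : ∃ w, IsSubword w W ∧ OccursAtLeast k u w := by
  obtain ⟨t, ht, rfl⟩ := (hW u hu).exists_subset_card_eq k
  refine ⟨factor W 0 (t.sup id + u.length), isSubword_factor _ _ _, ?_⟩
  rw [OccursAtLeast, ← Set.encard_coe_eq_coe_finsetCard]
  refine Set.encard_le_encard_of_injOn
    (f := fun i => (factor W 0 i, factor W (i + u.length) (t.sup id - i))) ?_ ?_
  · intro i hi
    have hle : i ≤ t.sup id := Finset.le_sup (f := id) hi
    have hsum : t.sup id + u.length = i + u.length + (t.sup id - i) := by omega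
    change factor W 0 i ++ u ++ factor W (i + u.length) (t.sup id - i) = _
    rw [hsum, factor_add, factor_add, zero_add, zero_add, ← occursAt_iff.1 (ht hi)]
  · intro i _ j _ h
    simpa using congrArg (fun q => q.1.length) h

/-- Among more than `u.length` occurrences of `u` there are two disjoint ones. -/
theorem OccursAtLeast.exists_disjoint {u w : List α} (h : OccursAtLeast (u.length + 1) u w) :
    ∃ a m b, w = a ++ u ++ m ++ u ++ b := by
  classical
  by_contra hcon
  push Not at hcon
  have hne : ∃ n, ∃ a b, a ++ u ++ b = w ∧ a.length = n := by
    obtain ⟨q, hq⟩ := Set.one_le_encard_iff_nonempty.1 (le_trans (by simp) h)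
    exact ⟨_, q.1, q.2, hq, rfl⟩
  obtain ⟨a₀, b₀, h₀, hn⟩ := Nat.find_spec hne
  have hmin : ∀ a b, a ++ u ++ b = w → a₀.length ≤ a.length := by
    intro a b hab
    rw [hn]
    exact Nat.find_min' hne ⟨a, b, hab, rfl⟩
  have hclose : ∀ a b, a ++ u ++ b = w → a.length < a₀.length + u.length := by
    intro a b hab
    by_contra hlt
    have hp : a₀ ++ u <+: a := by
      refine List.prefix_of_prefix_length_le (l₃ := w) ⟨b₀, h₀⟩ ⟨u ++ b, ?_⟩ ?_
      · rw [← List.append_assoc, hab]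
      · simpa using hlt
    obtain ⟨m, rfl⟩ := hp
    exact hcon a₀ m b hab.symm
  have hle : {q : List α × List α | q.1 ++ u ++ q.2 = w}.encard
      ≤ (↑(Finset.range u.length) : Set ℕ).encard := by
    refine Set.encard_le_encard_of_injOn (f := fun q => q.1.length - a₀.length) ?_ ?_
    · rintro ⟨a, b⟩ hq
      have h1 := hmin a b hq
      have h2 := hclose a b hq
      simp only [Finset.coe_range, Set.mem_Iio]
      omega
    · rintro ⟨a, b⟩ hq ⟨a', b'⟩ hq' heq
      have h1 := hmin a b hq
      have h2 := hmin a' b' hq'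
      have hlen : a.length = a'.length := by
        simp only at heq
        omega
      have hq3 : a ++ (u ++ b) = a' ++ (u ++ b') := by
        rw [← List.append_assoc, ← List.append_assoc]
        exact hq.trans hq'.symm
      obtain ⟨rfl, h3⟩ := List.append_inj hq3 hlen
      rw [List.append_cancel_left h3]
  rw [Set.encard_coe_eq_coe_finsetCard, Finset.card_range] at hle
  have := le_trans h hle
  rw [Nat.cast_le] at this
  omega

end Words

/-! ### Walks, reversal and natural continuations in directed multigraphs -/

namespace MultiDigraph

variable {V E : Type*} (G : MultiDigraph V E)

/-- `p` is the edge sequence of a walk from `a` to `b`. In contrast to `IsPath`, the sequence may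
be empty, and the end vertices are recorded. -/
def IsWalk : V → List E → V → Prop
  | a, [], b => a = b
  | a, e :: p, b => G.src e = a ∧ IsWalk (G.tgt e) p b

/-- The graph with all edges reversed. -/
def reverse : MultiDigraph V E where
  src := G.tgt
  tgt := G.src

variable {G}

@[simp] theorem isWalk_nil {a b : V} : G.IsWalk a [] b ↔ a = b := Iff.rfl

@[simp] theorem isWalk_cons {a b : V} {e : E} {p : List E} :
    G.IsWalk a (e :: p) b ↔ G.src e = a ∧ G.IsWalk (G.tgt e) p b := Iff.rfl

theorem isWalk_append {a c : V} {p q : List E} :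
    G.IsWalk a (p ++ q) c ↔ ∃ b, G.IsWalk a p b ∧ G.IsWalk b q c := by
  induction p generalizing a with
  | nil => simp
  | cons e p ih => simp [ih, and_assoc]

theorem isWalk_concat {a b : V} {e : E} {p : List E} :
    G.IsWalk a (p ++ [e]) b ↔ G.IsWalk a p (G.src e) ∧ G.tgt e = b := by
  rw [isWalk_append]
  constructor
  · rintro ⟨_, h, rfl, h'⟩
    exact ⟨h, h'⟩
  · rintro ⟨h, h'⟩
    exact ⟨_, h, rfl, h'⟩

theorem isPath_cons {e : E} {p : List E} :
    G.IsPath (e :: p) ↔ ∃ b, G.IsWalk (G.tgt e) p b := by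
  induction p generalizing e with
  | nil => simp [IsPath]
  | cons f p ih =>
    have := ih (e := f)
    simp only [IsPath, ne_eq, reduceCtorEq, not_false_eq_true, true_and] at this
    simp only [IsPath, ne_eq, reduceCtorEq, not_false_eq_true, true_and,
      List.isChain_cons_cons, isWalk_cons, this]
    constructor
    · rintro ⟨h, b, hb⟩
      exact ⟨b, h.symm, hb⟩
    · rintro ⟨b, h, hb⟩
      exact ⟨h.symm, b, hb⟩

theorem IsWalk.isPath {a b : V} {p : List E} (h : G.IsWalk a p b) (hp : p ≠ []) : G.IsPath p := by
  cases p with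
  | nil => exact absurd rfl hp
  | cons e p => exact isPath_cons.2 ⟨b, h.2⟩

theorem IsPath.exists_isWalk {p : List E} (h : G.IsPath p) : ∃ a b, G.IsWalk a p b := by
  cases p with
  | nil => exact absurd rfl h.1
  | cons e p =>
    obtain ⟨b, hb⟩ := isPath_cons.1 h
    exact ⟨G.src e, b, rfl, hb⟩

theorem IsWalk.src_head? {a b : V} {p : List E} (h : G.IsWalk a p b) {e : E}
    (he : e ∈ p.head?) : G.src e = a := by
  cases p with
  | nil => simp at he
  | cons f p =>
    obtain rfl : f = e := by simpa using he
    exact h.1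

theorem IsWalk.tgt_getLast? {a b : V} {p : List E} (h : G.IsWalk a p b) {e : E}
    (he : e ∈ p.getLast?) : G.tgt e = b := by
  rcases List.eq_nil_or_concat' p with rfl | ⟨q, f, rfl⟩
  · simp at he
  · obtain rfl : f = e := by simpa using he
    exact (isWalk_concat.1 h).2

theorem IsWalk.startsCollecting_iff {a b : V} {p : List E} (h : G.IsWalk a p b) (hp : p ≠ []) :
    G.StartsCollecting p ↔ G.IsCollecting a := by
  have hmem : p.head hp ∈ p.head? := List.head?_eq_some_head hp
  constructor
  · rintro ⟨e, he, hc⟩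
    rwa [h.src_head? he] at hc
  · intro hc
    exact ⟨_, hmem, by rwa [h.src_head? hmem]⟩

theorem IsWalk.endsDistributing_iff {a b : V} {p : List E} (h : G.IsWalk a p b) (hp : p ≠ []) :
    G.EndsDistributing p ↔ G.IsDistributing b := by
  have hmem : p.getLast hp ∈ p.getLast? := List.getLast?_eq_some_getLast hp
  constructor
  · rintro ⟨e, he, hc⟩
    rwa [h.tgt_getLast? he] at hc
  · intro hc
    exact ⟨_, hmem, by rwa [h.tgt_getLast? hmem]⟩

theorem IsWalk.end_unique {a b b' : V} {p : List E} (h : G.IsWalk a p b)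
    (h' : G.IsWalk a p b') : b = b' := by
  induction p generalizing a with
  | nil => exact h.symm.trans h'
  | cons e p ih => exact ih h.2 h'.2

theorem IsDistributing.not_isCollecting {a : V} (h : G.IsDistributing a) : ¬ G.IsCollecting a := by
  intro h'
  obtain ⟨e, he, f, hf, hne⟩ := h.2
  exact hne (h'.2.unique he hf)

theorem isSymmetricPath_iff {p : List E} :
    G.IsSymmetricPath p ↔ ∃ a b, G.IsWalk a p b ∧ G.IsCollecting a ∧ G.IsDistributing b := by
  constructor
  · rintro ⟨hp, hs, he⟩
    obtain ⟨a, b, h⟩ := hp.exists_isWalk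
    exact ⟨a, b, h, (h.startsCollecting_iff hp.1).1 hs, (h.endsDistributing_iff hp.1).1 he⟩
  · rintro ⟨a, b, h, ha, hb⟩
    have hp : p ≠ [] := by
      rintro rfl
      rw [isWalk_nil] at h
      subst h
      exact hb.not_isCollecting ha
    exact ⟨h.isPath hp, (h.startsCollecting_iff hp).2 ha, (h.endsDistributing_iff hp).2 hb⟩

theorem reflTransGen_iff_isWalk {a b : V} :
    Relation.ReflTransGen (fun a b => ∃ e, G.src e = a ∧ G.tgt e = b) a b ↔
      ∃ p, G.IsWalk a p b := by
  constructor
  · intro h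
    induction h with
    | refl => exact ⟨[], rfl⟩
    | tail _ hbc ih =>
      obtain ⟨p, hp⟩ := ih
      obtain ⟨e, rfl, rfl⟩ := hbc
      exact ⟨p ++ [e], isWalk_concat.2 ⟨hp, rfl⟩⟩
  · rintro ⟨p, hp⟩
    induction p generalizing a with
    | nil => rw [isWalk_nil.1 hp]
    | cons e p ih => exact Relation.ReflTransGen.head ⟨e, hp.1, rfl⟩ (ih hp.2)

theorem stronglyConnected_iff : G.StronglyConnected ↔ ∀ a b, ∃ p, G.IsWalk a p b := by
  simp only [StronglyConnected, reflTransGen_iff_isWalk]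

theorem isWalk_reverse {a b : V} {p : List E} :
    G.reverse.IsWalk b p.reverse a ↔ G.IsWalk a p b := by
  induction p generalizing a with
  | nil => exact eq_comm
  | cons e p ih =>
    rw [List.reverse_cons, isWalk_concat, isWalk_cons, and_comm]
    exact and_congr Iff.rfl ih

theorem isPath_reverse {p : List E} : G.reverse.IsPath p.reverse ↔ G.IsPath p := by
  constructor
  · intro h
    obtain ⟨a, b, hw⟩ := h.exists_isWalk
    exact (isWalk_reverse.1 hw).isPath (by simpa using h.1)
  · intro h
    obtain ⟨a, b, hw⟩ := h.exists_isWalk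
    exact (isWalk_reverse.2 hw).isPath (by simpa using h.1)

theorem isDistributing_reverse {a : V} : G.reverse.IsDistributing a ↔ G.IsCollecting a := and_comm

theorem isCollecting_reverse {a : V} : G.reverse.IsCollecting a ↔ G.IsDistributing a := and_comm

theorem isBranching_reverse {a : V} : G.reverse.IsBranching a ↔ G.IsBranching a := or_comm

theorem StronglyConnected.reverse (h : G.StronglyConnected) : G.reverse.StronglyConnected := by
  rw [stronglyConnected_iff] at h ⊢
  intro a b
  obtain ⟨p, hp⟩ := h b a
  exact ⟨p.reverse, isWalk_reverse.2 hp⟩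

theorem endsDistributing_reverse {p : List E} :
    G.reverse.EndsDistributing p.reverse ↔ G.StartsCollecting p := by
  rw [EndsDistributing, StartsCollecting, List.getLast?_reverse]
  exact exists_congr fun e => and_congr Iff.rfl and_comm

theorem IsLeftContinuation.reverse {p q : List E} (h : G.IsLeftContinuation p q) :
    G.reverse.IsRightContinuation p.reverse q.reverse := by
  obtain ⟨⟨h1, h2, h3⟩, h4⟩ := h
  refine ⟨⟨isPath_reverse.2 h1, List.reverse_prefix.2 h2, endsDistributing_reverse.2 h3⟩, ?_⟩
  intro r hr1 hr2 hr3
  rw [← List.reverse_reverse r] at hr1 hr2 hr3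
  have := h4 r.reverse (isPath_reverse.1 hr1) (List.reverse_prefix.1 hr2)
    (endsDistributing_reverse.1 hr3)
  simpa using this

theorem IsRightContinuation.of_reverse {p q : List E}
    (h : G.reverse.IsRightContinuation p.reverse q.reverse) : G.IsLeftContinuation p q := by
  obtain ⟨⟨h1, h2, h3⟩, h4⟩ := h
  refine ⟨⟨isPath_reverse.1 h1, List.reverse_prefix.1 h2, endsDistributing_reverse.1 h3⟩, ?_⟩
  intro r hr1 hr2 hr3
  have := h4 r.reverse (isPath_reverse.2 hr1) (List.reverse_prefix.2 hr2)
    (endsDistributing_reverse.2 hr3)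
  simpa using this

/-- The natural continuation of an edge to the right exists as soon as some distributing vertex
exists in a strongly connected graph. -/
theorem StronglyConnected.exists_isRightContinuation (hG : G.StronglyConnected)
    (hd : ∃ b, G.IsDistributing b) (e : E) : ∃ q, G.IsRightContinuation [e] q := by
  classical
  obtain ⟨b, hb⟩ := hd
  have hex : ∃ n q, (G.IsPath q ∧ [e] <+: q ∧ G.EndsDistributing q) ∧ q.length = n := by
    obtain ⟨p, hp⟩ := stronglyConnected_iff.1 hG (G.tgt e) b
    have hw : G.IsWalk (G.src e) (e :: p) b := ⟨rfl, hp⟩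
    exact ⟨_, e :: p, ⟨hw.isPath (by simp), ⟨p, rfl⟩,
      (hw.endsDistributing_iff (by simp)).2 hb⟩, rfl⟩
  obtain ⟨q, hq, hn⟩ := Nat.find_spec hex
  exact ⟨q, hq, fun r h1 h2 h3 => hn ▸ Nat.find_min' hex ⟨r, ⟨h1, h2, h3⟩, rfl⟩⟩

theorem StronglyConnected.exists_isLeftContinuation (hG : G.StronglyConnected)
    (hd : ∃ b, G.IsCollecting b) (e : E) : ∃ q, G.IsLeftContinuation [e] q := by
  obtain ⟨b, hb⟩ := hd
  obtain ⟨q, hq⟩ := hG.reverse.exists_isRightContinuation ⟨b, isDistributing_reverse.2 hb⟩ e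
  refine ⟨q.reverse, IsRightContinuation.of_reverse ?_⟩
  rwa [List.reverse_reverse]

theorem rightContinuation_spec {p : List E} (h : ∃ q, G.IsRightContinuation p q) :
    G.IsRightContinuation p (G.rightContinuation p) := by
  rw [rightContinuation, dif_pos h]
  exact h.choose_spec

theorem leftContinuation_spec {p : List E} (h : ∃ q, G.IsLeftContinuation p q) :
    G.IsLeftContinuation p (G.leftContinuation p) := by
  rw [leftContinuation, dif_pos h]
  exact h.choose_spec

/-- By minimality the natural continuation to the right of an edge passes no distributing vertex
before its end. -/
theorem IsRightContinuation.exists_eq_cons {e : E} {q : List E}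
    (h : G.IsRightContinuation [e] q) :
    ∃ q' b, q = e :: q' ∧ G.IsWalk (G.src e) (e :: q') b ∧ G.IsDistributing b ∧
      ∀ f ∈ q', ¬ G.IsDistributing (G.src f) := by
  obtain ⟨⟨h1, ⟨q', rfl⟩, h3⟩, h4⟩ := h
  obtain ⟨a, b, hw⟩ := h1.exists_isWalk
  obtain rfl : G.src e = a := hw.1
  refine ⟨q', b, rfl, hw, (hw.endsDistributing_iff (by simp)).1 h3, ?_⟩
  intro f hf hd
  obtain ⟨l₁, l₂, rfl⟩ := List.append_of_mem hf
  obtain ⟨z, hz, hz'⟩ := isWalk_append.1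
    (show G.IsWalk (G.src e) ((e :: l₁) ++ f :: l₂) b from hw)
  obtain rfl : G.src f = z := hz'.1
  have := h4 (e :: l₁) (hz.isPath (by simp)) ⟨l₁, rfl⟩
    ((hz.endsDistributing_iff (by simp)).2 hd)
  simp at this

theorem IsLeftContinuation.exists_eq_concat {e : E} {q : List E}
    (h : G.IsLeftContinuation [e] q) :
    ∃ q' a, q = q' ++ [e] ∧ G.IsWalk a (q' ++ [e]) (G.tgt e) ∧ G.IsCollecting a ∧
      ∀ f ∈ q', ¬ G.IsCollecting (G.tgt f) := by
  obtain ⟨q', a, h1, h2, h3, h4⟩ := h.reverse.exists_eq_cons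
  have hq : q = q'.reverse ++ [e] := by
    rw [← List.reverse_reverse q, h1, List.reverse_cons]
  refine ⟨q'.reverse, a, hq, ?_, isDistributing_reverse.1 h3, ?_⟩
  · rw [← isWalk_reverse, List.reverse_append, List.reverse_reverse]
    exact h2
  · intro f hf hc
    exact h4 f (by simpa using hf) (isDistributing_reverse.2 hc)

/-- While the edges leave vertices of outgoing degree at most one, a walk is determined by its
first edge. -/
theorem prefix_of_forced {a b c : V} {p q : List E} (hp : G.IsWalk a p b) (hq : G.IsWalk a q c)
    (hforced : ∀ f ∈ p, ∀ g, G.src g = G.src f → g = f)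
    (hlen : p.length ≤ q.length) : p <+: q := by
  induction p generalizing a q with
  | nil => exact List.nil_prefix
  | cons f p ih =>
    cases q with
    | nil => simp at hlen
    | cons g q =>
      obtain rfl : g = f := hforced f (by simp) g (hq.1.trans hp.1.symm)
      rw [List.cons_prefix_cons]
      exact ⟨rfl, ih hp.2 hq.2 (fun f hf => hforced f (by simp [hf])) (by simpa using hlen)⟩

theorem suffix_of_forced {a b c : V} {p q : List E} (hp : G.IsWalk a p b) (hq : G.IsWalk c q b)
    (hforced : ∀ f ∈ p, ∀ g, G.tgt g = G.tgt f → g = f)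
    (hlen : p.length ≤ q.length) : p <:+ q := by
  rw [← List.reverse_prefix]
  exact prefix_of_forced (isWalk_reverse.2 hp) (isWalk_reverse.2 hq)
    (fun f hf g hg => hforced f (by simpa using hf) g hg) (by simpa using hlen)

/-- If all vertices of a finite nonempty graph are distributing or collecting, then both kinds of
vertices occur: otherwise all incoming degrees (or all outgoing degrees) would be
`1`, and then so would be the degrees of the other kind. -/
theorem exists_isCollecting_of_forall [Finite V] (a₀ : V)
    (h : ∀ a, G.IsDistributing a ∨ G.IsCollecting a) : ∃ a, G.IsCollecting a := by
  by_contra hcon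
  push Not at hcon
  have hd : ∀ a, G.IsDistributing a := fun a => (h a).resolve_right (hcon a)
  choose e he using fun a => (hd a).1.exists
  have hsurj : Function.Surjective fun a => G.src (e a) := by
    intro a
    obtain ⟨f, hf, -⟩ := (hd a).2
    refine ⟨G.tgt f, ?_⟩
    simp only
    rw [(hd (G.tgt f)).1.unique (he (G.tgt f)) rfl, hf]
  have hinj := Finite.injective_iff_surjective.2 hsurj
  obtain ⟨f, hf, g, hg, hne⟩ := (hd a₀).2
  have hf' := (hd (G.tgt f)).1.unique (he (G.tgt f)) rfl
  have hg' := (hd (G.tgt g)).1.unique (he (G.tgt g)) rfl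
  apply hne
  have : G.tgt f = G.tgt g := hinj (by
    simp only
    rw [hf', hg']
    exact hf.trans hg.symm)
  exact (hd (G.tgt g)).1.unique this rfl

theorem exists_isDistributing_of_forall [Finite V] (a₀ : V)
    (h : ∀ a, G.IsDistributing a ∨ G.IsCollecting a) : ∃ a, G.IsDistributing a := by
  obtain ⟨a, ha⟩ := exists_isCollecting_of_forall (G := G.reverse) a₀ fun a => (h a).symm.imp
    isDistributing_reverse.2 isCollecting_reverse.2
  exact ⟨a, isCollecting_reverse.1 ha⟩

/-! ### Contraction of non-branching vertices -/

theorem eq_of_src_eq {e f : E} (h : ¬ G.IsBranching (G.src f)) (he : G.src e = G.src f) :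
    e = f := by
  by_contra hne
  exact h (Or.inl ⟨e, he, f, rfl, hne⟩)

theorem eq_of_tgt_eq {e f : E} (h : ¬ G.IsBranching (G.tgt f)) (he : G.tgt e = G.tgt f) :
    e = f := by
  by_contra hne
  exact h (Or.inr ⟨e, he, f, rfl, hne⟩)

theorem isBranchPath_cons {e : E} {p : List E} :
    G.IsBranchPath (e :: p) ↔ G.IsBranching (G.src e) ∧
      (∃ b, G.IsWalk (G.tgt e) p b ∧ G.IsBranching b) ∧ ∀ f ∈ p, ¬ G.IsBranching (G.src f) := by
  constructor
  · rintro ⟨h1, h2, ⟨f, hf, hb⟩, h4⟩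
    obtain ⟨b, hw⟩ := isPath_cons.1 h1
    have hw' : G.IsWalk (G.src e) (e :: p) b := ⟨rfl, hw⟩
    refine ⟨by simpa using h2, ⟨b, hw, ?_⟩, h4⟩
    rwa [hw'.tgt_getLast? hf] at hb
  · rintro ⟨h1, ⟨b, hw, hb⟩, h3⟩
    have hw' : G.IsWalk (G.src e) (e :: p) b := ⟨rfl, hw⟩
    have hmem : (e :: p).getLast (by simp) ∈ (e :: p).getLast? :=
      List.getLast?_eq_some_getLast (by simp)
    exact ⟨hw'.isPath (by simp), ⟨e, by simp, h1⟩,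
      ⟨_, hmem, by rwa [hw'.tgt_getLast? hmem]⟩, h3⟩

theorem IsBranchPath.eq_of_cons {e : E} {p q : List E} (hp : G.IsBranchPath (e :: p))
    (hq : G.IsBranchPath (e :: q)) : p = q := by
  obtain ⟨-, ⟨b, hp, hb⟩, hp'⟩ := isBranchPath_cons.1 hp
  obtain ⟨-, ⟨c, hq, hc⟩, hq'⟩ := isBranchPath_cons.1 hq
  generalize G.tgt e = a at hp hq
  clear * - hp hq hb hc hp' hq'
  induction p generalizing a q with
  | nil =>
    cases q with
    | nil => rfl
    | cons g q =>
      rw [isWalk_nil] at hp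
      subst hp
      exact absurd (hq.1 ▸ hb) (hq' g (by simp))
  | cons f p ih =>
    cases q with
    | nil =>
      rw [isWalk_nil] at hq
      subst hq
      exact absurd (hp.1 ▸ hc) (hp' f (by simp))
    | cons g q =>
      obtain rfl : g = f := eq_of_src_eq (hp' f (by simp)) (hq.1.trans hp.1.symm)
      rw [ih (fun f hf => hp' f (by simp [hf])) (fun f hf => hq' f (by simp [hf])) _ hp.2 hq.2]

theorem IsBranchPath.reverse {p : List E} (h : G.IsBranchPath p) :
    G.reverse.IsBranchPath p.reverse := by
  obtain ⟨h1, ⟨e, he, he'⟩, ⟨f, hf, hf'⟩, h4⟩ := h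
  refine ⟨isPath_reverse.2 h1, ⟨f, by simpa using hf, isBranching_reverse.2 hf'⟩,
    ⟨e, by simpa using he, isBranching_reverse.2 he'⟩, ?_⟩
  intro x hx hb
  rw [isBranching_reverse] at hb
  rw [List.tail_reverse, List.mem_reverse] at hx
  obtain ⟨a, b, hw⟩ := h1.exists_isWalk
  clear * - h4 hx hb hw
  induction p generalizing a with
  | nil => simp at hx
  | cons y p ih =>
    cases p with
    | nil => simp at hx
    | cons z p =>
      rw [List.dropLast_cons_cons, List.mem_cons] at hx
      rcases hx with rfl | hx
      · exact h4 z (by simp) (hw.2.1 ▸ hb)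
      · exact ih (fun t ht => h4 t (List.mem_of_mem_tail ht)) hx _ hw.2

theorem IsBranchPath.eq_of_concat {e : E} {p q : List E} (hp : G.IsBranchPath (p ++ [e]))
    (hq : G.IsBranchPath (q ++ [e])) : p = q := by
  have hp' := hp.reverse
  have hq' := hq.reverse
  rw [List.reverse_append, List.reverse_singleton, List.singleton_append] at hp' hq'
  exact List.reverse_injective (hp'.eq_of_cons hq')

/-- The path of `G` that corresponds to a path of the contraction. -/
def expand (p : List {p : List E // G.IsBranchPath p}) : List E :=
  p.flatMap Subtype.val

@[simp] theorem expand_nil : expand ([] : List {p : List E // G.IsBranchPath p}) = [] := rfl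

@[simp] theorem expand_cons (d : {p : List E // G.IsBranchPath p}) (p) :
    expand (d :: p) = d.1 ++ expand p := List.flatMap_cons

@[simp] theorem expand_append (p q : List {p : List E // G.IsBranchPath p}) :
    expand (p ++ q) = expand p ++ expand q := List.flatMap_append

theorem exists_eq_cons (d : {p : List E // G.IsBranchPath p}) :
    ∃ e p, d.1 = e :: p := List.exists_cons_of_ne_nil d.2.1.1

theorem exists_eq_concat (d : {p : List E // G.IsBranchPath p}) :
    ∃ p e, d.1 = p ++ [e] :=
  (List.eq_nil_or_concat' d.1).resolve_left d.2.1.1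

theorem contract_src {d : {p : List E // G.IsBranchPath p}} {e : E} {p : List E}
    (h : d.1 = e :: p) : (G.contract.src d).1 = G.src e := by
  simp [contract, h]

theorem contract_tgt {d : {p : List E // G.IsBranchPath p}} {e : E} {p : List E}
    (h : d.1 = p ++ [e]) : (G.contract.tgt d).1 = G.tgt e := by
  simp [contract, h]

theorem isWalk_val (d : {p : List E // G.IsBranchPath p}) :
    G.IsWalk (G.contract.src d).1 d.1 (G.contract.tgt d).1 := by
  obtain ⟨a, b, hw⟩ := d.2.1.exists_isWalk
  obtain ⟨e, p, he⟩ := exists_eq_cons d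
  obtain ⟨q, f, hf⟩ := exists_eq_concat d
  have ha := hw.src_head? (e := e) (by simp [he])
  have hb := hw.tgt_getLast? (e := f) (by simp [hf])
  rw [contract_src he, contract_tgt hf, ha, hb]
  exact hw

theorem edge_ext_cons {d d' : {p : List E // G.IsBranchPath p}} {e : E} {p p' : List E}
    (h : d.1 = e :: p) (h' : d'.1 = e :: p') : d = d' := by
  have hd := d.2
  have hd' := d'.2
  rw [h] at hd
  rw [h'] at hd'
  exact Subtype.ext (by rw [h, h', hd.eq_of_cons hd'])

theorem edge_ext_concat {d d' : {p : List E // G.IsBranchPath p}} {e : E} {p p' : List E}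
    (h : d.1 = p ++ [e]) (h' : d'.1 = p' ++ [e]) : d = d' := by
  have hd := d.2
  have hd' := d'.2
  rw [h] at hd
  rw [h'] at hd'
  exact Subtype.ext (by rw [h, h', hd.eq_of_concat hd'])

theorem isWalk_expand {a b : {a : V // G.IsBranching a}}
    {p : List {p : List E // G.IsBranchPath p}} (h : G.contract.IsWalk a p b) :
    G.IsWalk a.1 (expand p) b.1 := by
  induction p generalizing a with
  | nil =>
    rw [isWalk_nil] at h
    rw [h]
    rfl
  | cons d p ih =>
    obtain ⟨rfl, h2⟩ := h
    rw [expand_cons, isWalk_append]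
    exact ⟨_, isWalk_val d, ih h2⟩

/-- Every walk between branching vertices is the expansion of a walk of the contraction. -/
theorem exists_expand_eq {a b : {a : V // G.IsBranching a}} {p : List E}
    (h : G.IsWalk a.1 p b.1) : ∃ ds, G.contract.IsWalk a ds b ∧ expand ds = p := by
  -- A nonempty walk with arbitrary start splits at the first branching vertex after its start.
  have key : ∀ (p : List E) (e : E), G.IsWalk (G.tgt e) p b.1 →
      ∃ (r : List E) (z : {a : V // G.IsBranching a}) (ds : _),
        G.IsWalk (G.tgt e) r z.1 ∧ (∀ f ∈ r, ¬ G.IsBranching (G.src f)) ∧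
        G.contract.IsWalk z ds b ∧ p = r ++ expand ds := by
    intro p
    induction p with
    | nil =>
      intro e he
      exact ⟨[], b, [], he, by simp, rfl, rfl⟩
    | cons f p ih =>
      intro e he
      obtain ⟨r, z, ds, h1, h2, h3, rfl⟩ := ih f he.2
      by_cases hf : G.IsBranching (G.src f)
      · have hbp : G.IsBranchPath (f :: r) := isBranchPath_cons.2 ⟨hf, ⟨z.1, h1, z.2⟩, h2⟩
        refine ⟨[], ⟨G.src f, hf⟩, ⟨f :: r, hbp⟩ :: ds, he.1.symm, by simp, ⟨?_, ?_⟩, by simp⟩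
        · exact Subtype.ext (contract_src (d := ⟨f :: r, hbp⟩) rfl)
        · have hz : G.contract.tgt ⟨f :: r, hbp⟩ = z := by
            apply Subtype.ext
            have hw := isWalk_val ⟨f :: r, hbp⟩
            exact hw.2.end_unique h1
          rwa [hz]
      · exact ⟨f :: r, z, ds, ⟨he.1, h1⟩, by simpa using ⟨hf, h2⟩, h3, rfl⟩
  cases p with
  | nil => exact ⟨[], Subtype.ext h, rfl⟩
  | cons e p =>
    obtain ⟨r, z, ds, h1, h2, h3, rfl⟩ := key p e h.2
    have hbp : G.IsBranchPath (e :: r) :=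
      isBranchPath_cons.2 ⟨by rw [h.1]; exact a.2, ⟨z.1, h1, z.2⟩, h2⟩
    refine ⟨⟨e :: r, hbp⟩ :: ds, ⟨?_, ?_⟩, by simp⟩
    · exact Subtype.ext ((contract_src (d := ⟨e :: r, hbp⟩) rfl).trans h.1)
    · have hz : G.contract.tgt ⟨e :: r, hbp⟩ = z :=
        Subtype.ext ((isWalk_val ⟨e :: r, hbp⟩).2.end_unique h1)
      rwa [hz]

theorem StronglyConnected.contract (h : G.StronglyConnected) : G.contract.StronglyConnected := by
  rw [stronglyConnected_iff] at h ⊢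
  intro a b
  obtain ⟨p, hp⟩ := h a.1 b.1
  obtain ⟨ds, hds, -⟩ := exists_expand_eq hp
  exact ⟨ds, hds⟩

theorem StronglyConnected.exists_cons (h : G.StronglyConnected) {e : E}
    (he : G.IsBranching (G.src e)) : ∃ (d : {p : List E // G.IsBranchPath p}) (p : List E),
      d.1 = e :: p := by
  obtain ⟨p, hp⟩ := stronglyConnected_iff.1 h (G.tgt e) (G.src e)
  obtain ⟨ds, -, hds⟩ := exists_expand_eq (a := ⟨_, he⟩) (b := ⟨_, he⟩)
    (show G.IsWalk (G.src e) (e :: p) (G.src e) from ⟨rfl, hp⟩)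
  cases ds with
  | nil => simp at hds
  | cons d ds =>
    obtain ⟨f, q, hf⟩ := exists_eq_cons d
    rw [expand_cons, hf, List.cons_append, List.cons.injEq] at hds
    exact ⟨d, q, hds.1 ▸ hf⟩

theorem StronglyConnected.exists_concat (h : G.StronglyConnected) {e : E}
    (he : G.IsBranching (G.tgt e)) : ∃ (d : {p : List E // G.IsBranchPath p}) (p : List E),
      d.1 = p ++ [e] := by
  obtain ⟨p, hp⟩ := stronglyConnected_iff.1 h (G.tgt e) (G.src e)
  obtain ⟨ds, -, hds⟩ := exists_expand_eq (a := ⟨_, he⟩) (b := ⟨_, he⟩)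
    (isWalk_concat.2 ⟨hp, rfl⟩)
  rcases List.eq_nil_or_concat' ds with rfl | ⟨ds, d, rfl⟩
  · simp at hds
  · obtain ⟨q, f, hf⟩ := exists_eq_concat d
    rw [expand_append, expand_cons, expand_nil, List.append_nil, hf, ← List.append_assoc] at hds
    obtain ⟨-, hfe⟩ := List.append_inj' hds rfl
    rw [List.cons.injEq] at hfe
    exact ⟨d, q, hfe.1 ▸ hf⟩

theorem StronglyConnected.isDistributing_contract (h : G.StronglyConnected)
    {a : {a : V // G.IsBranching a}} (ha : G.IsDistributing a.1) :
    G.contract.IsDistributing a := by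
  constructor
  · obtain ⟨e, he, huniq⟩ := ha.1
    obtain ⟨d, p, hd⟩ := h.exists_concat (e := e) (by rw [he]; exact a.2)
    refine ⟨d, Subtype.ext ((contract_tgt hd).trans he), fun d' hd' => ?_⟩
    obtain ⟨q, f, hf⟩ := exists_eq_concat d'
    have hfe : f = e := huniq f (by
      simp only
      rw [← contract_tgt hf, hd'])
    exact edge_ext_concat (hfe ▸ hf) hd
  · obtain ⟨e, he, f, hf, hne⟩ := ha.2
    obtain ⟨d, p, hd⟩ := h.exists_cons (e := e) (by rw [show G.src e = a.1 from he]; exact a.2)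
    obtain ⟨d', p', hd'⟩ := h.exists_cons (e := f)
      (by rw [show G.src f = a.1 from hf]; exact a.2)
    refine ⟨d, Subtype.ext ((contract_src hd).trans he), d',
      Subtype.ext ((contract_src hd').trans hf), ?_⟩
    rintro rfl
    rw [hd, List.cons.injEq] at hd'
    exact hne hd'.1

theorem StronglyConnected.isCollecting_contract (h : G.StronglyConnected)
    {a : {a : V // G.IsBranching a}} (ha : G.IsCollecting a.1) :
    G.contract.IsCollecting a := by
  constructor
  · obtain ⟨e, he, f, hf, hne⟩ := ha.1
    obtain ⟨d, p, hd⟩ := h.exists_concat (e := e) (by rw [show G.tgt e = a.1 from he]; exact a.2)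
    obtain ⟨d', p', hd'⟩ := h.exists_concat (e := f)
      (by rw [show G.tgt f = a.1 from hf]; exact a.2)
    refine ⟨d, Subtype.ext ((contract_tgt hd).trans he), d',
      Subtype.ext ((contract_tgt hd').trans hf), ?_⟩
    rintro rfl
    rw [hd] at hd'
    exact hne (by simpa using (List.append_inj' hd' rfl).2)
  · obtain ⟨e, he, huniq⟩ := ha.2
    obtain ⟨d, p, hd⟩ := h.exists_cons (e := e) (by rw [he]; exact a.2)
    refine ⟨d, Subtype.ext ((contract_src hd).trans he), fun d' hd' => ?_⟩
    obtain ⟨f, q, hf⟩ := exists_eq_cons d'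
    have hfe : f = e := huniq f (by
      simp only
      rw [← contract_src hf, hd'])
    exact edge_ext_cons (hfe ▸ hf) hd

theorem prefix_of_expand_prefix {p q : List {p : List E // G.IsBranchPath p}}
    (h : expand p <+: expand q) : p <+: q := by
  induction p generalizing q with
  | nil => exact List.nil_prefix
  | cons d p ih =>
    obtain ⟨e, r, he⟩ := exists_eq_cons d
    cases q with
    | nil => simp [he] at h
    | cons d' q =>
      obtain ⟨e', r', he'⟩ := exists_eq_cons d'
      obtain rfl : d = d' := by
        have h' := h
        rw [expand_cons, expand_cons, he, he', List.cons_append, List.cons_append,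
          List.cons_prefix_cons] at h'
        obtain ⟨rfl, -⟩ := h'
        exact edge_ext_cons he he'
      rw [expand_cons, expand_cons, List.prefix_append_right_inj] at h
      rw [List.cons_prefix_cons]
      exact ⟨rfl, ih h⟩

/-- An occurrence of an expansion in an expansion comes from an occurrence in the contraction,
because a path of the contraction starts in a branching vertex. -/
theorem exists_of_expand_eq {p q : List {p : List E // G.IsBranchPath p}} (hp : p ≠ [])
    {a b : List E} (h : a ++ expand p ++ b = expand q) :
    ∃ a' b', a' ++ p ++ b' = q ∧ expand a' = a ∧ expand b' = b := by
  induction q generalizing a with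
  | nil =>
    obtain ⟨d, p, rfl⟩ := List.exists_cons_of_ne_nil hp
    obtain ⟨e, r, he⟩ := exists_eq_cons d
    simp [he] at h
  | cons d' q ih =>
    rcases a.eq_nil_or_concat' with rfl | hne
    · obtain ⟨b', hb'⟩ := prefix_of_expand_prefix (p := p) (q := d' :: q) ⟨b, by simpa using h⟩
      refine ⟨[], b', hb', rfl, ?_⟩
      rw [← hb', expand_append, List.nil_append] at h
      exact (List.append_cancel_left h).symm
    · rw [expand_cons, List.append_assoc] at h
      rcases List.append_eq_append_iff.1 h with ⟨c, hc1, hc2⟩ | ⟨c, hc1, hc2⟩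
      · cases c with
        | nil =>
          obtain ⟨a', b', h1, h2, h3⟩ := ih (a := []) (by simpa using hc2)
          refine ⟨d' :: a', b', by rw [← h1]; rfl, ?_, h3⟩
          rw [expand_cons, h2, hc1]
          simp
        | cons x c =>
          exfalso
          obtain ⟨d, p, rfl⟩ := List.exists_cons_of_ne_nil hp
          obtain ⟨e, r, he⟩ := exists_eq_cons d
          rw [expand_cons, he] at hc2
          obtain rfl : e = x := by
            simp only [List.cons_append, List.cons.injEq] at hc2
            exact hc2.1
          have hbr := d.2
          rw [he] at hbr
          refine d'.2.2.2.2 e ?_ (isBranchPath_cons.1 hbr).1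
          obtain ⟨y, a, rfl⟩ : ∃ y a', a = y :: a' := by
            refine List.exists_cons_of_ne_nil ?_
            rintro rfl
            obtain ⟨_, _, h⟩ := hne
            simp at h
          rw [hc1]
          simp
      · obtain ⟨a', b', h1, h2, h3⟩ := ih (a := c) (by rw [List.append_assoc]; exact hc2.symm)
        exact ⟨d' :: a', b', by rw [← h1]; rfl, by rw [expand_cons, h2, hc1], h3⟩

end MultiDigraph

/-! ### Front and back words of paths -/

namespace LabeledGraph

variable {A V E : Type*}

/-- The reversed graph: edges and words are read backwards, and front and back words are
exchanged. -/
def reverse (S : LabeledGraph A V E) : LabeledGraph A V E where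
  toMultiDigraph := S.toMultiDigraph.reverse
  front e := (S.back e).reverse
  back e := (S.front e).reverse

open Classical in
/-- The contribution of an edge that is not the first one to the front word of a path. -/
noncomputable def frontTerm (S : LabeledGraph A V E) (e : E) : List A :=
  if S.IsDistributing (S.src e) then S.front e else []

open Classical in
/-- The contribution of an edge that is not the last one to the back word of a path. -/
noncomputable def backTerm (S : LabeledGraph A V E) (e : E) : List A :=
  if S.IsCollecting (S.tgt e) then S.back e else []

variable {S : LabeledGraph A V E}

theorem frontTerm_of_isDistributing {e : E} (h : S.IsDistributing (S.src e)) :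
    S.frontTerm e = S.front e := if_pos h

theorem frontTerm_of_not {e : E} (h : ¬ S.IsDistributing (S.src e)) :
    S.frontTerm e = [] := if_neg h

theorem backTerm_of_isCollecting {e : E} (h : S.IsCollecting (S.tgt e)) :
    S.backTerm e = S.back e := if_pos h

theorem backTerm_of_not {e : E} (h : ¬ S.IsCollecting (S.tgt e)) :
    S.backTerm e = [] := if_neg h

theorem frontWord_cons (e : E) (p : List E) :
    S.frontWord (e :: p) = S.front e ++ p.flatMap S.frontTerm := by
  rw [frontWord]
  congr 1
  induction p with
  | nil => rfl
  | cons f p ih =>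
    rw [List.filter_cons, List.flatMap_cons, ← ih, frontTerm]
    split_ifs <;> simp_all

theorem backWord_concat (e : E) (p : List E) :
    S.backWord (p ++ [e]) = p.flatMap S.backTerm ++ S.back e := by
  rw [backWord, List.dropLast_concat, List.getLast?_concat]
  congr 1
  · induction p with
    | nil => rfl
    | cons f p ih =>
      rw [List.filter_cons, List.flatMap_cons, ← ih, backTerm]
      split_ifs <;> simp_all
  · simp

theorem frontWord_append {p q : List E} (hp : p ≠ []) :
    S.frontWord (p ++ q) = S.frontWord p ++ q.flatMap S.frontTerm := by
  obtain ⟨e, p, rfl⟩ := List.exists_cons_of_ne_nil hp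
  rw [List.cons_append, frontWord_cons, frontWord_cons, List.flatMap_append, List.append_assoc]

theorem backWord_append {p q : List E} (hq : q ≠ []) :
    S.backWord (p ++ q) = p.flatMap S.backTerm ++ S.backWord q := by
  obtain ⟨q, e, rfl⟩ := (List.eq_nil_or_concat' q).resolve_left hq
  rw [← List.append_assoc, backWord_concat, backWord_concat, List.flatMap_append,
    List.append_assoc]

theorem frontWord_of_isDistributing {a b : V} {p : List E} (hw : S.IsWalk a p b)
    (ha : S.IsDistributing a) : S.frontWord p = p.flatMap S.frontTerm := by
  cases p with
  | nil => rfl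
  | cons e p =>
    rw [frontWord_cons, List.flatMap_cons, frontTerm_of_isDistributing (by rwa [hw.1])]

theorem backWord_of_isCollecting {a b : V} {p : List E} (hw : S.IsWalk a p b)
    (hb : S.IsCollecting b) : S.backWord p = p.flatMap S.backTerm := by
  rcases List.eq_nil_or_concat' p with rfl | ⟨p, e, rfl⟩
  · rfl
  · rw [backWord_concat, List.flatMap_append, List.flatMap_singleton,
      backTerm_of_isCollecting (by rwa [(MultiDigraph.isWalk_concat.1 hw).2])]

theorem frontTerm_reverse (e : E) : S.reverse.frontTerm e = (S.backTerm e).reverse := by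
  by_cases h : S.IsCollecting (S.tgt e)
  · rw [backTerm_of_isCollecting h,
      frontTerm_of_isDistributing (MultiDigraph.isDistributing_reverse.2 h)]
    rfl
  · rw [backTerm_of_not h,
      frontTerm_of_not fun h' => h (MultiDigraph.isDistributing_reverse.1 h')]
    rfl

theorem frontWord_reverse (p : List E) :
    S.reverse.frontWord p.reverse = (S.backWord p).reverse := by
  rcases List.eq_nil_or_concat' p with rfl | ⟨p, e, rfl⟩
  · rfl
  · rw [List.reverse_append, List.reverse_singleton, List.singleton_append, frontWord_cons,
      backWord_concat, List.reverse_append]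
    congr 1
    induction p with
    | nil => rfl
    | cons f p ih => simp [ih, frontTerm_reverse]

/-! ### Words of symmetric paths in a Rauzy scheme -/

section Scheme

variable {W : ℕ → A} {v : E}

theorem IsRauzyScheme.frontWord_infix (hS : S.IsRauzyScheme W) {s t : List E}
    (hs : S.IsSymmetricPath s) (ht : t ≠ []) (hts : t <:+: s) :
    S.frontWord t <:+: S.frontWord s := by
  obtain ⟨p, q, rfl⟩ := hts
  have hs' := hs
  rw [List.append_assoc] at hs' ⊢
  obtain ⟨a, b, hw, ha, hb⟩ := MultiDigraph.isSymmetricPath_iff.1 hs'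
  obtain ⟨z, hp, hq⟩ := MultiDigraph.isWalk_append.1 hw
  have key : S.frontWord t <:+: S.frontWord (t ++ q) := by
    rw [frontWord_append ht]
    exact (List.prefix_append _ _).isInfix
  refine key.trans ?_
  by_cases hpe : p = []
  · rw [hpe, List.nil_append]
  rcases hS.isGraphWithWords.distributing_or_collecting z with hz | hz
  · rw [frontWord_append hpe, frontWord_of_isDistributing hq hz]
    exact (List.suffix_append _ _).isInfix
  · rw [hS.front_eq_back _ (MultiDigraph.isSymmetricPath_iff.2 ⟨z, b, hq, hz, hb⟩),
      hS.front_eq_back _ hs', backWord_append (p := p) (by simp [ht])]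
    exact (List.suffix_append _ _).isInfix

theorem IsRauzyScheme.backWord_infix (hS : S.IsRauzyScheme W) {s t : List E}
    (hs : S.IsSymmetricPath s) (ht : t ≠ []) (hts : t <:+: s) :
    S.backWord t <:+: S.frontWord s := by
  obtain ⟨p, q, rfl⟩ := hts
  obtain ⟨a, b, hw, ha, hb⟩ := MultiDigraph.isSymmetricPath_iff.1 hs
  obtain ⟨z, hp, hq⟩ := MultiDigraph.isWalk_append.1 hw
  have key : S.backWord t <:+: S.backWord (p ++ t) := by
    rw [backWord_append ht]
    exact (List.suffix_append _ _).isInfix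
  refine key.trans ?_
  rw [hS.front_eq_back _ hs]
  by_cases hqe : q = []
  · rw [hqe, List.append_nil]
  rcases hS.isGraphWithWords.distributing_or_collecting z with hz | hz
  · rw [← hS.front_eq_back _ (MultiDigraph.isSymmetricPath_iff.2 ⟨a, z, hp, ha, hz⟩),
      ← hS.front_eq_back _ hs, frontWord_append (p := p ++ t) (by simp [ht])]
    exact (List.prefix_append _ _).isInfix
  · rw [backWord_append hqe, backWord_of_isCollecting hp hz]
    exact (List.prefix_append _ _).isInfix

theorem IsRauzyScheme.front_support (hS : S.IsRauzyScheme W) (hv : S.IsSupportEdge v) :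
    S.front v = S.back v := by
  have h := hS.front_eq_back [v]
    (MultiDigraph.isSymmetricPath_iff.2 ⟨_, _, ⟨rfl, rfl⟩, hv.1, hv.2⟩)
  have h1 := S.frontWord_cons v []
  have h2 := S.backWord_concat v []
  rw [List.nil_append] at h2
  rw [h1, h2] at h
  simpa using h

theorem IsRauzyScheme.backWord_append_support (hS : S.IsRauzyScheme W) (hv : S.IsSupportEdge v)
    {x : E} (hx : S.tgt x = S.src v) (p : List E) :
    S.backWord (p ++ [x, v]) = p.flatMap S.backTerm ++ (S.back x ++ S.front v) := by
  have h := S.backWord_concat v (p ++ [x])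
  rw [List.append_assoc, List.flatMap_append, List.flatMap_singleton,
    backTerm_of_isCollecting (by rw [hx]; exact hv.1), ← hS.front_support hv] at h
  simpa using h

/-- A symmetric path through `x`, `v`, `y` contains the word `B(x) F(v) F(y)`. -/
theorem IsRauzyScheme.crossing_infix (hS : S.IsRauzyScheme W) (hv : S.IsSupportEdge v)
    {x y : E} (hx : S.tgt x = S.src v) (hy : S.src y = S.tgt v) {s : List E}
    (hs : S.IsSymmetricPath s) (h : [x, v, y] <:+: s) :
    S.back x ++ S.front v ++ S.front y <:+: S.frontWord s := by
  obtain ⟨p, q, rfl⟩ := h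
  obtain ⟨a, b, hw, ha, hb⟩ := MultiDigraph.isSymmetricPath_iff.1 hs
  have hsplit : p ++ [x, v, y] ++ q = (p ++ [x, v]) ++ (y :: q) := by simp
  rw [hsplit] at hw ⊢
  obtain ⟨z, hp, hq⟩ := MultiDigraph.isWalk_append.1 hw
  obtain rfl : S.tgt v = z := hy.symm.trans hq.1
  rw [frontWord_append (by simp),
    hS.front_eq_back _ (MultiDigraph.isSymmetricPath_iff.2 ⟨a, _, hp, ha, hv.2⟩),
    hS.backWord_append_support hv hx, List.flatMap_cons,
    frontTerm_of_isDistributing (by rw [hy]; exact hv.2)]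
  exact ⟨p.flatMap S.backTerm, q.flatMap S.frontTerm, by simp⟩

/-- The symmetric path obtained by continuing `x`, `v`, `y` naturally on both sides has the word
`B(x) F(v) F(y)`. -/
theorem IsRauzyScheme.exists_crossing (hS : S.IsRauzyScheme W) (hv : S.IsSupportEdge v)
    {x y : E} (hx : S.tgt x = S.src v) (hy : S.src y = S.tgt v) :
    ∃ t, S.IsSymmetricPath t ∧ [x, v, y] <:+: t ∧
      S.frontWord t = S.back x ++ S.front v ++ S.front y := by
  have hG := hS.isGraphWithWords.stronglyConnected
  obtain ⟨_, hl⟩ := hG.exists_isLeftContinuation ⟨_, hv.1⟩ x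
  obtain ⟨_, hr⟩ := hG.exists_isRightContinuation ⟨_, hv.2⟩ y
  obtain ⟨p, a, -, hp, ha, hp'⟩ := hl.exists_eq_concat
  obtain ⟨q, b, -, hq, hb, hq'⟩ := hr.exists_eq_cons
  have hpv : S.IsWalk a (p ++ [x, v]) (S.tgt v) := by
    have : p ++ [x, v] = p ++ [x] ++ [v] := by simp
    rw [this, MultiDigraph.isWalk_concat]
    exact ⟨hx ▸ hp, rfl⟩
  refine ⟨p ++ [x, v] ++ y :: q, MultiDigraph.isSymmetricPath_iff.2
    ⟨a, b, MultiDigraph.isWalk_append.2 ⟨_, hpv, hy ▸ hq⟩, ha, hb⟩, ⟨p, q, by simp⟩, ?_⟩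
  have hp0 : p.flatMap S.backTerm = [] :=
    List.flatMap_eq_nil_iff.2 fun f hf => backTerm_of_not (hp' f hf)
  have hq0 : q.flatMap S.frontTerm = [] :=
    List.flatMap_eq_nil_iff.2 fun f hf => frontTerm_of_not (hq' f hf)
  rw [frontWord_append (by simp),
    hS.front_eq_back _ (MultiDigraph.isSymmetricPath_iff.2 ⟨a, _, hpv, ha, hv.2⟩),
    hS.backWord_append_support hv hx, List.flatMap_cons,
    frontTerm_of_isDistributing (by rw [hy]; exact hv.2), hp0, hq0]
  simp

/-! ### Admissible paths -/

/-- If the word of a path contains `w` at some place, then one can drop edges in front so that the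
word begins inside `w`, not too far from its beginning. -/
theorem IsRauzyScheme.exists_trim_left (hS : S.IsRauzyScheme W) {M : ℕ}
    (hM : ∀ e, (S.back e).length ≤ M) {s : List E} {a b : V} (hw : S.IsWalk a s b)
    (hb : S.IsDistributing b) {x w y : List A} (h : S.backWord s = x ++ w ++ y)
    (hwM : M < w.length) :
    ∃ s' w₁ w₂, S.IsSymmetricPath s' ∧ w = w₁ ++ w₂ ∧ w₁.length ≤ M ∧
      S.backWord s' = w₂ ++ y := by
  induction s generalizing a x with
  | nil =>
    have := congrArg List.length h
    simp only [backWord, List.dropLast_nil, List.filter_nil, List.flatMap_nil, List.getLast?_nil,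
      Option.toList_none, List.append_nil, List.length_nil, List.length_append] at this
    omega
  | cons e s ih =>
    by_cases hs : s = []
    · have h1 := congrArg List.length h
      have h2 := hM e
      have h3 := S.backWord_concat e []
      rw [List.nil_append, ← hs] at h3
      rw [h3] at h1
      simp only [hs, List.flatMap_nil, List.nil_append, List.length_append] at h1
      omega
    have hcons : S.backWord (e :: s) = S.backTerm e ++ S.backWord s := by
      have := S.backWord_append (p := [e]) hs
      rwa [List.flatMap_singleton, List.singleton_append] at this
    rw [hcons] at h
    rcases hS.isGraphWithWords.distributing_or_collecting (S.tgt e) with he | he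
    · rw [backTerm_of_not he.not_isCollecting] at h
      exact ih hw.2 h
    · rw [backTerm_of_isCollecting he, List.append_assoc] at h
      rcases List.append_eq_append_iff.1 h with ⟨c, -, hc2⟩ | ⟨c, hc1, hc2⟩
      · exact ih hw.2 (x := c) (by rw [hc2, List.append_assoc])
      · have hcM : c.length ≤ M := by
          have := hM e
          rw [hc1, List.length_append] at this
          omega
        obtain ⟨w₂, rfl⟩ : c <+: w :=
          List.prefix_of_prefix_length_le (l₃ := w ++ y) ⟨_, hc2.symm⟩ ⟨y, rfl⟩ (by omega)
        refine ⟨s, c, w₂, MultiDigraph.isSymmetricPath_iff.2 ⟨_, b, hw.2, he, hb⟩, rfl, hcM, ?_⟩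
        rw [List.append_assoc] at hc2
        exact (List.append_cancel_left hc2).symm

/-- The mirror image of `exists_trim_left`. -/
theorem IsRauzyScheme.exists_trim_right (hS : S.IsRauzyScheme W) {M : ℕ}
    (hM : ∀ e, (S.front e).length ≤ M) {s : List E} {a b : V} (hw : S.IsWalk a s b)
    (ha : S.IsCollecting a) {x w y : List A} (h : S.frontWord s = x ++ w ++ y)
    (hwM : M < w.length) :
    ∃ s' w₁ w₂, S.IsSymmetricPath s' ∧ w = w₁ ++ w₂ ∧ w₂.length ≤ M ∧
      S.frontWord s' = x ++ w₁ := by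
  induction s using List.reverseRecOn generalizing b y with
  | nil =>
    have := congrArg List.length h
    simp only [frontWord, List.length_nil, List.length_append] at this
    omega
  | append_singleton s e ih =>
    by_cases hs : s = []
    · have h1 := congrArg List.length h
      have h2 := hM e
      rw [hs, List.nil_append, frontWord_cons] at h1
      simp only [List.flatMap_nil, List.append_nil, List.length_append] at h1
      omega
    obtain ⟨hws, -⟩ := MultiDigraph.isWalk_concat.1 hw
    rw [frontWord_append hs, List.flatMap_singleton] at h
    rcases hS.isGraphWithWords.distributing_or_collecting (S.src e) with he | he
    · rw [frontTerm_of_isDistributing he] at h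
      rcases List.append_eq_append_iff.1 h with ⟨c, hc1, hc2⟩ | ⟨c, hc1, hc2⟩
      · have hcM : c.length ≤ M := by
          have := hM e
          rw [hc2, List.length_append] at this
          omega
        obtain ⟨w₁, rfl⟩ : c <:+ w :=
          List.suffix_of_suffix_length_le (l₃ := x ++ w) ⟨_, hc1.symm⟩ ⟨x, rfl⟩ (by omega)
        refine ⟨s, w₁, c, MultiDigraph.isSymmetricPath_iff.2 ⟨a, _, hws, ha, he⟩, rfl, hcM, ?_⟩
        rw [← List.append_assoc] at hc1
        exact (List.append_cancel_right hc1).symm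
      · exact ih hws (y := c) hc1
    · rw [frontTerm_of_not fun h => h.not_isCollecting he, List.append_nil] at h
      exact ih hws h

/-- Every subword of `W` lies in the word of a symmetric path whose own word is a subword
of `W`. -/
theorem IsRauzyScheme.exists_symmetric_isSubword (hS : S.IsRauzyScheme W) (hW : IsRecurrent W)
    {u : List A} (hu : IsSubword u W) :
    ∃ s, S.IsSymmetricPath s ∧ IsSubword (S.frontWord s) W ∧ u <:+: S.frontWord s := by
  have := hS.isGraphWithWords.finite_edges
  obtain ⟨M, hM⟩ := (Set.finite_range
    fun e => (S.front e).length + (S.back e).length).bddAbove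
  have hMf : ∀ e, (S.front e).length ≤ M := fun e =>
    le_trans (Nat.le_add_right _ _) (hM ⟨e, rfl⟩)
  have hMb : ∀ e, (S.back e).length ≤ M := fun e =>
    le_trans (Nat.le_add_left _ _) (hM ⟨e, rfl⟩)
  obtain ⟨l, r, hl, hr, hlr⟩ := hW.exists_extension hu M (M + 1)
  obtain ⟨s, hs, x, y, hxy⟩ := hS.exists_symmetric _ hlr
  obtain ⟨a, b, hw, ha, hb⟩ := MultiDigraph.isSymmetricPath_iff.1 hs
  rw [hS.front_eq_back s hs] at hxy
  obtain ⟨s₁, w₁, w₂, hs₁, hw₁₂, hlen₁, hB⟩ := hS.exists_trim_left hMb hw hb hxy.symm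
    (by simp only [List.length_append]; omega)
  obtain ⟨a₁, b₁, hwalk₁, ha₁, hb₁⟩ := MultiDigraph.isSymmetricPath_iff.1 hs₁
  have hlen := congrArg List.length hw₁₂
  simp only [List.length_append] at hlen
  rw [← hS.front_eq_back s₁ hs₁] at hB
  obtain ⟨s₂, w₃, w₄, hs₂, rfl, hlen₂, hF⟩ := hS.exists_trim_right hMf hwalk₁ ha₁ (x := [])
    (w := w₂) (y := y) (by rw [hB, List.nil_append]) (by omega)
  rw [List.nil_append] at hF
  have hin : w₃ <:+: l ++ u ++ r := ⟨w₁, w₄, by rw [hw₁₂]; simp⟩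
  refine ⟨s₂, hs₂, by rw [hF]; exact hlr.of_infix hin, ?_⟩
  rw [hF]
  -- `u` begins after `w₁`, because `w₁` is not longer than `l`, and ends before `w₄`.
  rw [List.append_assoc] at hw₁₂
  obtain ⟨c, rfl⟩ : w₁ <+: l := List.prefix_of_prefix_length_le (l₃ := l ++ (u ++ r))
    ⟨_, hw₁₂.symm⟩ ⟨_, rfl⟩ (by omega)
  rw [List.append_assoc] at hw₁₂
  have h2 := List.append_cancel_left hw₁₂
  obtain ⟨d, rfl⟩ : w₄ <:+ r := List.suffix_of_suffix_length_le (l₃ := c ++ (u ++ r))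
    ⟨_, h2.symm⟩ ⟨c ++ u, by simp⟩ (by omega)
  refine ⟨c, d, ?_⟩
  have h3 : c ++ u ++ d ++ w₄ = w₃ ++ w₄ := by
    rw [← h2]
    simp
  exact List.append_cancel_right h3

/-- The path `t` is part of a symmetric path whose word is a subword of `W`. -/
def Admissible (S : LabeledGraph A V E) (W : ℕ → A) (t : List E) : Prop :=
  ∃ s, S.IsSymmetricPath s ∧ IsSubword (S.frontWord s) W ∧ t <:+: s

theorem Admissible.of_infix {s t : List E} (h : S.Admissible W s) (hts : t <:+: s) :
    S.Admissible W t := by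
  obtain ⟨r, h1, h2, h3⟩ := h
  exact ⟨r, h1, h2, hts.trans h3⟩

theorem Admissible.exists_isWalk {t : List E} (h : S.Admissible W t) :
    ∃ a b, S.IsWalk a t b := by
  obtain ⟨s, h1, -, p, q, rfl⟩ := h
  obtain ⟨a, b, hw, -, -⟩ := MultiDigraph.isSymmetricPath_iff.1 h1
  obtain ⟨z, hz, -⟩ := MultiDigraph.isWalk_append.1 hw
  obtain ⟨z', -, hz'⟩ := MultiDigraph.isWalk_append.1 hz
  exact ⟨_, _, hz'⟩

theorem IsRauzyScheme.isSubword_frontWord (hS : S.IsRauzyScheme W) {t : List E}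
    (h : S.Admissible W t) (ht : t ≠ []) : IsSubword (S.frontWord t) W := by
  obtain ⟨s, h1, h2, h3⟩ := h
  exact h2.of_infix (hS.frontWord_infix h1 ht h3)

theorem IsRauzyScheme.isSubword_backWord (hS : S.IsRauzyScheme W) {t : List E}
    (h : S.Admissible W t) (ht : t ≠ []) : IsSubword (S.backWord t) W := by
  obtain ⟨s, h1, h2, h3⟩ := h
  exact h2.of_infix (hS.backWord_infix h1 ht h3)

theorem IsRauzyScheme.infix_of_infix (hS : S.IsRauzyScheme W) {s t : List E}
    (hs : S.IsSymmetricPath s) (ht : S.IsSymmetricPath t)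
    (h : S.frontWord s <:+: S.frontWord t) : s <:+: t :=
  occursAtLeast_one.1 (hS.occurs_of_occurs 1 s t hs ht (occursAtLeast_one.2 h))

theorem IsRauzyScheme.admissible_edge (hS : S.IsRauzyScheme W) (hW : IsRecurrent W) (e : E) :
    S.Admissible W [e] := by
  obtain ⟨u, hu, hue⟩ := hS.exists_witness e
  obtain ⟨s, h1, h2, h3⟩ := hS.exists_symmetric_isSubword hW hu
  exact ⟨s, h1, h2, List.singleton_infix_iff _ _ |>.2 (hue s h1 h3)⟩

theorem IsRauzyScheme.admissible_crossing (hS : S.IsRauzyScheme W) (hW : IsRecurrent W)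
    (hv : S.IsSupportEdge v) {x y : E} (hx : S.tgt x = S.src v) (hy : S.src y = S.tgt v)
    (hxy : IsSubword (S.back x ++ S.front v ++ S.front y) W) :
    S.Admissible W [x, v, y] := by
  obtain ⟨t, ht1, ht2, ht3⟩ := hS.exists_crossing hv hx hy
  rw [← ht3] at hxy
  obtain ⟨s, h1, h2, h3⟩ := hS.exists_symmetric_isSubword hW hxy
  exact ⟨s, h1, h2, ht2.trans (hS.infix_of_infix ht1 h1 h3)⟩

/-- Admissible paths can be joined: by recurrence some admissible path contains both, and a
further one contains two disjoint copies of that path. -/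
theorem IsRauzyScheme.exists_admissible_append (hS : S.IsRauzyScheme W) (hW : IsRecurrent W)
    {t₁ t₂ : List E} (h₁ : S.Admissible W t₁) (h₂ : S.Admissible W t₂) :
    ∃ m, S.Admissible W (t₁ ++ m ++ t₂) := by
  obtain ⟨s₁, hs₁, hw₁, hi₁⟩ := h₁
  obtain ⟨s₂, hs₂, hw₂, hi₂⟩ := h₂
  obtain ⟨z, hz, hz₁, hz₂⟩ := hw₁.exists_common hw₂
  obtain ⟨s, hs, hsw, hzs⟩ := hS.exists_symmetric_isSubword hW hz
  obtain ⟨p₁, q₁, e₁⟩ := hi₁.trans (hS.infix_of_infix hs₁ hs (hz₁.trans hzs))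
  obtain ⟨p₂, q₂, e₂⟩ := hi₂.trans (hS.infix_of_infix hs₂ hs (hz₂.trans hzs))
  obtain ⟨w, hw, hocc⟩ := hW.exists_occursAtLeast hsw (s.length + 1)
  obtain ⟨r, hr, hrw, hwr⟩ := hS.exists_symmetric_isSubword hW hw
  obtain ⟨a, m, b, hab⟩ :=
    (hS.occurs_of_occurs _ s r hs hr (hocc.mono_right hwr)).exists_disjoint
  refine ⟨q₁ ++ m ++ p₂, r, hr, hrw, a ++ p₁, q₂ ++ b, ?_⟩
  have hsm : a ++ s ++ m ++ s ++ b =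
      a ++ (p₁ ++ t₁ ++ q₁) ++ m ++ (p₂ ++ t₂ ++ q₂) ++ b := by rw [e₁, e₂]
  rw [hab, hsm]
  simp

end Scheme

end LabeledGraph

namespace MultiDigraph

/-! ### Transfer of degrees -/

variable {V E V' E' : Type*} {G : MultiDigraph V E} {H : MultiDigraph V' E'}

theorem existsUnique_of_bijOn {f : E → E'} {s : Set E} {t : Set E'} (h : Set.BijOn f s t)
    (ht : ∃! e, e ∈ t) : ∃! e, e ∈ s := by
  obtain ⟨e, he, hu⟩ := ht
  obtain ⟨e', he', rfl⟩ := h.surjOn he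
  exact ⟨e', he', fun g hg => h.injOn hg he' (hu _ (h.mapsTo hg))⟩

theorem nontrivial_of_bijOn {f : E → E'} {s : Set E} {t : Set E'} (h : Set.BijOn f s t)
    (ht : t.Nontrivial) : s.Nontrivial := by
  rw [← h.image_eq] at ht
  exact Set.nontrivial_of_image f s ht

/-- Degrees can be computed after a map that is bijective on the edges at a vertex. -/
theorem IsDistributing.of_bijOn {f : E → E'} {a : V} {b : V'} (h : H.IsDistributing b)
    (hs : Set.BijOn f {e | G.src e = a} {e | H.src e = b})
    (ht : Set.BijOn f {e | G.tgt e = a} {e | H.tgt e = b}) : G.IsDistributing a :=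
  ⟨existsUnique_of_bijOn ht h.1, nontrivial_of_bijOn hs h.2⟩

theorem IsCollecting.of_bijOn {f : E → E'} {a : V} {b : V'} (h : H.IsCollecting b)
    (hs : Set.BijOn f {e | G.src e = a} {e | H.src e = b})
    (ht : Set.BijOn f {e | G.tgt e = a} {e | H.tgt e = b}) : G.IsCollecting a :=
  ⟨nontrivial_of_bijOn ht h.1, existsUnique_of_bijOn hs h.2⟩

theorem isWalk_restrict {P : E → Prop} {a b : V} {p : List {e // P e}} :
    (G.restrict P).IsWalk a p b ↔ G.IsWalk a (p.map Subtype.val) b := by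
  induction p generalizing a with
  | nil => rfl
  | cons e p ih => exact and_congr Iff.rfl ih

end MultiDigraph

/-! ### The split graph and its projection to the original graph -/

namespace LabeledGraph

variable {A V E : Type*} {S : LabeledGraph A V E} {v : E}

/-- The edge of `S` from which an edge of the split graph arises. -/
def proj : S.SplitEdge v → E
  | .inl e => e.1
  | .inr _ => v

/-- The vertex of `S` from which a vertex of the split graph arises. -/
def projVertex : S.SplitVertex v → V
  | .inl a => a.1
  | .inr (.inl _) => S.src v
  | .inr (.inr _) => S.tgt v

/-- The vertex is one of the copies of the beginning of `v`. -/
def IsEntry : S.SplitVertex v → Prop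
  | .inr (.inl _) => True
  | _ => False

/-- The vertex is one of the copies of the end of `v`. -/
def IsExit : S.SplitVertex v → Prop
  | .inr (.inr _) => True
  | _ => False

/-- The vertex is a distributing vertex of `S` or a copy of the beginning of `v`. These are the
distributing vertices of the split graph. -/
def IsForward : S.SplitVertex v → Prop
  | .inl a => S.IsDistributing a.1
  | .inr (.inl _) => True
  | .inr (.inr _) => False

theorem not_isExit_of_isForward {z : S.SplitVertex v} (h : IsForward z) : ¬ IsExit z := by
  rcases z with a | x | y
  exacts [id, id, fun _ => h]

theorem not_isEntry_of_not_isForward {z : S.SplitVertex v} (h : ¬ IsForward z) : ¬ IsEntry z := by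
  rcases z with a | x | y
  exacts [id, h, id]

section Incidence

variable (hv : S.IsSupportEdge v)

theorem src_ne_tgt (hv : S.IsSupportEdge v) : S.src v ≠ S.tgt v :=
  fun h => hv.2.not_isCollecting (h ▸ hv.1)

theorem inEdge_ne (hv : S.IsSupportEdge v) (x : S.InEdge v) : x.1 ≠ v :=
  fun h => src_ne_tgt hv (by rw [← x.2, h])

theorem outEdge_ne (hv : S.IsSupportEdge v) (y : S.OutEdge v) : y.1 ≠ v :=
  fun h => src_ne_tgt hv (by rw [← y.2, h])

theorem split_src_inl_of_eq {e : {e : E // e ≠ v}} (h : S.src e.1 = S.tgt v) :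
    (S.split v hv).src (.inl e) = .inr (.inr ⟨e.1, h⟩) := dif_pos h

theorem split_src_inl_of_ne {e : {e : E // e ≠ v}} (h : S.src e.1 ≠ S.tgt v) :
    (S.split v hv).src (.inl e) = .inl ⟨S.src e.1, src_ne_of_ne hv e.2, h⟩ := dif_neg h

theorem split_tgt_inl_of_eq {e : {e : E // e ≠ v}} (h : S.tgt e.1 = S.src v) :
    (S.split v hv).tgt (.inl e) = .inr (.inl ⟨e.1, h⟩) := dif_pos h

theorem split_tgt_inl_of_ne {e : {e : E // e ≠ v}} (h : S.tgt e.1 ≠ S.src v) :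
    (S.split v hv).tgt (.inl e) = .inl ⟨S.tgt e.1, h, tgt_ne_of_ne hv e.2⟩ := dif_neg h

theorem split_src_inr (x : S.InEdge v) (y : S.OutEdge v) :
    (S.split v hv).src (.inr (x, y)) = .inr (.inl x) := rfl

theorem split_tgt_inr (x : S.InEdge v) (y : S.OutEdge v) :
    (S.split v hv).tgt (.inr (x, y)) = .inr (.inr y) := rfl

theorem not_isEntry_src_inl (e : {e : E // e ≠ v}) : ¬ IsEntry ((S.split v hv).src (.inl e)) := by
  by_cases h : S.src e.1 = S.tgt v
  · rw [split_src_inl_of_eq hv h]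
    exact id
  · rw [split_src_inl_of_ne hv h]
    exact id

theorem not_isExit_tgt_inl (e : {e : E // e ≠ v}) : ¬ IsExit ((S.split v hv).tgt (.inl e)) := by
  by_cases h : S.tgt e.1 = S.src v
  · rw [split_tgt_inl_of_eq hv h]
    exact id
  · rw [split_tgt_inl_of_ne hv h]
    exact id

theorem exists_inl_of_src {e : S.SplitEdge v} (h : ¬ IsEntry ((S.split v hv).src e)) :
    ∃ e', e = .inl e' := by
  rcases e with e | ⟨x, y⟩
  · exact ⟨e, rfl⟩
  · exact absurd trivial h

theorem exists_inl_of_tgt {e : S.SplitEdge v} (h : ¬ IsExit ((S.split v hv).tgt e)) :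
    ∃ e', e = .inl e' := by
  rcases e with e | ⟨x, y⟩
  · exact ⟨e, rfl⟩
  · exact absurd trivial h

theorem exists_inl_of_proj {e : S.SplitEdge v} (h : proj e ≠ v) : ∃ e', e = .inl e' := by
  rcases e with e | e
  · exact ⟨e, rfl⟩
  · exact absurd rfl h

theorem split_src_eq_inl {e : S.SplitEdge v} {a} (h : (S.split v hv).src e = .inl a) :
    ∃ e' : {e : E // e ≠ v}, e = .inl e' ∧ S.src e'.1 = a.1 := by
  rcases e with e | ⟨x, y⟩
  · by_cases he : S.src e.1 = S.tgt v
    · rw [split_src_inl_of_eq hv he] at h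
      cases h
    · rw [split_src_inl_of_ne hv he] at h
      cases h
      exact ⟨e, rfl, rfl⟩
  · cases h

theorem split_src_eq_entry {e : S.SplitEdge v} {x} (h : (S.split v hv).src e = .inr (.inl x)) :
    ∃ y, e = .inr (x, y) := by
  rcases e with e | ⟨x', y⟩
  · exact (not_isEntry_src_inl hv e (by rw [h]; trivial)).elim
  · cases h
    exact ⟨y, rfl⟩

theorem split_src_eq_exit {e : S.SplitEdge v} {y} (h : (S.split v hv).src e = .inr (.inr y)) :
    e = .inl ⟨y.1, outEdge_ne hv y⟩ := by
  rcases e with e | ⟨x, y⟩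
  · by_cases he : S.src e.1 = S.tgt v
    · rw [split_src_inl_of_eq hv he] at h
      cases h
      rfl
    · rw [split_src_inl_of_ne hv he] at h
      cases h
  · cases h

theorem split_tgt_eq_inl {e : S.SplitEdge v} {a} (h : (S.split v hv).tgt e = .inl a) :
    ∃ e' : {e : E // e ≠ v}, e = .inl e' ∧ S.tgt e'.1 = a.1 := by
  rcases e with e | ⟨x, y⟩
  · by_cases he : S.tgt e.1 = S.src v
    · rw [split_tgt_inl_of_eq hv he] at h
      cases h
    · rw [split_tgt_inl_of_ne hv he] at h
      cases h
      exact ⟨e, rfl, rfl⟩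
  · cases h

theorem split_tgt_eq_exit {e : S.SplitEdge v} {y} (h : (S.split v hv).tgt e = .inr (.inr y)) :
    ∃ x, e = .inr (x, y) := by
  rcases e with e | ⟨x', y⟩
  · exact (not_isExit_tgt_inl hv e (by rw [h]; trivial)).elim
  · cases h
    exact ⟨x', rfl⟩

theorem split_tgt_eq_entry {e : S.SplitEdge v} {x} (h : (S.split v hv).tgt e = .inr (.inl x)) :
    e = .inl ⟨x.1, inEdge_ne hv x⟩ := by
  rcases e with e | ⟨x, y⟩
  · by_cases he : S.tgt e.1 = S.src v
    · rw [split_tgt_inl_of_eq hv he] at h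
      cases h
      rfl
    · rw [split_tgt_inl_of_ne hv he] at h
      cases h
  · cases h

theorem split_src_outEdge (y : S.OutEdge v) :
    (S.split v hv).src (.inl ⟨y.1, outEdge_ne hv y⟩) = .inr (.inr y) :=
  split_src_inl_of_eq hv y.2

theorem split_tgt_inEdge (x : S.InEdge v) :
    (S.split v hv).tgt (.inl ⟨x.1, inEdge_ne hv x⟩) = .inr (.inl x) :=
  split_tgt_inl_of_eq hv x.2

theorem projVertex_src (e : S.SplitEdge v) :
    projVertex ((S.split v hv).src e) = S.src (proj e) := by
  rcases e with e | ⟨x, y⟩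
  · by_cases h : S.src e.1 = S.tgt v
    · rw [split_src_inl_of_eq hv h]
      exact h.symm
    · rw [split_src_inl_of_ne hv h]
      rfl
  · rfl

theorem projVertex_tgt (e : S.SplitEdge v) :
    projVertex ((S.split v hv).tgt e) = S.tgt (proj e) := by
  rcases e with e | ⟨x, y⟩
  · by_cases h : S.tgt e.1 = S.src v
    · rw [split_tgt_inl_of_eq hv h]
      exact h.symm
    · rw [split_tgt_inl_of_ne hv h]
      rfl
  · rfl

theorem isWalk_map_proj {a b : S.SplitVertex v} {p : List (S.SplitEdge v)}
    (h : (S.split v hv).IsWalk a p b) :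
    S.IsWalk (projVertex a) (p.map proj) (projVertex b) := by
  induction p generalizing a with
  | nil => exact congrArg projVertex h
  | cons e p ih =>
    obtain ⟨rfl, h2⟩ := h
    refine ⟨(projVertex_src hv e).symm, ?_⟩
    rw [← projVertex_tgt hv]
    exact ih h2

theorem bijOn_proj_src (a) :
    Set.BijOn proj {e | (S.split v hv).src e = .inl a} {e | S.src e = a.1} := by
  refine ⟨?_, ?_, ?_⟩
  · intro e he
    obtain ⟨e, rfl, he'⟩ := split_src_eq_inl hv he
    exact he'
  · intro e he f hf hef
    obtain ⟨e, rfl, -⟩ := split_src_eq_inl hv he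
    obtain ⟨f, rfl, -⟩ := split_src_eq_inl hv hf
    exact congrArg Sum.inl (Subtype.ext hef)
  · intro e he
    exact ⟨.inl ⟨e, fun h => a.2.1 (by rw [← show S.src e = a.1 from he, h])⟩,
      (split_src_inl_of_ne hv (by rw [show S.src e = a.1 from he]; exact a.2.2)).trans
        (congrArg Sum.inl (Subtype.ext he)), rfl⟩

theorem bijOn_proj_tgt (a) :
    Set.BijOn proj {e | (S.split v hv).tgt e = .inl a} {e | S.tgt e = a.1} := by
  refine ⟨?_, ?_, ?_⟩
  · intro e he
    obtain ⟨e, rfl, he'⟩ := split_tgt_eq_inl hv he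
    exact he'
  · intro e he f hf hef
    obtain ⟨e, rfl, -⟩ := split_tgt_eq_inl hv he
    obtain ⟨f, rfl, -⟩ := split_tgt_eq_inl hv hf
    exact congrArg Sum.inl (Subtype.ext hef)
  · intro e he
    exact ⟨.inl ⟨e, fun h => a.2.2 (by rw [← show S.tgt e = a.1 from he, h])⟩,
      (split_tgt_inl_of_ne hv (by rw [show S.tgt e = a.1 from he]; exact a.2.1)).trans
        (congrArg Sum.inl (Subtype.ext he)), rfl⟩

theorem isDistributing_split {z : S.SplitVertex v} (hz : IsForward z) :
    (S.split v hv).IsDistributing z := by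
  rcases z with a | x | y
  · exact MultiDigraph.IsDistributing.of_bijOn (H := S.toMultiDigraph) hz
      (bijOn_proj_src hv a) (bijOn_proj_tgt hv a)
  · refine ⟨⟨_, split_tgt_inEdge hv x, fun e he => split_tgt_eq_entry hv he⟩, ?_⟩
    obtain ⟨e, he, f, hf, hne⟩ := hv.2.2
    refine ⟨.inr (x, ⟨e, he⟩), rfl, .inr (x, ⟨f, hf⟩), rfl, fun h => hne ?_⟩
    cases h
    rfl
  · exact hz.elim

theorem isCollecting_split (hS : ∀ a, S.IsDistributing a ∨ S.IsCollecting a)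
    {z : S.SplitVertex v} (hz : ¬ IsForward z) : (S.split v hv).IsCollecting z := by
  rcases z with a | x | y
  · exact MultiDigraph.IsCollecting.of_bijOn (H := S.toMultiDigraph)
      ((hS a.1).resolve_left hz) (bijOn_proj_src hv a) (bijOn_proj_tgt hv a)
  · exact absurd trivial hz
  · refine ⟨?_, ⟨_, split_src_outEdge hv y, fun e he => split_src_eq_exit hv he⟩⟩
    obtain ⟨e, he, f, hf, hne⟩ := hv.1.1
    refine ⟨.inr (⟨e, he⟩, y), rfl, .inr (⟨f, hf⟩, y), rfl, fun h => hne ?_⟩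
    cases h
    rfl

/-! ### Lifting paths to the split graph -/

/-- In the split graph, `v` can only be passed between the edges that belong to the copy of `v`. -/
theorem exists_around_inr {a b : S.SplitVertex v} {p q : List (S.SplitEdge v)} {x : S.InEdge v}
    {y : S.OutEdge v} (h : (S.split v hv).IsWalk a (p ++ .inr (x, y) :: q) b)
    (ha : ¬ IsEntry a) (hb : ¬ IsExit b) :
    ∃ p' q', p = p' ++ [.inl ⟨x.1, inEdge_ne hv x⟩] ∧ q = .inl ⟨y.1, outEdge_ne hv y⟩ :: q' := by
  obtain ⟨_, hp, rfl, hq⟩ := MultiDigraph.isWalk_append.1 h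
  obtain ⟨p', rfl⟩ : ∃ p', p = p' ++ [.inl ⟨x.1, inEdge_ne hv x⟩] := by
    rcases List.eq_nil_or_concat' p with rfl | ⟨p, e, rfl⟩
    · rw [MultiDigraph.isWalk_nil] at hp
      exact (ha (by rw [hp]; trivial)).elim
    · rw [MultiDigraph.isWalk_concat] at hp
      exact ⟨p, by rw [split_tgt_eq_entry hv hp.2]⟩
  refine ⟨p', ?_⟩
  cases q with
  | nil =>
    rw [MultiDigraph.isWalk_nil] at hq
    exact (hb (by rw [← hq]; trivial)).elim
  | cons f q => exact ⟨q, rfl, by rw [split_src_eq_exit hv hq.1]⟩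

/-- A path of `S` that follows an edge other than `v` and does not end with `v` lifts to the split
graph: where it passes `v`, its neighbouring edges select the copy of `v`. -/
theorem exists_lift (t : List E) (e : {e : E // e ≠ v}) {b : V} (ht : S.IsWalk (S.tgt e.1) t b)
    (hl : ∀ f ∈ t.getLast?, f ≠ v) :
    ∃ p z, (S.split v hv).IsWalk ((S.split v hv).tgt (.inl e)) p z ∧ p.map proj = t := by
  induction hn : t.length using Nat.strong_induction_on generalizing t e with
  | _ n ih =>
  subst hn
  cases t with
  | nil => exact ⟨[], _, rfl, rfl⟩
  | cons f t =>
    by_cases hf : f = v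
    · subst hf
      cases t with
      | nil => exact absurd rfl (hl f (by simp))
      | cons y t =>
        have hx : S.tgt e.1 = S.src f := ht.1.symm
        have hy : S.src y = S.tgt f := ht.2.1
        have hyf : y ≠ f := outEdge_ne hv ⟨y, hy⟩
        obtain ⟨p, z, hp, hpt⟩ := ih t.length (by simp only [List.length_cons]; omega) t ⟨y, hyf⟩
          ht.2.2 (by
            intro g hg
            refine hl g ?_
            rw [Option.mem_def] at hg ⊢
            rw [List.getLast?_cons_cons, List.getLast?_cons, hg]
            rfl) rfl
        refine ⟨.inr (⟨e.1, hx⟩, ⟨y, hy⟩) :: .inl ⟨y, hyf⟩ :: p, z, ⟨?_, ?_, hp⟩, ?_⟩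
        · rw [split_tgt_inl_of_eq hv hx]
          rfl
        · exact split_src_outEdge hv ⟨y, hy⟩
        · simp [proj, hpt]
    · obtain ⟨p, z, hp, hpt⟩ := ih t.length (by simp) t ⟨f, hf⟩ ht.2 (by
        intro g hg
        refine hl g ?_
        rw [Option.mem_def] at hg ⊢
        rw [List.getLast?_cons, hg]
        rfl) rfl
      refine ⟨.inl ⟨f, hf⟩ :: p, z, ⟨?_, hp⟩, by simp [proj, hpt]⟩
      have hs : S.src f ≠ S.tgt v := fun h => tgt_ne_of_ne hv e.2 (ht.1.symm.trans h)
      have hs' : S.tgt e.1 ≠ S.src v := fun h => src_ne_of_ne hv hf (ht.1.trans h)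
      rw [split_src_inl_of_ne hv hs, split_tgt_inl_of_ne hv hs']
      exact congrArg Sum.inl (Subtype.ext ht.1)

/-- Walks with the same start and the same projection coincide, unless they end inside a copy
of `v`. -/
theorem eq_of_map_proj_eq_of_start {z b c : S.SplitVertex v} {p q : List (S.SplitEdge v)}
    (hp : (S.split v hv).IsWalk z p b) (hq : (S.split v hv).IsWalk z q c) (hb : ¬ IsExit b)
    (h : p.map proj = q.map proj) : p = q := by
  induction p generalizing z q with
  | nil => simpa using h.symm
  | cons f p ih =>
    cases q with
    | nil => simp at h
    | cons g q =>
      rw [List.map_cons, List.map_cons, List.cons.injEq] at h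
      obtain ⟨hfg, h⟩ := h
      obtain rfl : f = g := by
        rcases f with f | ⟨x, y⟩ <;> rcases g with g | ⟨x', y'⟩
        · exact congrArg Sum.inl (Subtype.ext hfg)
        · exact absurd hfg f.2
        · exact absurd hfg.symm g.2
        · have hx : x = x' := by
            have := hp.1.trans hq.1.symm
            rw [split_src_inr, split_src_inr] at this
            cases this
            rfl
          cases p with
          | nil =>
            exact (hb (by rw [← show (S.split v hv).tgt (.inr (x, y)) = b from hp.2]; trivial)).elim
          | cons f p =>
            cases q with
            | nil => simp at h
            | cons g q =>
              obtain rfl := split_src_eq_exit hv hp.2.1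
              obtain ⟨g, rfl⟩ := exists_inl_of_proj (e := g) (by
                rw [List.map_cons, List.map_cons, List.cons.injEq] at h
                rw [← h.1]
                exact outEdge_ne hv y)
              obtain ⟨rfl⟩ := Sum.inl.inj (split_src_eq_exit hv hq.2.1)
              rw [List.map_cons, List.map_cons, List.cons.injEq] at h
              have hy : y = y' := Subtype.ext h.1
              rw [hx, hy]
      rw [ih hp.2 hq.2 h]

/-- A path of the split graph that neither starts nor ends inside a copy of `v` is determined by
its projection. -/
theorem eq_of_map_proj_eq {a b a' b' : S.SplitVertex v} {p q : List (S.SplitEdge v)}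
    (hp : (S.split v hv).IsWalk a p b) (hq : (S.split v hv).IsWalk a' q b') (ha : ¬ IsEntry a)
    (hb : ¬ IsExit b) (h : p.map proj = q.map proj) : p = q := by
  cases p with
  | nil => simpa using h.symm
  | cons f p =>
    cases q with
    | nil => simp at h
    | cons g q =>
      have h' := h
      rw [List.map_cons, List.map_cons, List.cons.injEq] at h'
      obtain ⟨f, rfl⟩ := exists_inl_of_src hv (hp.1.symm ▸ ha)
      obtain ⟨g, rfl⟩ := exists_inl_of_proj (e := g) (by rw [← h'.1]; exact f.2)
      obtain rfl : f = g := Subtype.ext h'.1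
      exact eq_of_map_proj_eq_of_start hv hp (show (S.split v hv).IsWalk a _ b' from
        ⟨hp.1, hq.2⟩) hb h

/-! ### Words of paths in the split graph -/

theorem frontTerm_split_inl (e : {e : E // e ≠ v}) (h : S.src e.1 ≠ S.tgt v)
    (hS : ∀ a, S.IsDistributing a ∨ S.IsCollecting a) :
    (S.split v hv).frontTerm (.inl e) = S.frontTerm e.1 := by
  have hsrc := split_src_inl_of_ne hv h
  have hfr : (S.split v hv).front (.inl e) = S.front e.1 := if_neg h
  by_cases hd : S.IsDistributing (S.src e.1)
  · rw [frontTerm_of_isDistributing hd, frontTerm_of_isDistributing, hfr]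
    rw [hsrc]
    exact isDistributing_split hv hd
  · rw [frontTerm_of_not hd, frontTerm_of_not]
    rw [hsrc]
    exact fun h' => h'.not_isCollecting (isCollecting_split hv hS hd)

theorem frontTerm_split_inl_of_eq (e : {e : E // e ≠ v}) (h : S.src e.1 = S.tgt v)
    (hS : ∀ a, S.IsDistributing a ∨ S.IsCollecting a) :
    (S.split v hv).frontTerm (.inl e) = [] := by
  refine frontTerm_of_not ?_
  rw [split_src_inl_of_eq hv h]
  exact fun h' => h'.not_isCollecting (isCollecting_split hv hS id)

theorem frontTerm_split_inr (x : S.InEdge v) (y : S.OutEdge v) :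
    (S.split v hv).frontTerm (.inr (x, y)) = S.front y.1 :=
  frontTerm_of_isDistributing (isDistributing_split hv (z := .inr (.inl x)) trivial)

theorem backTerm_split_inl (e : {e : E // e ≠ v}) (h : S.tgt e.1 ≠ S.src v)
    (hS : ∀ a, S.IsDistributing a ∨ S.IsCollecting a) :
    (S.split v hv).backTerm (.inl e) = S.backTerm e.1 := by
  have htgt := split_tgt_inl_of_ne hv h
  have hbk : (S.split v hv).back (.inl e) = S.back e.1 := if_neg h
  by_cases hd : S.IsDistributing (S.tgt e.1)
  · rw [backTerm_of_not hd.not_isCollecting, backTerm_of_not]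
    have hf : IsForward ((S.split v hv).tgt (.inl e)) := by
      rw [htgt]
      exact hd
    exact (isDistributing_split hv hf).not_isCollecting
  · rw [backTerm_of_isCollecting ((hS _).resolve_left hd), backTerm_of_isCollecting, hbk]
    rw [htgt]
    exact isCollecting_split hv hS hd

theorem backTerm_split_inl_of_eq (e : {e : E // e ≠ v}) (h : S.tgt e.1 = S.src v) :
    (S.split v hv).backTerm (.inl e) = [] := by
  refine backTerm_of_not ?_
  rw [split_tgt_inl_of_eq hv h]
  exact (isDistributing_split hv (z := .inr (.inl _)) trivial).not_isCollecting

theorem backTerm_split_inr (x : S.InEdge v) (y : S.OutEdge v)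
    (hS : ∀ a, S.IsDistributing a ∨ S.IsCollecting a) :
    (S.split v hv).backTerm (.inr (x, y)) = S.back x.1 :=
  backTerm_of_isCollecting (isCollecting_split hv hS (z := .inr (.inr y)) id)

/-- The front word `F(y)` that the split graph has already read when it arrives at the vertex
`y`. -/
def headDefect : S.SplitVertex v → List A
  | .inr (.inr y) => S.front y.1
  | _ => []

/-- The back word `B(x)` that the split graph has not yet read when it arrives at the vertex
`x`. -/
def tailDefect : S.SplitVertex v → List A
  | .inr (.inl x) => S.back x.1
  | _ => []

theorem headDefect_of_not {z : S.SplitVertex v} (h : ¬ IsExit z) : headDefect z = [] := by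
  rcases z with a | x | y
  exacts [rfl, rfl, absurd trivial h]

theorem tailDefect_of_not {z : S.SplitVertex v} (h : ¬ IsEntry z) : tailDefect z = [] := by
  rcases z with a | x | y
  exacts [rfl, absurd trivial h, rfl]

/-- Passing a copy of `v`, the split graph reads `F(y)` one edge earlier than `S`. -/
theorem flatMap_frontTerm_map_proj (hS : ∀ a, S.IsDistributing a ∨ S.IsCollecting a)
    {a b : S.SplitVertex v} {p : List (S.SplitEdge v)} (hp : (S.split v hv).IsWalk a p b)
    (hb : ¬ IsExit b) :
    (p.map proj).flatMap S.frontTerm =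
      headDefect a ++ p.flatMap (S.split v hv).frontTerm := by
  induction p generalizing a with
  | nil =>
    rw [MultiDigraph.isWalk_nil] at hp
    rw [hp, headDefect_of_not hb]
    rfl
  | cons e p ih =>
    obtain ⟨rfl, hp⟩ := hp
    rw [List.map_cons, List.flatMap_cons, List.flatMap_cons, ih hp]
    rcases e with e | ⟨x, y⟩
    · rw [headDefect_of_not (not_isExit_tgt_inl hv e)]
      by_cases h : S.src e.1 = S.tgt v
      · rw [split_src_inl_of_eq hv h, frontTerm_split_inl_of_eq hv e h hS, proj,
          frontTerm_of_isDistributing (by rw [h]; exact hv.2)]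
        rfl
      · rw [split_src_inl_of_ne hv h, frontTerm_split_inl hv e h hS]
        rfl
    · rw [frontTerm_split_inr, proj, frontTerm_of_not fun h => h.not_isCollecting hv.1]
      rfl

theorem flatMap_backTerm_map_proj (hS : ∀ a, S.IsDistributing a ∨ S.IsCollecting a)
    {a b : S.SplitVertex v} {p : List (S.SplitEdge v)} (hp : (S.split v hv).IsWalk a p b)
    (ha : ¬ IsEntry a) :
    (p.map proj).flatMap S.backTerm =
      p.flatMap (S.split v hv).backTerm ++ tailDefect b := by
  induction p using List.reverseRecOn generalizing b with
  | nil =>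
    rw [MultiDigraph.isWalk_nil] at hp
    rw [← hp, tailDefect_of_not ha]
    rfl
  | append_singleton p e ih =>
    obtain ⟨hp', rfl⟩ := MultiDigraph.isWalk_concat.1 hp
    rw [List.map_append, List.flatMap_append, List.flatMap_append, ih hp', List.map_singleton,
      List.flatMap_singleton, List.flatMap_singleton]
    rcases e with e | ⟨x, y⟩
    · rw [tailDefect_of_not (not_isEntry_src_inl hv e)]
      by_cases h : S.tgt e.1 = S.src v
      · rw [split_tgt_inl_of_eq hv h, backTerm_split_inl_of_eq hv e h, proj,
          backTerm_of_isCollecting (by rw [h]; exact hv.1)]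
        simp [tailDefect]
      · rw [split_tgt_inl_of_ne hv h, backTerm_split_inl hv e h hS]
        simp [tailDefect, proj]
    · rw [backTerm_split_inr hv x y hS, proj, backTerm_of_not hv.2.not_isCollecting]
      simp [tailDefect, split_tgt_inr, split_src_inr]

/-- The copy of `v` that completes a path of the split graph at one of its ends. -/
def cap : S.SplitVertex v → List E
  | .inl _ => []
  | .inr _ => [v]

theorem flatMap_frontTerm_cap (hv : S.IsSupportEdge v) (z : S.SplitVertex v) :
    (cap z).flatMap S.frontTerm = [] := by
  rcases z with a | z
  · rfl
  · rw [cap, List.flatMap_singleton, frontTerm_of_not fun h => h.not_isCollecting hv.1]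

theorem flatMap_backTerm_cap (hv : S.IsSupportEdge v) (z : S.SplitVertex v) :
    (cap z).flatMap S.backTerm = [] := by
  rcases z with a | z
  · rfl
  · rw [cap, List.flatMap_singleton, backTerm_of_not hv.2.not_isCollecting]

theorem frontWord_split (hS : ∀ a, S.IsDistributing a ∨ S.IsCollecting a)
    {a b : S.SplitVertex v} {p : List (S.SplitEdge v)} (hp : (S.split v hv).IsWalk a p b)
    (hne : p ≠ []) (ha : ¬ IsEntry a) (hb : ¬ IsExit b) :
    (S.split v hv).frontWord p = S.frontWord (cap a ++ p.map proj) := by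
  obtain ⟨e, p, rfl⟩ := List.exists_cons_of_ne_nil hne
  obtain ⟨rfl, hp⟩ := hp
  obtain ⟨e, rfl⟩ := exists_inl_of_src hv ha
  have h' := flatMap_frontTerm_map_proj hv hS hp hb
  rw [headDefect_of_not (not_isExit_tgt_inl hv e), List.nil_append] at h'
  rw [frontWord_cons, ← h']
  by_cases h : S.src e.1 = S.tgt v
  · have hfr : (S.split v hv).front (.inl e) = S.front v ++ S.front e.1 := if_pos h
    rw [split_src_inl_of_eq hv h, cap, List.map_cons, proj, List.singleton_append, frontWord_cons,
      List.flatMap_cons, frontTerm_of_isDistributing (by rw [h]; exact hv.2), hfr,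
      List.append_assoc]
  · have hfr : (S.split v hv).front (.inl e) = S.front e.1 := if_neg h
    rw [split_src_inl_of_ne hv h, cap, List.map_cons, proj, List.nil_append, frontWord_cons, hfr]

theorem backWord_split (hS : ∀ a, S.IsDistributing a ∨ S.IsCollecting a)
    (hvv : S.front v = S.back v)
    {a b : S.SplitVertex v} {p : List (S.SplitEdge v)} (hp : (S.split v hv).IsWalk a p b)
    (hne : p ≠ []) (ha : ¬ IsEntry a) (hb : ¬ IsExit b) :
    (S.split v hv).backWord p = S.backWord (p.map proj ++ cap b) := by
  obtain ⟨p, e, rfl⟩ := (List.eq_nil_or_concat' p).resolve_left hne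
  obtain ⟨hp', rfl⟩ := MultiDigraph.isWalk_concat.1 hp
  obtain ⟨e, rfl⟩ := exists_inl_of_tgt hv hb
  have h' := flatMap_backTerm_map_proj hv hS hp' ha
  rw [tailDefect_of_not (not_isEntry_src_inl hv e), List.append_nil] at h'
  rw [backWord_concat, ← h', List.map_append, List.map_singleton]
  by_cases h : S.tgt e.1 = S.src v
  · have hbk : (S.split v hv).back (.inl e) = S.back e.1 ++ S.front v := if_pos h
    rw [split_tgt_inl_of_eq hv h, cap, backWord_concat, List.flatMap_append,
      List.flatMap_singleton, proj, backTerm_of_isCollecting (by rw [h]; exact hv.1), hbk, hvv,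
      List.append_assoc]
  · have hbk : (S.split v hv).back (.inl e) = S.back e.1 := if_neg h
    rw [split_tgt_inl_of_ne hv h, cap, List.append_nil, backWord_concat, hbk, proj]

theorem frontWord_split_inr (hS : ∀ a, S.IsDistributing a ∨ S.IsCollecting a)
    {x : S.InEdge v} {y : S.OutEdge v} {b : S.SplitVertex v} {p : List (S.SplitEdge v)}
    (hp : (S.split v hv).IsWalk (.inr (.inr y)) p b) (hb : ¬ IsExit b) :
    (S.split v hv).frontWord (.inr (x, y) :: p) = S.frontWord (p.map proj) := by
  have h := flatMap_frontTerm_map_proj hv hS hp hb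
  have hw := isWalk_map_proj hv hp
  rw [frontWord_of_isDistributing hw hv.2, h, frontWord_cons]
  rfl

theorem backWord_split_inr (hS : ∀ a, S.IsDistributing a ∨ S.IsCollecting a)
    {x : S.InEdge v} {y : S.OutEdge v} {a : S.SplitVertex v} {p : List (S.SplitEdge v)}
    (hp : (S.split v hv).IsWalk a p (.inr (.inl x))) (ha : ¬ IsEntry a) :
    (S.split v hv).backWord (p ++ [.inr (x, y)]) = S.backWord (p.map proj) := by
  have h := flatMap_backTerm_map_proj hv hS hp ha
  have hw := isWalk_map_proj hv hp
  rw [backWord_of_isCollecting hw hv.1, h, backWord_concat]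
  rfl

end Incidence

end LabeledGraph

namespace LabeledGraph

variable {A V E : Type*} {S : LabeledGraph A V E} {v : E} {W : ℕ → A}

/-! ### The graph of good edges -/

section GoodGraph

variable (hv : S.IsSupportEdge v)

/-- The edge sequence in `S` of a path along good edges. -/
def base (p : List {e : S.SplitEdge v // S.IsGood v W e}) : List E :=
  (p.map Subtype.val).map proj

@[simp] theorem base_append (p q : List {e : S.SplitEdge v // S.IsGood v W e}) :
    base (p ++ q) = base p ++ base q := by simp [base]

@[simp] theorem base_cons (e : {e : S.SplitEdge v // S.IsGood v W e}) (p) :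
    base (e :: p) = proj e.1 :: base p := rfl

@[simp] theorem base_nil : base ([] : List {e : S.SplitEdge v // S.IsGood v W e}) = [] := rfl

theorem isWalk_good {a b : S.SplitVertex v} {p : List {e : S.SplitEdge v // S.IsGood v W e}} :
    (S.goodGraph v W hv).IsWalk a p b ↔ (S.split v hv).IsWalk a (p.map Subtype.val) b :=
  MultiDigraph.isWalk_restrict

theorem isWalk_base {a b : S.SplitVertex v} {p : List {e : S.SplitEdge v // S.IsGood v W e}}
    (h : (S.goodGraph v W hv).IsWalk a p b) :
    S.IsWalk (projVertex a) (base p) (projVertex b) :=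
  isWalk_map_proj hv ((isWalk_good hv).1 h)

theorem bijOn_good_src (a) : Set.BijOn (fun e => proj e.1)
    {e | (S.goodGraph v W hv).src e = .inl a} {e | S.src e = a.1} := by
  have h : Set.BijOn Subtype.val {e | (S.goodGraph v W hv).src e = .inl a}
      {e | (S.split v hv).src e = .inl a} := by
    refine ⟨fun e he => he, Subtype.val_injective.injOn, fun e he => ?_⟩
    obtain ⟨e, rfl, -⟩ := split_src_eq_inl hv he
    exact ⟨⟨.inl e, trivial⟩, he, rfl⟩
  exact (bijOn_proj_src hv a).comp h

theorem bijOn_good_tgt (a) : Set.BijOn (fun e => proj e.1)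
    {e | (S.goodGraph v W hv).tgt e = .inl a} {e | S.tgt e = a.1} := by
  have h : Set.BijOn Subtype.val {e | (S.goodGraph v W hv).tgt e = .inl a}
      {e | (S.split v hv).tgt e = .inl a} := by
    refine ⟨fun e he => he, Subtype.val_injective.injOn, fun e he => ?_⟩
    obtain ⟨e, rfl, -⟩ := split_tgt_eq_inl hv he
    exact ⟨⟨.inl e, trivial⟩, he, rfl⟩
  exact (bijOn_proj_tgt hv a).comp h

theorem isDistributing_good {z : S.SplitVertex v} (hb : (S.goodGraph v W hv).IsBranching z)
    (hz : IsForward z) : (S.goodGraph v W hv).IsDistributing z := by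
  rcases z with a | x | y
  · exact MultiDigraph.IsDistributing.of_bijOn (H := S.toMultiDigraph) hz
      (bijOn_good_src hv a) (bijOn_good_tgt hv a)
  · have huniq : ∃! e, (S.goodGraph v W hv).tgt e = .inr (.inl x) :=
      ⟨⟨.inl ⟨x.1, inEdge_ne hv x⟩, trivial⟩, split_tgt_inEdge hv x,
        fun e he => Subtype.ext (split_tgt_eq_entry hv he)⟩
    refine ⟨huniq, hb.resolve_right ?_⟩
    rintro ⟨e, he, f, hf, hne⟩
    exact hne (huniq.unique he hf)
  · exact hz.elim

theorem isCollecting_good (hS : ∀ a, S.IsDistributing a ∨ S.IsCollecting a)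
    {z : S.SplitVertex v} (hb : (S.goodGraph v W hv).IsBranching z)
    (hz : ¬ IsForward z) : (S.goodGraph v W hv).IsCollecting z := by
  rcases z with a | x | y
  · exact MultiDigraph.IsCollecting.of_bijOn (H := S.toMultiDigraph)
      ((hS a.1).resolve_left hz) (bijOn_good_src hv a) (bijOn_good_tgt hv a)
  · exact absurd trivial hz
  · have huniq : ∃! e, (S.goodGraph v W hv).src e = .inr (.inr y) :=
      ⟨⟨.inl ⟨y.1, outEdge_ne hv y⟩, trivial⟩, split_src_outEdge hv y,
        fun e he => Subtype.ext (split_src_eq_exit hv he)⟩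
    refine ⟨hb.resolve_left ?_, huniq⟩
    rintro ⟨e, he, f, hf, hne⟩
    exact hne (huniq.unique he hf)

/-- Along good edges a walk has a choice only at the distributing vertices of the graph of good
edges. -/
theorem eq_of_src_eq_good (hS : ∀ a, S.IsDistributing a ∨ S.IsCollecting a)
    {e f : {e : S.SplitEdge v // S.IsGood v W e}}
    (hf : ¬ (S.goodGraph v W hv).IsDistributing ((S.goodGraph v W hv).src f))
    (h : (S.goodGraph v W hv).src e = (S.goodGraph v W hv).src f) : e = f := by
  by_cases hb : (S.goodGraph v W hv).IsBranching ((S.goodGraph v W hv).src f)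
  · have hc := isCollecting_good hv hS hb fun hz => hf (isDistributing_good hv hb hz)
    exact hc.2.unique h rfl
  · exact MultiDigraph.eq_of_src_eq hb h

theorem eq_of_tgt_eq_good (hS : ∀ a, S.IsDistributing a ∨ S.IsCollecting a)
    {e f : {e : S.SplitEdge v // S.IsGood v W e}}
    (hf : ¬ (S.goodGraph v W hv).IsCollecting ((S.goodGraph v W hv).tgt f))
    (h : (S.goodGraph v W hv).tgt e = (S.goodGraph v W hv).tgt f) : e = f := by
  by_cases hb : (S.goodGraph v W hv).IsBranching ((S.goodGraph v W hv).tgt f)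
  · have hd := isDistributing_good hv hb
      (not_not.1 fun hz => hf (isCollecting_good hv hS hb hz))
    exact hd.1.unique h rfl
  · exact MultiDigraph.eq_of_tgt_eq hb h

/-! ### Admissible paths along good edges -/

/-- A nonempty path along good edges that does not begin or end inside a copy of `v` and whose
projection to `S` is admissible. -/
def GoodAdmissible (p : List {e : S.SplitEdge v // S.IsGood v W e}) : Prop :=
  p ≠ [] ∧ S.Admissible W (base p) ∧
    ∃ a b, (S.goodGraph v W hv).IsWalk a p b ∧ ¬ IsEntry a ∧ ¬ IsExit b

variable {hv}

theorem head?_base_ne {a b : S.SplitVertex v} {p : List {e : S.SplitEdge v // S.IsGood v W e}}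
    (h : (S.goodGraph v W hv).IsWalk a p b) (ha : ¬ IsEntry a) :
    ∀ e ∈ (base p).head?, e ≠ v := by
  cases p with
  | nil => simp
  | cons f p =>
    intro e he
    obtain rfl : proj f.1 = e := by simpa using he
    obtain ⟨f', hf'⟩ := exists_inl_of_src hv (e := f.1) (h.1.symm ▸ ha)
    rw [hf']
    exact f'.2

theorem getLast?_base_ne {a b : S.SplitVertex v} {p : List {e : S.SplitEdge v // S.IsGood v W e}}
    (h : (S.goodGraph v W hv).IsWalk a p b) (hb : ¬ IsExit b) :
    ∀ e ∈ (base p).getLast?, e ≠ v := by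
  rcases List.eq_nil_or_concat' p with rfl | ⟨p, f, rfl⟩
  · simp
  · intro e he
    obtain rfl : proj f.1 = e := by simpa using he
    obtain ⟨f', hf'⟩ := exists_inl_of_tgt hv (e := f.1)
      ((MultiDigraph.isWalk_concat.1 h).2.symm ▸ hb)
    rw [hf']
    exact f'.2

/-- An admissible path of `S` that does not begin or end with `v` lifts to good edges: where it
passes `v` between `x` and `y`, the word `B(x) F(v) F(y)` is a subword of `W`. -/
theorem IsRauzyScheme.exists_goodAdmissible (hS : S.IsRauzyScheme W) {t : List E}
    (ht : S.Admissible W t) (hne : t ≠ []) (hh : ∀ e ∈ t.head?, e ≠ v)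
    (hl : ∀ e ∈ t.getLast?, e ≠ v) :
    ∃ p, GoodAdmissible (W := W) hv p ∧ base p = t := by
  obtain ⟨e, t, rfl⟩ := List.exists_cons_of_ne_nil hne
  obtain ⟨a, b, hw⟩ := ht.exists_isWalk
  obtain ⟨p, z, hp, rfl⟩ := exists_lift hv t ⟨e, hh e (by simp)⟩ hw.2 (by
    intro f hf
    refine hl f ?_
    rw [Option.mem_def] at hf ⊢
    rw [List.getLast?_cons, hf]
    rfl)
  have hP : (S.split v hv).IsWalk ((S.split v hv).src (.inl ⟨e, hh e (by simp)⟩))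
      (.inl ⟨e, hh e (by simp)⟩ :: p) z := ⟨rfl, hp⟩
  have ha := not_isEntry_src_inl hv ⟨e, hh e (by simp)⟩
  have hmap : (Sum.inl ⟨e, hh e (by simp)⟩ :: p : List (S.SplitEdge v)).map proj
      = e :: p.map proj := rfl
  generalize hPdef : (Sum.inl ⟨e, hh e (by simp)⟩ :: p : List (S.SplitEdge v)) = P at hP hmap
  have hPne : P ≠ [] := by simp [← hPdef]
  rw [← hmap] at ht hl ⊢
  have hz : ¬ IsExit z := by
    obtain ⟨q, f, rfl⟩ := (List.eq_nil_or_concat' P).resolve_left hPne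
    obtain ⟨f, rfl⟩ := exists_inl_of_proj (e := f) (hl _ (by simp))
    rw [← (MultiDigraph.isWalk_concat.1 hP).2]
    exact not_isExit_tgt_inl hv f
  have hgood : ∀ f ∈ P, S.IsGood v W f := by
    rintro (f | ⟨x, y⟩) hf
    · exact trivial
    · obtain ⟨p₁, p₂, rfl⟩ := List.append_of_mem hf
      obtain ⟨q₁, q₂, rfl, rfl⟩ := exists_around_inr hv hP ha hz
      obtain ⟨s, hs, hsw, hts⟩ := ht
      refine hsw.of_infix (hS.crossing_infix hv x.2 y.2 hs (List.IsInfix.trans ?_ hts))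
      exact ⟨q₁.map proj, q₂.map proj, by simp [proj]⟩
  have hval : (P.attachWith (S.IsGood v W) hgood).map Subtype.val = P :=
    List.attachWith_map_subtype_val _
  have hbase : base (P.attachWith (S.IsGood v W) hgood) = P.map proj := by rw [base, hval]
  refine ⟨P.attachWith (S.IsGood v W) hgood, ⟨?_, ?_, _, z, ?_, ha, hz⟩, hbase⟩
  · intro h
    rw [h] at hval
    exact hPne hval.symm
  · rwa [hbase]
  · rw [isWalk_good, hval]
    exact hP

theorem eq_of_base_eq {a b a' b' : S.SplitVertex v}
    {p q : List {e : S.SplitEdge v // S.IsGood v W e}}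
    (hp : (S.goodGraph v W hv).IsWalk a p b) (hq : (S.goodGraph v W hv).IsWalk a' q b')
    (ha : ¬ IsEntry a) (hb : ¬ IsExit b) (h : base p = base q) : p = q :=
  List.map_injective_iff.2 Subtype.val_injective
    (eq_of_map_proj_eq hv ((isWalk_good hv).1 hp) ((isWalk_good hv).1 hq) ha hb h)

/-- An occurrence of `base p` in the projection of a path is the projection of an occurrence
of `p`. -/
theorem exists_of_base_eq {a b a' b' : S.SplitVertex v}
    {p q : List {e : S.SplitEdge v // S.IsGood v W e}}
    (hp : (S.goodGraph v W hv).IsWalk a p b) (hq : (S.goodGraph v W hv).IsWalk a' q b')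
    (ha : ¬ IsEntry a) (hb : ¬ IsExit b) {s t : List E} (h : s ++ base p ++ t = base q) :
    ∃ q₁ q₂, q₁ ++ p ++ q₂ = q ∧ base q₁ = s ∧ base q₂ = t := by
  rw [base, List.map_map] at h
  obtain ⟨q', q₂, rfl, h₁, h₂⟩ := List.append_eq_map_iff.1 (h.trans (List.map_map ..))
  obtain ⟨q₁, m, rfl, h₃, h₄⟩ := List.append_eq_map_iff.1 h₁.symm
  obtain ⟨z, hz, -⟩ := MultiDigraph.isWalk_append.1 hq
  obtain ⟨z', -, hm⟩ := MultiDigraph.isWalk_append.1 hz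
  obtain rfl : p = m := eq_of_base_eq hp hm ha hb
    (by rw [base, base, List.map_map, List.map_map, h₄])
  exact ⟨q₁, q₂, rfl, by rw [base, List.map_map, h₃], by rw [base, List.map_map, h₂]⟩

theorem IsRauzyScheme.exists_goodAdmissible_append (hS : S.IsRauzyScheme W) (hW : IsRecurrent W)
    {p q : List {e : S.SplitEdge v // S.IsGood v W e}} (hp : GoodAdmissible hv p)
    (hq : GoodAdmissible hv q) : ∃ m, GoodAdmissible hv (p ++ m ++ q) := by
  obtain ⟨hpne, hpa, a, b, hpw, ha, hb⟩ := hp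
  obtain ⟨hqne, hqa, c, d, hqw, hc, hd⟩ := hq
  obtain ⟨m, hm⟩ := hS.exists_admissible_append hW hpa hqa
  have hpb : base p ≠ [] := by simpa [base] using hpne
  have hqb : base q ≠ [] := by simpa [base] using hqne
  obtain ⟨r, hr, hrb⟩ := hS.exists_goodAdmissible (hv := hv) hm (by simp [hpb])
    (by
      rw [List.append_assoc, List.head?_append_of_ne_nil _ hpb]
      exact head?_base_ne hpw ha)
    (by
      rw [List.getLast?_append_of_ne_nil _ hqb]
      exact getLast?_base_ne hqw hd)
  have hr' := hr
  obtain ⟨-, -, a', d', hrw, ha', hd'⟩ := hr'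
  obtain ⟨r₁, r₂, rfl, h₁, h₂⟩ := exists_of_base_eq (s := []) (t := m ++ base q) hpw hrw ha hb
    (by rw [hrb]; simp)
  obtain rfl : r₁ = [] := by simpa [base] using h₁
  obtain ⟨z, -, hz⟩ := MultiDigraph.isWalk_append.1 hrw
  obtain ⟨m', r₃, rfl, h₃, h₄⟩ := exists_of_base_eq (s := m) (t := []) hqw hz hc hd
    (by rw [h₂]; simp)
  obtain rfl : r₃ = [] := by simpa [base] using h₄
  refine ⟨m', ?_⟩
  simpa using hr

/-- Every good edge lies on an admissible path along good edges. -/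
theorem IsRauzyScheme.exists_goodAdmissible_mem (hS : S.IsRauzyScheme W) (hW : IsRecurrent W)
    (e : {e : S.SplitEdge v // S.IsGood v W e}) :
    ∃ p q, GoodAdmissible hv (p ++ e :: q) := by
  obtain ⟨e | ⟨x, y⟩, he⟩ := e
  · exact ⟨[], [], by simp, hS.admissible_edge hW e.1, _, _, ⟨rfl, rfl⟩,
      not_isEntry_src_inl hv e, not_isExit_tgt_inl hv e⟩
  · refine ⟨[⟨.inl ⟨x.1, inEdge_ne hv x⟩, trivial⟩], [⟨.inl ⟨y.1, outEdge_ne hv y⟩, trivial⟩],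
      by simp, hS.admissible_crossing hW hv x.2 y.2 he, _, _,
      ⟨rfl, (split_tgt_inEdge hv x).symm, split_src_outEdge hv y, rfl⟩,
      not_isEntry_src_inl hv _, not_isExit_tgt_inl hv _⟩

theorem IsRauzyScheme.exists_long_goodAdmissible (hS : S.IsRauzyScheme W) (hW : IsRecurrent W)
    (e : {e : S.SplitEdge v // S.IsGood v W e}) (n : ℕ) :
    ∃ p q, n ≤ p.length ∧ n ≤ q.length ∧ GoodAdmissible hv (p ++ e :: q) := by
  obtain ⟨p₀, q₀, h₀⟩ := hS.exists_goodAdmissible_mem (hv := hv) hW e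
  induction n with
  | zero => exact ⟨p₀, q₀, Nat.zero_le _, Nat.zero_le _, h₀⟩
  | succ n ih =>
    obtain ⟨p, q, hp, hq, h⟩ := ih
    obtain ⟨m, hm⟩ := hS.exists_goodAdmissible_append hW h₀ h
    obtain ⟨m', hm'⟩ := hS.exists_goodAdmissible_append hW hm h₀
    refine ⟨p₀ ++ e :: q₀ ++ m ++ p, q ++ m' ++ p₀ ++ e :: q₀, ?_, ?_, by simpa using hm'⟩ <;>
    · simp only [List.length_append, List.length_cons]
      omega

theorem IsRauzyScheme.exists_goodWalk (hS : S.IsRauzyScheme W) (hW : IsRecurrent W)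
    (e f : {e : S.SplitEdge v // S.IsGood v W e}) :
    ∃ p, (S.goodGraph v W hv).IsWalk ((S.goodGraph v W hv).tgt e) p
      ((S.goodGraph v W hv).src f) := by
  obtain ⟨p, q, h₁⟩ := hS.exists_goodAdmissible_mem (hv := hv) hW e
  obtain ⟨p', q', h₂⟩ := hS.exists_goodAdmissible_mem (hv := hv) hW f
  obtain ⟨m, -, -, a, b, hw, -, -⟩ := hS.exists_goodAdmissible_append hW h₁ h₂
  have hsplit : p ++ e :: q ++ m ++ (p' ++ f :: q') = p ++ e :: ((q ++ m ++ p') ++ f :: q') := by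
    simp
  rw [hsplit] at hw
  obtain ⟨_, -, -, hw⟩ := MultiDigraph.isWalk_append.1 hw
  obtain ⟨_, hw, rfl, -⟩ := MultiDigraph.isWalk_append.1 hw
  exact ⟨_, hw⟩

theorem exists_good_incident (hS : S.IsRauzyScheme W) (z : S.SplitVertex v) :
    ∃ e, (S.goodGraph v W hv).src e = z ∨ (S.goodGraph v W hv).tgt e = z := by
  rcases z with a | x | y
  · rcases hS.isGraphWithWords.distributing_or_collecting a.1 with h | h
    · obtain ⟨e, he, -⟩ := h.2
      obtain ⟨e', he', -⟩ := (bijOn_good_src (W := W) hv a).surjOn he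
      exact ⟨e', Or.inl he'⟩
    · obtain ⟨e, he, -⟩ := h.1
      obtain ⟨e', he', -⟩ := (bijOn_good_tgt (W := W) hv a).surjOn he
      exact ⟨e', Or.inr he'⟩
  · exact ⟨⟨.inl ⟨x.1, inEdge_ne hv x⟩, trivial⟩, Or.inr (split_tgt_inEdge hv x)⟩
  · exact ⟨⟨.inl ⟨y.1, outEdge_ne hv y⟩, trivial⟩, Or.inl (split_src_outEdge hv y)⟩

theorem IsRauzyScheme.exists_good_src (hS : S.IsRauzyScheme W) (hW : IsRecurrent W)
    (z : S.SplitVertex v) : ∃ e, (S.goodGraph v W hv).src e = z := by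
  obtain ⟨e, he | he⟩ := exists_good_incident (hv := hv) hS z
  · exact ⟨e, he⟩
  · obtain ⟨p, hp⟩ := hS.exists_goodWalk (hv := hv) hW e e
    rw [he] at hp
    cases p with
    | nil => exact ⟨e, hp.symm⟩
    | cons f p => exact ⟨f, hp.1⟩

theorem IsRauzyScheme.exists_good_tgt (hS : S.IsRauzyScheme W) (hW : IsRecurrent W)
    (z : S.SplitVertex v) : ∃ e, (S.goodGraph v W hv).tgt e = z := by
  obtain ⟨e, he | he⟩ := exists_good_incident (hv := hv) hS z
  · obtain ⟨p, hp⟩ := hS.exists_goodWalk (hv := hv) hW e e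
    rw [he] at hp
    rcases List.eq_nil_or_concat' p with rfl | ⟨p, f, rfl⟩
    · exact ⟨e, hp⟩
    · exact ⟨f, (MultiDigraph.isWalk_concat.1 hp).2⟩
  · exact ⟨e, he⟩

theorem IsRauzyScheme.goodGraph_stronglyConnected (hS : S.IsRauzyScheme W)
    (hW : IsRecurrent W) : (S.goodGraph v W hv).StronglyConnected := by
  rw [MultiDigraph.stronglyConnected_iff]
  intro a b
  obtain ⟨e, rfl⟩ := hS.exists_good_tgt (hv := hv) hW a
  obtain ⟨f, rfl⟩ := hS.exists_good_src (hv := hv) hW b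
  exact hS.exists_goodWalk hW e f

theorem IsRauzyScheme.exists_isBranching (hS : S.IsRauzyScheme W) (hW : IsRecurrent W)
    (hper : ¬ S.RevealsPeriodicity v W hv) : ∃ z, (S.goodGraph v W hv).IsBranching z := by
  by_contra hcon
  push Not at hcon
  refine hper ⟨hS.goodGraph_stronglyConnected hW, fun z => ⟨?_, ?_⟩⟩
  · obtain ⟨e, rfl⟩ := hS.exists_good_src (hv := hv) hW z
    exact ⟨e, rfl, fun f hf => MultiDigraph.eq_of_src_eq (hcon _) hf⟩
  · obtain ⟨e, rfl⟩ := hS.exists_good_tgt (hv := hv) hW z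
    exact ⟨e, rfl, fun f hf => MultiDigraph.eq_of_tgt_eq (hcon _) hf⟩

end GoodGraph

end LabeledGraph

/-! ### Words defined by natural continuations -/

namespace MultiDigraph

variable {V E : Type*} {G : MultiDigraph V E}

/-- A walk that leaves vertices of outgoing degree one until it reaches a distributing vertex is
the beginning of every walk from the same vertex to a distributing vertex. -/
theorem prefix_of_not_isDistributing (hG : ∀ a, G.IsDistributing a ∨ G.IsCollecting a)
    {a b c : V} {p q : List E} (hp : G.IsWalk a p b) (hq : G.IsWalk a q c)
    (hc : G.IsDistributing c) (hforced : ∀ f ∈ p, ¬ G.IsDistributing (G.src f)) : p <+: q := by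
  induction p generalizing a q with
  | nil => exact List.nil_prefix
  | cons f p ih =>
    have hf := hforced f (by simp)
    cases q with
    | nil =>
      rw [isWalk_nil] at hq
      exact absurd (by rw [hp.1, hq]; exact hc) hf
    | cons g q =>
      obtain rfl : g = f := ((hG _).resolve_left hf).2.unique (hq.1.trans hp.1.symm) rfl
      rw [List.cons_prefix_cons]
      exact ⟨rfl, ih hp.2 hq.2 fun f hf => hforced f (by simp [hf])⟩

end MultiDigraph

namespace LabeledGraph

section Continuation

variable {A V₁ E₁ V₂ E₂ : Type*} {H : LabeledGraph A V₁ E₁} {H' : LabeledGraph A V₂ E₂}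

/-- Suppose that each edge of `H` stands for a path of `H'`, and that its front word is the front
word in `H'` of its natural continuation to the right. Then the front word of each path of `H` that
ends in a distributing vertex is the front word of the corresponding path of `H'`: such a path is
a concatenation of natural continuations of edges. -/
theorem frontWord_eq_frontWord_flatMap (hH : ∀ a, H.IsDistributing a ∨ H.IsCollecting a)
    (l : E₁ → List E₂)
    (hl : ∀ d, ∃ e p, l d = e :: p ∧ (H.IsDistributing (H.src d) → H'.IsDistributing (H'.src e)))
    (hF : ∀ d, ∃ q, H.IsRightContinuation [d] q ∧ H.front d = H'.frontWord (q.flatMap l))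
    {a b : V₁} {p : List E₁} (hp : H.IsWalk a p b) (hb : H.IsDistributing b) :
    H.frontWord p = H'.frontWord (p.flatMap l) := by
  induction hn : p.length using Nat.strong_induction_on generalizing a p with
  | _ n ih =>
  subst hn
  cases p with
  | nil => rfl
  | cons d p =>
    obtain ⟨_, hq, hd⟩ := hF d
    obtain ⟨q, c, rfl, hqw, hc, hq'⟩ := hq.exists_eq_cons
    obtain ⟨r, rfl⟩ := MultiDigraph.prefix_of_not_isDistributing hH hqw.2 hp.2 hb hq'
    obtain ⟨z, hz, hr⟩ := MultiDigraph.isWalk_append.1 hp.2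
    obtain rfl : z = c := hz.end_unique hqw.2
    have hq0 : q.flatMap H.frontTerm = [] :=
      List.flatMap_eq_nil_iff.2 fun f hf => frontTerm_of_not (hq' f hf)
    have hne : (d :: q).flatMap l ≠ [] := by
      obtain ⟨e, t, het, -⟩ := hl d
      simp [het]
    have hr' : H'.frontWord (r.flatMap l) = (r.flatMap l).flatMap H'.frontTerm := by
      cases r with
      | nil => rfl
      | cons d' r =>
        obtain ⟨e, t, het, he⟩ := hl d'
        rw [List.flatMap_cons, het, List.cons_append, frontWord_cons, List.flatMap_cons,
          frontTerm_of_isDistributing (he (by rw [hr.1]; exact hc))]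
    rw [← List.cons_append, frontWord_append (by simp), List.flatMap_append,
      frontWord_append hne, ← hr', ← ih r.length (by simp) hr rfl,
      frontWord_of_isDistributing hr hc, frontWord_cons, hq0, List.append_nil, hd]

/-- The mirror image of `frontWord_eq_frontWord_flatMap`. -/
theorem backWord_eq_backWord_flatMap (hH : ∀ a, H.IsDistributing a ∨ H.IsCollecting a)
    (l : E₁ → List E₂)
    (hl : ∀ d, ∃ p e, l d = p ++ [e] ∧ (H.IsCollecting (H.tgt d) → H'.IsCollecting (H'.tgt e)))
    (hB : ∀ d, ∃ q, H.IsLeftContinuation [d] q ∧ H.back d = H'.backWord (q.flatMap l))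
    {a b : V₁} {p : List E₁} (hp : H.IsWalk a p b) (ha : H.IsCollecting a) :
    H.backWord p = H'.backWord (p.flatMap l) := by
  have hrev : ∀ q : List E₁,
      q.reverse.flatMap (fun d => (l d).reverse) = (q.flatMap l).reverse := by
    intro q
    rw [List.reverse_flatMap]
    rfl
  have := frontWord_eq_frontWord_flatMap (H := H.reverse) (H' := H'.reverse)
    (fun a => (hH a).symm.imp MultiDigraph.isDistributing_reverse.2
      MultiDigraph.isCollecting_reverse.2) (fun d => (l d).reverse)
    (fun d => by
      obtain ⟨p, e, h1, h2⟩ := hl d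
      exact ⟨e, p.reverse, by simp [h1], fun h => MultiDigraph.isDistributing_reverse.2
        (h2 (MultiDigraph.isDistributing_reverse.1 h))⟩)
    (fun d => by
      obtain ⟨q, h1, h2⟩ := hB d
      refine ⟨q.reverse, h1.reverse, ?_⟩
      rw [hrev, frontWord_reverse, ← h2]
      rfl)
    (MultiDigraph.isWalk_reverse.2 hp) (MultiDigraph.isDistributing_reverse.2 ha)
  rw [hrev, frontWord_reverse, frontWord_reverse] at this
  exact List.reverse_injective this

end Continuation

/-! ### Paths of the evolution and their words -/

variable {A V E : Type*} {S : LabeledGraph A V E} {v : E} {W : ℕ → A}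
  {hv : S.IsSupportEdge v}

theorem toSplitPath_eq (p : List (S.EvolutionEdge v W hv)) :
    toSplitPath p = (MultiDigraph.expand p).map Subtype.val := by
  rw [toSplitPath, MultiDigraph.expand, List.map_flatMap]

theorem IsRauzyScheme.isDistributing_evolution (hS : S.IsRauzyScheme W) (hW : IsRecurrent W)
    {z : {a // (S.goodGraph v W hv).IsBranching a}} (hz : IsForward z.1) :
    (S.evolution v W hv).IsDistributing z :=
  (hS.goodGraph_stronglyConnected hW).isDistributing_contract (isDistributing_good hv z.2 hz)

theorem IsRauzyScheme.isCollecting_evolution (hS : S.IsRauzyScheme W) (hW : IsRecurrent W)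
    {z : {a // (S.goodGraph v W hv).IsBranching a}} (hz : ¬ IsForward z.1) :
    (S.evolution v W hv).IsCollecting z :=
  (hS.goodGraph_stronglyConnected hW).isCollecting_contract
    (isCollecting_good hv hS.isGraphWithWords.distributing_or_collecting z.2 hz)

theorem IsRauzyScheme.isForward_of_isDistributing (hS : S.IsRauzyScheme W) (hW : IsRecurrent W)
    {z : {a // (S.goodGraph v W hv).IsBranching a}}
    (hz : (S.evolution v W hv).IsDistributing z) : IsForward z.1 :=
  not_not.1 fun h => hz.not_isCollecting (hS.isCollecting_evolution hW h)

theorem IsRauzyScheme.not_isForward_of_isCollecting (hS : S.IsRauzyScheme W) (hW : IsRecurrent W)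
    {z : {a // (S.goodGraph v W hv).IsBranching a}}
    (hz : (S.evolution v W hv).IsCollecting z) : ¬ IsForward z.1 :=
  fun h => (hS.isDistributing_evolution hW h).not_isCollecting hz

theorem IsRauzyScheme.evolution_distributing_or_collecting (hS : S.IsRauzyScheme W)
    (hW : IsRecurrent W) (z : {a // (S.goodGraph v W hv).IsBranching a}) :
    (S.evolution v W hv).IsDistributing z ∨ (S.evolution v W hv).IsCollecting z := by
  by_cases h : IsForward z.1
  · exact Or.inl (hS.isDistributing_evolution hW h)
  · exact Or.inr (hS.isCollecting_evolution hW h)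

theorem IsRauzyScheme.isGraphWithWords_evolution (hS : S.IsRauzyScheme W) (hW : IsRecurrent W) :
    (S.evolution v W hv).IsGraphWithWords := by
  have := hS.isGraphWithWords.finite_vertices
  have := hS.isGraphWithWords.finite_edges
  refine ⟨inferInstance, ?_, (hS.goodGraph_stronglyConnected hW).contract,
    hS.evolution_distributing_or_collecting hW⟩
  refine Finite.of_injective
    (fun d : S.EvolutionEdge v W hv => d.1.head d.2.1.1) ?_
  intro d d' h
  obtain ⟨e, p, he⟩ := MultiDigraph.exists_eq_cons d
  obtain ⟨e', p', he'⟩ := MultiDigraph.exists_eq_cons d'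
  obtain rfl : e = e' := by simpa [he, he'] using h
  exact MultiDigraph.edge_ext_cons he he'

theorem IsRauzyScheme.exists_isCollecting_evolution (hS : S.IsRauzyScheme W)
    (hW : IsRecurrent W) (hper : ¬ S.RevealsPeriodicity v W hv) :
    ∃ a, (S.evolution v W hv).IsCollecting a := by
  obtain ⟨z, hz⟩ := hS.exists_isBranching hW hper
  have := (hS.isGraphWithWords_evolution (hv := hv) hW).finite_vertices
  exact MultiDigraph.exists_isCollecting_of_forall ⟨z, hz⟩
    (hS.evolution_distributing_or_collecting hW)

theorem IsRauzyScheme.exists_isDistributing_evolution (hS : S.IsRauzyScheme W)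
    (hW : IsRecurrent W) (hper : ¬ S.RevealsPeriodicity v W hv) :
    ∃ a, (S.evolution v W hv).IsDistributing a := by
  obtain ⟨z, hz⟩ := hS.exists_isBranching hW hper
  have := (hS.isGraphWithWords_evolution (hv := hv) hW).finite_vertices
  exact MultiDigraph.exists_isDistributing_of_forall ⟨z, hz⟩
    (hS.evolution_distributing_or_collecting hW)

theorem IsRauzyScheme.isRightContinuation_evolution (hS : S.IsRauzyScheme W)
    (hW : IsRecurrent W) (hper : ¬ S.RevealsPeriodicity v W hv) (d : S.EvolutionEdge v W hv) :
    (S.evolution v W hv).IsRightContinuation [d]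
      ((S.goodGraph v W hv).contract.rightContinuation [d]) :=
  MultiDigraph.rightContinuation_spec
    ((hS.isGraphWithWords_evolution hW).stronglyConnected.exists_isRightContinuation
      (hS.exists_isDistributing_evolution hW hper) d)

theorem IsRauzyScheme.isLeftContinuation_evolution (hS : S.IsRauzyScheme W)
    (hW : IsRecurrent W) (hper : ¬ S.RevealsPeriodicity v W hv) (d : S.EvolutionEdge v W hv) :
    (S.evolution v W hv).IsLeftContinuation [d]
      ((S.goodGraph v W hv).contract.leftContinuation [d]) :=
  MultiDigraph.leftContinuation_spec
    ((hS.isGraphWithWords_evolution hW).stronglyConnected.exists_isLeftContinuation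
      (hS.exists_isCollecting_evolution hW hper) d)

theorem IsRauzyScheme.frontWord_evolution (hS : S.IsRauzyScheme W) (hW : IsRecurrent W)
    (hper : ¬ S.RevealsPeriodicity v W hv) {p : List (S.EvolutionEdge v W hv)} {a b}
    (hp : (S.evolution v W hv).IsWalk a p b) (hb : (S.evolution v W hv).IsDistributing b) :
    (S.evolution v W hv).frontWord p = (S.split v hv).frontWord (toSplitPath p) := by
  refine frontWord_eq_frontWord_flatMap (hS.evolution_distributing_or_collecting hW)
    (fun d => d.1.map Subtype.val) (fun d => ?_)
    (fun d => ⟨_, hS.isRightContinuation_evolution hW hper d, rfl⟩) hp hb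
  obtain ⟨e, q, hd⟩ := MultiDigraph.exists_eq_cons d
  refine ⟨e.1, q.map Subtype.val, by rw [hd, List.map_cons], fun h => ?_⟩
  have hz := hS.isForward_of_isDistributing hW h
  have hsrc : ((S.evolution v W hv).src d).1 = (S.split v hv).src e.1 :=
    MultiDigraph.contract_src hd
  rw [hsrc] at hz
  exact isDistributing_split hv hz

theorem IsRauzyScheme.backWord_evolution (hS : S.IsRauzyScheme W) (hW : IsRecurrent W)
    (hper : ¬ S.RevealsPeriodicity v W hv) {p : List (S.EvolutionEdge v W hv)} {a b}
    (hp : (S.evolution v W hv).IsWalk a p b) (ha : (S.evolution v W hv).IsCollecting a) :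
    (S.evolution v W hv).backWord p = (S.split v hv).backWord (toSplitPath p) := by
  refine backWord_eq_backWord_flatMap (hS.evolution_distributing_or_collecting hW)
    (fun d => d.1.map Subtype.val) (fun d => ?_)
    (fun d => ⟨_, hS.isLeftContinuation_evolution hW hper d, rfl⟩) hp ha
  obtain ⟨q, e, hd⟩ := MultiDigraph.exists_eq_concat d
  refine ⟨q.map Subtype.val, e.1, by rw [hd, List.map_append, List.map_singleton], fun h => ?_⟩
  have hz := hS.not_isForward_of_isCollecting hW h
  have htgt : ((S.evolution v W hv).tgt d).1 = (S.split v hv).tgt e.1 :=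
    MultiDigraph.contract_tgt hd
  rw [htgt] at hz
  exact isCollecting_split hv hS.isGraphWithWords.distributing_or_collecting hz

/-! ### Symmetric paths of the evolution as symmetric paths of the scheme -/

/-- The symmetric path of `S` that corresponds to a symmetric path of the evolution from `a` to
`b`: the projection, completed by `v` at those ends that are copies of ends of `v`. -/
noncomputable def completion (a b : {a // (S.goodGraph v W hv).IsBranching a})
    (p : List (S.EvolutionEdge v W hv)) : List E :=
  cap a.1 ++ base (MultiDigraph.expand p) ++ cap b.1

theorem exists_isWalk_cap_left (hv : S.IsSupportEdge v)
    (hS : ∀ a, S.IsDistributing a ∨ S.IsCollecting a) {z : S.SplitVertex v}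
    (hz : ¬ IsForward z) : ∃ a, S.IsWalk a (cap z) (projVertex z) ∧ S.IsCollecting a := by
  rcases z with a | x | y
  · exact ⟨a.1, rfl, (hS a.1).resolve_left hz⟩
  · exact absurd trivial hz
  · exact ⟨_, ⟨rfl, rfl⟩, hv.1⟩

theorem exists_isWalk_cap_right (hv : S.IsSupportEdge v) {z : S.SplitVertex v}
    (hz : IsForward z) : ∃ b, S.IsWalk (projVertex z) (cap z) b ∧ S.IsDistributing b := by
  rcases z with a | x | y
  · exact ⟨a.1, rfl, hz⟩
  · exact ⟨_, ⟨rfl, rfl⟩, hv.2⟩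
  · exact hz.elim

theorem cap_eq (z : S.SplitVertex v) : cap z = [] ∨ cap z = [v] := by
  rcases z with a | z
  exacts [Or.inl rfl, Or.inr rfl]

variable {a b : {a // (S.goodGraph v W hv).IsBranching a}} {p : List (S.EvolutionEdge v W hv)}

theorem isWalk_expand_evolution (hp : (S.evolution v W hv).IsWalk a p b) :
    (S.goodGraph v W hv).IsWalk a.1 (MultiDigraph.expand p) b.1 :=
  MultiDigraph.isWalk_expand hp

theorem isWalk_toSplitPath (hp : (S.evolution v W hv).IsWalk a p b) :
    (S.split v hv).IsWalk a.1 (toSplitPath p) b.1 := by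
  rw [toSplitPath_eq]
  exact (isWalk_good hv).1 (isWalk_expand_evolution hp)

theorem IsRauzyScheme.isSymmetricPath_completion (hS : S.IsRauzyScheme W) (hW : IsRecurrent W)
    (hp : (S.evolution v W hv).IsWalk a p b) (ha : (S.evolution v W hv).IsCollecting a)
    (hb : (S.evolution v W hv).IsDistributing b) : S.IsSymmetricPath (completion a b p) := by
  obtain ⟨c, hc, hc'⟩ := exists_isWalk_cap_left hv
    hS.isGraphWithWords.distributing_or_collecting (hS.not_isForward_of_isCollecting hW ha)
  obtain ⟨d, hd, hd'⟩ := exists_isWalk_cap_right hv (hS.isForward_of_isDistributing hW hb)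
  exact MultiDigraph.isSymmetricPath_iff.2 ⟨c, d, MultiDigraph.isWalk_append.2
    ⟨_, MultiDigraph.isWalk_append.2
      ⟨_, hc, isWalk_base hv (isWalk_expand_evolution hp)⟩, hd⟩, hc', hd'⟩

theorem IsRauzyScheme.expand_ne_nil (hS : S.IsRauzyScheme W) (hW : IsRecurrent W)
    (hp : (S.evolution v W hv).IsWalk a p b) (ha : (S.evolution v W hv).IsCollecting a)
    (hb : (S.evolution v W hv).IsDistributing b) :
    MultiDigraph.expand p ≠ [] := by
  intro h
  have hw := isWalk_expand_evolution hp
  rw [h, MultiDigraph.isWalk_nil] at hw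
  exact hS.not_isForward_of_isCollecting hW ha (hw ▸ hS.isForward_of_isDistributing hW hb)

theorem IsRauzyScheme.frontWord_completion (hS : S.IsRauzyScheme W) (hW : IsRecurrent W)
    (hper : ¬ S.RevealsPeriodicity v W hv)
    (hp : (S.evolution v W hv).IsWalk a p b) (ha : (S.evolution v W hv).IsCollecting a)
    (hb : (S.evolution v W hv).IsDistributing b) :
    (S.evolution v W hv).frontWord p = S.frontWord (completion a b p) := by
  have hne := hS.expand_ne_nil hW hp ha hb
  rw [hS.frontWord_evolution hW hper hp hb,
    frontWord_split hv hS.isGraphWithWords.distributing_or_collecting (isWalk_toSplitPath hp)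
      (by rw [toSplitPath_eq]; simpa using hne)
      (not_isEntry_of_not_isForward (hS.not_isForward_of_isCollecting hW ha))
      (not_isExit_of_isForward (hS.isForward_of_isDistributing hW hb)),
    completion, frontWord_append (q := cap b.1) (by simpa [base] using fun _ => hne),
    flatMap_frontTerm_cap hv, List.append_nil, toSplitPath_eq]
  rfl

theorem IsRauzyScheme.backWord_completion (hS : S.IsRauzyScheme W) (hW : IsRecurrent W)
    (hper : ¬ S.RevealsPeriodicity v W hv)
    (hp : (S.evolution v W hv).IsWalk a p b) (ha : (S.evolution v W hv).IsCollecting a)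
    (hb : (S.evolution v W hv).IsDistributing b) :
    (S.evolution v W hv).backWord p = S.backWord (completion a b p) := by
  have hne := hS.expand_ne_nil hW hp ha hb
  rw [hS.backWord_evolution hW hper hp ha,
    backWord_split hv hS.isGraphWithWords.distributing_or_collecting (hS.front_support hv)
      (isWalk_toSplitPath hp) (by rw [toSplitPath_eq]; simpa using hne)
      (not_isEntry_of_not_isForward (hS.not_isForward_of_isCollecting hW ha))
      (not_isExit_of_isForward (hS.isForward_of_isDistributing hW hb)),
    completion, List.append_assoc, backWord_append (p := cap a.1)
      (by simpa [base] using fun h => absurd h hne),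
    flatMap_backTerm_cap hv, List.nil_append, toSplitPath_eq]
  rfl

/-- A word in `c₁ ++ l ++ c₂` that neither begins nor ends with `v` lies in `l` when `c₁` and `c₂`
consist of at most the letter `v`. -/
theorem exists_split_of_append_eq {α : Type*} {v : α} {s m t c₁ l c₂ : List α}
    (h : s ++ m ++ t = c₁ ++ l ++ c₂) (h₁ : c₁ = [] ∨ c₁ = [v]) (h₂ : c₂ = [] ∨ c₂ = [v])
    (hm : m ≠ []) (hh : ∀ e ∈ m.head?, e ≠ v) (hl : ∀ e ∈ m.getLast?, e ≠ v) :
    ∃ s' t', s = c₁ ++ s' ∧ t = t' ++ c₂ ∧ s' ++ m ++ t' = l := by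
  obtain ⟨s', rfl⟩ : c₁ <+: s := by
    rcases h₁ with rfl | rfl
    · exact List.nil_prefix
    · cases s with
      | nil =>
        obtain ⟨x, m, rfl⟩ := List.exists_cons_of_ne_nil hm
        simp only [List.nil_append, List.cons_append, List.cons.injEq] at h
        exact absurd h.1 (hh x rfl)
      | cons x s =>
        simp only [List.nil_append, List.cons_append, List.cons.injEq] at h
        exact ⟨s, by rw [h.1]; rfl⟩
  obtain ⟨t', rfl⟩ : c₂ <:+ t := by
    rcases h₂ with rfl | rfl
    · exact List.nil_suffix
    · rcases List.eq_nil_or_concat' t with rfl | ⟨t, x, rfl⟩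
      · obtain ⟨m, x, rfl⟩ := (List.eq_nil_or_concat' m).resolve_left hm
        rw [List.append_nil, ← List.append_assoc] at h
        have := List.append_inj_right' h rfl
        exact absurd (by simpa using this) (hl x (by simp))
      · rw [← List.append_assoc] at h
        have := List.append_inj_right' h rfl
        exact ⟨t, by rw [this]⟩
  refine ⟨s', t', rfl, rfl,
    List.append_cancel_left (as := c₁) (List.append_cancel_right (bs := c₂) ?_)⟩
  rw [← h]
  simp

/-- An occurrence in the completion of a path along good edges that does not begin or end inside a
copy of `v` lifts to good edges. -/
theorem exists_of_completion_eq {r : List {e : S.SplitEdge v // S.IsGood v W e}}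
    {c d : S.SplitVertex v} (hr : (S.goodGraph v W hv).IsWalk c r d) (hc : ¬ IsEntry c)
    (hd : ¬ IsExit d) (hne : r ≠ []) (hp : (S.evolution v W hv).IsWalk a p b) {s t : List E}
    (h : s ++ base r ++ t = completion a b p) :
    ∃ q₁ q₂, q₁ ++ r ++ q₂ = MultiDigraph.expand p ∧ s = cap a.1 ++ base q₁ ∧
      t = base q₂ ++ cap b.1 := by
  obtain ⟨s', t', rfl, rfl, h'⟩ := exists_split_of_append_eq h (cap_eq _) (cap_eq _)
    (by simpa [base] using hne) (head?_base_ne hr hc) (getLast?_base_ne hr hd)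
  obtain ⟨q₁, q₂, h₁, rfl, rfl⟩ := exists_of_base_eq hr (isWalk_expand_evolution hp) hc hd h'
  exact ⟨q₁, q₂, h₁, rfl, rfl⟩

/-- Occurrences of completions come from occurrences of paths of the evolution. -/
theorem IsRauzyScheme.occursAtLeast_of_completion (hS : S.IsRauzyScheme W) (hW : IsRecurrent W)
    {k : ℕ} {c d : {a // (S.goodGraph v W hv).IsBranching a}}
    {q : List (S.EvolutionEdge v W hv)}
    (hp : (S.evolution v W hv).IsWalk a p b) (ha : (S.evolution v W hv).IsCollecting a)
    (hb : (S.evolution v W hv).IsDistributing b) (hq : (S.evolution v W hv).IsWalk c q d)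
    (h : OccursAtLeast k (completion a b p) (completion c d q)) : OccursAtLeast k p q := by
  have hne := hS.expand_ne_nil hW hp ha hb
  have hpne : p ≠ [] := by
    rintro rfl
    exact hne rfl
  refine h.of_surjOn (fun r =>
    ((cap c.1 ++ base (MultiDigraph.expand r.1)).take
      ((cap c.1 ++ base (MultiDigraph.expand r.1)).length - (cap a.1).length),
     (base (MultiDigraph.expand r.2) ++ cap d.1).drop (cap b.1).length)) ?_
  intro s t hst
  obtain ⟨q₁, q₂, h₁, h₂, h₃⟩ := exists_of_completion_eq (s := s ++ cap a.1) (t := cap b.1 ++ t)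
    (isWalk_expand_evolution hp)
    (not_isEntry_of_not_isForward (hS.not_isForward_of_isCollecting hW ha))
    (not_isExit_of_isForward (hS.isForward_of_isDistributing hW hb)) hne hq
    (by rw [← hst, completion]; simp)
  obtain ⟨r₁, r₂, h₄, rfl, rfl⟩ := MultiDigraph.exists_of_expand_eq hpne h₁
  refine ⟨r₁, r₂, h₄, ?_⟩
  rw [← h₂, ← h₃]
  simp

/-! ### Letters and words on the edges of the evolution -/

theorem front_split_letters (hS : S.IsRauzyScheme W) {z : S.SplitVertex v} (hz : IsForward z) :
    (∀ e, (S.split v hv).src e = z → (S.split v hv).front e ≠ []) ∧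
    ∀ e f, (S.split v hv).src e = z → (S.split v hv).src f = z → e ≠ f →
      ((S.split v hv).front e).head? ≠ ((S.split v hv).front f).head? := by
  rcases z with a | x | y
  · have hfr : ∀ e : {e : E // e ≠ v}, S.src e.1 = a.1 →
        (S.split v hv).front (.inl e) = S.front e.1 :=
      fun e he => if_neg fun h => a.2.2 (he.symm.trans h)
    constructor
    · intro e he
      obtain ⟨e, rfl, he'⟩ := split_src_eq_inl hv he
      rw [hfr e he']
      exact (hS.front_letters _ hz).1 _ he'
    · intro e f he hf hne
      obtain ⟨e, rfl, he'⟩ := split_src_eq_inl hv he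
      obtain ⟨f, rfl, hf'⟩ := split_src_eq_inl hv hf
      rw [hfr e he', hfr f hf']
      exact (hS.front_letters _ hz).2 _ _ he' hf'
        fun h => hne (congrArg Sum.inl (Subtype.ext h))
  · constructor
    · intro e he
      obtain ⟨y, rfl⟩ := split_src_eq_entry hv he
      exact (hS.front_letters _ hv.2).1 y.1 y.2
    · intro e f he hf hne
      obtain ⟨y, rfl⟩ := split_src_eq_entry hv he
      obtain ⟨y', rfl⟩ := split_src_eq_entry hv hf
      refine (hS.front_letters _ hv.2).2 y.1 y'.1 y.2 y'.2 fun h => hne ?_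
      rw [Subtype.ext h]
  · exact hz.elim

theorem back_split_letters (hS : S.IsRauzyScheme W) {z : S.SplitVertex v} (hz : ¬ IsForward z) :
    (∀ e, (S.split v hv).tgt e = z → (S.split v hv).back e ≠ []) ∧
    ∀ e f, (S.split v hv).tgt e = z → (S.split v hv).tgt f = z → e ≠ f →
      ((S.split v hv).back e).getLast? ≠ ((S.split v hv).back f).getLast? := by
  rcases z with a | x | y
  · have hc : S.IsCollecting a.1 :=
      (hS.isGraphWithWords.distributing_or_collecting a.1).resolve_left hz
    have hbk : ∀ e : {e : E // e ≠ v}, S.tgt e.1 = a.1 →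
        (S.split v hv).back (.inl e) = S.back e.1 :=
      fun e he => if_neg fun h => a.2.1 (he.symm.trans h)
    constructor
    · intro e he
      obtain ⟨e, rfl, he'⟩ := split_tgt_eq_inl hv he
      rw [hbk e he']
      exact (hS.back_letters _ hc).1 _ he'
    · intro e f he hf hne
      obtain ⟨e, rfl, he'⟩ := split_tgt_eq_inl hv he
      obtain ⟨f, rfl, hf'⟩ := split_tgt_eq_inl hv hf
      rw [hbk e he', hbk f hf']
      exact (hS.back_letters _ hc).2 _ _ he' hf'
        fun h => hne (congrArg Sum.inl (Subtype.ext h))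
  · exact absurd trivial hz
  · constructor
    · intro e he
      obtain ⟨x, rfl⟩ := split_tgt_eq_exit hv he
      exact (hS.back_letters _ hv.1).1 x.1 x.2
    · intro e f he hf hne
      obtain ⟨x, rfl⟩ := split_tgt_eq_exit hv he
      obtain ⟨x', rfl⟩ := split_tgt_eq_exit hv hf
      refine (hS.back_letters _ hv.1).2 x.1 x'.1 x.2 x'.2 fun h => hne ?_
      rw [Subtype.ext h]

theorem front_evolution (d : S.EvolutionEdge v W hv) :
    (S.evolution v W hv).front d = (S.split v hv).frontWord
      (toSplitPath ((S.goodGraph v W hv).contract.rightContinuation [d])) := rfl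

theorem back_evolution (d : S.EvolutionEdge v W hv) :
    (S.evolution v W hv).back d = (S.split v hv).backWord
      (toSplitPath ((S.goodGraph v W hv).contract.leftContinuation [d])) := rfl

theorem IsRauzyScheme.exists_front_evolution_eq (hS : S.IsRauzyScheme W) (hW : IsRecurrent W)
    (hper : ¬ S.RevealsPeriodicity v W hv) {d : S.EvolutionEdge v W hv}
    {e : {e : S.SplitEdge v // S.IsGood v W e}} {r} (hd : d.1 = e :: r) :
    ∃ u, (S.evolution v W hv).front d = (S.split v hv).front e.1 ++ u := by
  obtain ⟨q, -, hq, -⟩ := (hS.isRightContinuation_evolution hW hper d).exists_eq_cons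
  refine ⟨((r ++ MultiDigraph.expand q).map Subtype.val).flatMap (S.split v hv).frontTerm, ?_⟩
  rw [front_evolution, hq, toSplitPath_eq, MultiDigraph.expand_cons, hd, List.cons_append,
    List.map_cons, frontWord_cons]

theorem IsRauzyScheme.exists_back_evolution_eq (hS : S.IsRauzyScheme W) (hW : IsRecurrent W)
    (hper : ¬ S.RevealsPeriodicity v W hv) {d : S.EvolutionEdge v W hv}
    {e : {e : S.SplitEdge v // S.IsGood v W e}} {r} (hd : d.1 = r ++ [e]) :
    ∃ u, (S.evolution v W hv).back d = u ++ (S.split v hv).back e.1 := by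
  obtain ⟨q, -, hq, -⟩ := (hS.isLeftContinuation_evolution hW hper d).exists_eq_concat
  refine ⟨((MultiDigraph.expand q ++ r).map Subtype.val).flatMap (S.split v hv).backTerm, ?_⟩
  rw [back_evolution, hq, toSplitPath_eq, MultiDigraph.expand_append, MultiDigraph.expand_cons,
    MultiDigraph.expand_nil, List.append_nil, hd, ← List.append_assoc, List.map_append,
    List.map_singleton, backWord_concat]

theorem IsRauzyScheme.not_isDistributing_of_mem_expand (hS : S.IsRauzyScheme W)
    (hW : IsRecurrent W) {q : List (S.EvolutionEdge v W hv)}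
    (hq : ∀ f ∈ q, ¬ (S.evolution v W hv).IsDistributing ((S.evolution v W hv).src f)) :
    ∀ f ∈ MultiDigraph.expand q,
      ¬ (S.goodGraph v W hv).IsDistributing ((S.goodGraph v W hv).src f) := by
  intro f hf hd
  obtain ⟨d, hdq, hfd⟩ := List.mem_flatMap.1 hf
  obtain ⟨e, r, he⟩ := MultiDigraph.exists_eq_cons d
  rw [he, List.mem_cons] at hfd
  rcases hfd with rfl | hfr
  · refine hq d hdq ((hS.goodGraph_stronglyConnected hW).isDistributing_contract ?_)
    rw [show ((S.evolution v W hv).src d).1 = _ from MultiDigraph.contract_src he]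
    exact hd
  · have hbr := d.2
    rw [he] at hbr
    exact (MultiDigraph.isBranchPath_cons.1 hbr).2.2 f hfr (Or.inl hd.2)

theorem IsRauzyScheme.not_isCollecting_of_mem_expand (hS : S.IsRauzyScheme W)
    (hW : IsRecurrent W) {q : List (S.EvolutionEdge v W hv)}
    (hq : ∀ f ∈ q, ¬ (S.evolution v W hv).IsCollecting ((S.evolution v W hv).tgt f)) :
    ∀ f ∈ MultiDigraph.expand q,
      ¬ (S.goodGraph v W hv).IsCollecting ((S.goodGraph v W hv).tgt f) := by
  intro f hf hd
  obtain ⟨d, hdq, hfd⟩ := List.mem_flatMap.1 hf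
  obtain ⟨r, e, he⟩ := MultiDigraph.exists_eq_concat d
  rw [he, List.mem_append, List.mem_singleton] at hfd
  rcases hfd with hfr | rfl
  · have hbr := MultiDigraph.IsBranchPath.reverse d.2
    rw [he, List.reverse_append, List.reverse_singleton, List.singleton_append] at hbr
    exact (MultiDigraph.isBranchPath_cons.1 hbr).2.2 f (by simpa using hfr) (Or.inl hd.1)
  · refine hq d hdq ((hS.goodGraph_stronglyConnected hW).isCollecting_contract ?_)
    rw [show ((S.evolution v W hv).tgt d).1 = _ from MultiDigraph.contract_tgt he]
    exact hd

/-- A good edge followed by a path that is forced by the degrees extends on both sides to an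
admissible path. -/
theorem IsRauzyScheme.exists_admissible_forced_right (hS : S.IsRauzyScheme W)
    (hW : IsRecurrent W) {e : {e : S.SplitEdge v // S.IsGood v W e}}
    {p : List {e : S.SplitEdge v // S.IsGood v W e}} {b : S.SplitVertex v}
    (hp : (S.goodGraph v W hv).IsWalk ((S.goodGraph v W hv).tgt e) p b)
    (hforced : ∀ f ∈ p, ¬ (S.goodGraph v W hv).IsDistributing ((S.goodGraph v W hv).src f)) :
    ∃ l f r a, S.Admissible W (base (l ++ [f] ++ e :: p ++ r)) ∧
      (S.goodGraph v W hv).IsWalk a (l ++ [f]) ((S.goodGraph v W hv).src e) := by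
  obtain ⟨l, r, hl, hr, -, ha, a, c, hw, -, -⟩ :=
    hS.exists_long_goodAdmissible (hv := hv) hW e (p.length + 1)
  obtain ⟨_, hwl, rfl, hwr⟩ := MultiDigraph.isWalk_append.1 hw
  obtain ⟨r, rfl⟩ := MultiDigraph.prefix_of_forced hp hwr
    (fun f hf g hg => eq_of_src_eq_good hv hS.isGraphWithWords.distributing_or_collecting
      (hforced f hf) hg) (by omega)
  rcases List.eq_nil_or_concat' l with rfl | ⟨l, f, rfl⟩
  · simp at hl
  · exact ⟨l, f, r, a, by simpa using ha, hwl⟩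

theorem IsRauzyScheme.exists_admissible_forced_left (hS : S.IsRauzyScheme W)
    (hW : IsRecurrent W) {e : {e : S.SplitEdge v // S.IsGood v W e}}
    {p : List {e : S.SplitEdge v // S.IsGood v W e}} {a : S.SplitVertex v}
    (hp : (S.goodGraph v W hv).IsWalk a p ((S.goodGraph v W hv).src e))
    (hforced : ∀ f ∈ p, ¬ (S.goodGraph v W hv).IsCollecting ((S.goodGraph v W hv).tgt f)) :
    ∃ l f r b, S.Admissible W (base (l ++ (p ++ [e]) ++ f :: r)) ∧
      (S.goodGraph v W hv).IsWalk ((S.goodGraph v W hv).tgt e) (f :: r) b := by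
  obtain ⟨l, r, hl, hr, -, ha, c, b, hw, -, -⟩ :=
    hS.exists_long_goodAdmissible (hv := hv) hW e (p.length + 1)
  obtain ⟨_, hwl, rfl, hwr⟩ := MultiDigraph.isWalk_append.1 hw
  obtain ⟨l, rfl⟩ := MultiDigraph.suffix_of_forced hp hwl
    (fun f hf g hg => eq_of_tgt_eq_good hv hS.isGraphWithWords.distributing_or_collecting
      (hforced f hf) hg) (by omega)
  cases r with
  | nil => simp at hr
  | cons f r => exact ⟨l, f, r, b, by simpa using ha, hwr⟩

theorem IsRauzyScheme.isSubword_front_evolution (hS : S.IsRauzyScheme W) (hW : IsRecurrent W)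
    (hper : ¬ S.RevealsPeriodicity v W hv) (d : S.EvolutionEdge v W hv) :
    IsSubword ((S.evolution v W hv).front d) W := by
  obtain ⟨q, b, hq, hw, hb, hforced⟩ :=
    (hS.isRightContinuation_evolution hW hper d).exists_eq_cons
  obtain ⟨e, r, hd⟩ := MultiDigraph.exists_eq_cons d
  have hfront : (S.evolution v W hv).front d =
      (S.split v hv).frontWord ((e :: (r ++ MultiDigraph.expand q)).map Subtype.val) := by
    rw [front_evolution, hq, toSplitPath_eq, MultiDigraph.expand_cons, hd, List.cons_append]
  have hbf := not_isExit_of_isForward (hS.isForward_of_isDistributing hW hb)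
  have hwalk := isWalk_expand_evolution hw
  rw [MultiDigraph.expand_cons, hd, List.cons_append,
    show ((S.evolution v W hv).src d).1 = _ from MultiDigraph.contract_src hd] at hwalk
  have hbr := d.2
  rw [hd] at hbr
  obtain ⟨l, f, t, a, hadm, hl⟩ := hS.exists_admissible_forced_right hW hwalk.2 (by
    intro f hf
    rcases List.mem_append.1 hf with hf | hf
    · exact fun h => (MultiDigraph.isBranchPath_cons.1 hbr).2.2 f hf (Or.inl h.2)
    · exact hS.not_isDistributing_of_mem_expand hW hforced f hf)
  have hsplit := (isWalk_good hv).1 hwalk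
  have hor := hS.isGraphWithWords.distributing_or_collecting
  rw [hfront]
  obtain ⟨e | ⟨x, y⟩, he⟩ := e
  · rw [frontWord_split hv hor hsplit (by simp) (not_isEntry_src_inl hv e) hbf]
    refine hS.isSubword_frontWord (hadm.of_infix ?_) (by simp)
    rcases hz : (S.split v hv).src (.inl e) with a | x | y
    · refine ⟨base (l ++ [f]), base t, ?_⟩
      change _ ++ (cap ((S.split v hv).src (.inl e)) ++
        base (⟨.inl e, he⟩ :: (r ++ MultiDigraph.expand q))) ++ _ = _
      rw [hz]
      simp [cap]
    · exact absurd trivial (hz ▸ not_isEntry_src_inl hv e :)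
    · -- The path starts in a copy of the end of `v`, so the preceding edge is a copy of `v`.
      have hf : proj f.1 = v := by
        obtain ⟨x, hx⟩ := split_tgt_eq_exit hv
          ((MultiDigraph.isWalk_concat.1 hl).2.trans hz : (S.split v hv).tgt f.1 = _)
        rw [hx]
        rfl
      refine ⟨base l, base t, ?_⟩
      change _ ++ (cap ((S.split v hv).src (.inl e)) ++
        base (⟨.inl e, he⟩ :: (r ++ MultiDigraph.expand q))) ++ _ = _
      rw [hz]
      simp [cap, hf]
  · have hne : r ++ MultiDigraph.expand q ≠ [] := by
      intro h
      have h2 := hwalk.2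
      rw [h, MultiDigraph.isWalk_nil] at h2
      exact hbf (by rw [← h2]; trivial)
    rw [List.map_cons, frontWord_split_inr hv hor hsplit.2 hbf]
    refine hS.isSubword_frontWord (hadm.of_infix ?_) (by simpa using hne)
    exact ⟨base (l ++ [f] ++ [⟨.inr (x, y), he⟩]), base t, by
      change _ ++ base (r ++ MultiDigraph.expand q) ++ _ = _
      simp⟩

theorem IsRauzyScheme.isSubword_back_evolution (hS : S.IsRauzyScheme W) (hW : IsRecurrent W)
    (hper : ¬ S.RevealsPeriodicity v W hv) (d : S.EvolutionEdge v W hv) :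
    IsSubword ((S.evolution v W hv).back d) W := by
  obtain ⟨q, a, hq, hw, ha, hforced⟩ :=
    (hS.isLeftContinuation_evolution hW hper d).exists_eq_concat
  obtain ⟨r, e, hd⟩ := MultiDigraph.exists_eq_concat d
  have hexp : MultiDigraph.expand (q ++ [d]) = (MultiDigraph.expand q ++ r) ++ [e] := by
    rw [MultiDigraph.expand_append, MultiDigraph.expand_cons, MultiDigraph.expand_nil,
      List.append_nil, hd, List.append_assoc]
  have hback : (S.evolution v W hv).back d =
      (S.split v hv).backWord (((MultiDigraph.expand q ++ r) ++ [e]).map Subtype.val) := by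
    rw [back_evolution, hq, toSplitPath_eq, hexp]
  have haf := not_isEntry_of_not_isForward (hS.not_isForward_of_isCollecting hW ha)
  have hwalk := isWalk_expand_evolution hw
  rw [hexp, show ((S.evolution v W hv).tgt d).1 = _ from MultiDigraph.contract_tgt hd] at hwalk
  have hwalk' := (MultiDigraph.isWalk_concat.1 hwalk).1
  have hbr := MultiDigraph.IsBranchPath.reverse d.2
  rw [hd, List.reverse_append, List.reverse_singleton, List.singleton_append] at hbr
  obtain ⟨l, f, t, b, hadm, hl⟩ := hS.exists_admissible_forced_left hW hwalk' (by
    intro f hf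
    rcases List.mem_append.1 hf with hf | hf
    · exact hS.not_isCollecting_of_mem_expand hW hforced f hf
    · exact fun h => (MultiDigraph.isBranchPath_cons.1 hbr).2.2 f (by simpa using hf)
        (Or.inl h.1))
  have hsplit := (isWalk_good hv).1 hwalk
  have hor := hS.isGraphWithWords.distributing_or_collecting
  rw [hback]
  obtain ⟨e | ⟨x, y⟩, he⟩ := e
  · rw [backWord_split hv hor (hS.front_support hv) hsplit (by simp) haf
      (not_isExit_tgt_inl hv e)]
    refine hS.isSubword_backWord (hadm.of_infix ?_) (by simp)
    rcases hz : (S.split v hv).tgt (.inl e) with a | x | y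
    · refine ⟨base l, base (f :: t), ?_⟩
      change _ ++ (base (MultiDigraph.expand q ++ r ++ [⟨.inl e, he⟩]) ++
        cap ((S.split v hv).tgt (.inl e))) ++ _ = _
      rw [hz]
      simp [cap]
    · -- The path ends in a copy of the beginning of `v`, so the next edge is a copy of `v`.
      have hf : proj f.1 = v := by
        obtain ⟨y, hy⟩ := split_src_eq_entry hv (hl.1.trans hz : (S.split v hv).src f.1 = _)
        rw [hy]
        rfl
      refine ⟨base l, base t, ?_⟩
      change _ ++ (base (MultiDigraph.expand q ++ r ++ [⟨.inl e, he⟩]) ++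
        cap ((S.split v hv).tgt (.inl e))) ++ _ = _
      rw [hz]
      simp [cap, hf]
    · exact absurd trivial (hz ▸ not_isExit_tgt_inl hv e :)
  · have hne : MultiDigraph.expand q ++ r ≠ [] := by
      intro h
      rw [h, MultiDigraph.isWalk_nil] at hwalk'
      exact haf (by rw [hwalk']; trivial)
    rw [List.map_append, List.map_singleton, backWord_split_inr hv hor
      ((isWalk_good hv).1 hwalk') haf]
    refine hS.isSubword_backWord (hadm.of_infix ?_) (by simpa using hne)
    exact ⟨base l, base (⟨.inr (x, y), he⟩ :: f :: t), by
      change _ ++ base (MultiDigraph.expand q ++ r) ++ _ = _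
      simp⟩

/-! ### Covering and witnesses -/

theorem IsRauzyScheme.exists_symmetric_evolution (hS : S.IsRauzyScheme W) (hW : IsRecurrent W)
    (hper : ¬ S.RevealsPeriodicity v W hv) {u : List A} (hu : IsSubword u W) :
    ∃ s, (S.evolution v W hv).IsSymmetricPath s ∧ u <:+: (S.evolution v W hv).frontWord s := by
  obtain ⟨s, hs, hsw, hus⟩ := hS.exists_symmetric_isSubword hW hu
  obtain ⟨x, hx, -⟩ := hv.1.1
  obtain ⟨y, hy, -⟩ := hv.2.2
  -- Between an edge into `v` and an edge out of `v`, the path `s` lifts to good edges.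
  obtain ⟨m, hm⟩ := hS.exists_admissible_append hW (hS.admissible_edge hW x)
    ⟨s, hs, hsw, List.infix_rfl⟩
  obtain ⟨m', hm'⟩ := hS.exists_admissible_append hW hm (hS.admissible_edge hW y)
  obtain ⟨r, ⟨-, -, c, d, hr, -, -⟩, hrs⟩ := hS.exists_goodAdmissible (hv := hv) hm' (by simp)
    (by simpa using inEdge_ne hv ⟨x, hx⟩)
    (by rw [List.getLast?_concat]; simpa using outEdge_ne hv ⟨y, hy⟩)
  obtain ⟨a, ha⟩ := hS.exists_isCollecting_evolution hW hper
  obtain ⟨b, hb⟩ := hS.exists_isDistributing_evolution hW hper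
  have hG := MultiDigraph.stronglyConnected_iff.1 (hS.goodGraph_stronglyConnected (hv := hv) hW)
  obtain ⟨l, hl⟩ := hG a.1 c
  obtain ⟨t, ht⟩ := hG d b.1
  obtain ⟨p, hp, hpe⟩ := MultiDigraph.exists_expand_eq (MultiDigraph.isWalk_append.2
    ⟨_, MultiDigraph.isWalk_append.2 ⟨_, hl, hr⟩, ht⟩)
  refine ⟨p, MultiDigraph.isSymmetricPath_iff.2 ⟨a, b, hp, ha, hb⟩, hus.trans ?_⟩
  rw [hS.frontWord_completion hW hper hp ha hb]
  refine hS.frontWord_infix (hS.isSymmetricPath_completion hW hp ha hb) hs.1.1 ?_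
  exact ⟨cap a.1 ++ base l ++ ([x] ++ m), m' ++ [y] ++ base t ++ cap b.1, by
    rw [completion, hpe, base_append, base_append, hrs]
    simp⟩

/-- An edge of the evolution is used as soon as its first good edge is. -/
theorem mem_of_mem_expand {d : S.EvolutionEdge v W hv} {e r} (hd : d.1 = e :: r)
    (he : e ∈ MultiDigraph.expand p) : d ∈ p := by
  obtain ⟨d', hd'p, hed'⟩ := List.mem_flatMap.1 he
  obtain ⟨e', r', he'⟩ := MultiDigraph.exists_eq_cons d'
  rw [he', List.mem_cons] at hed'
  rcases hed' with rfl | hed'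
  · rwa [MultiDigraph.edge_ext_cons hd he']
  · have hbr := d.2
    have hbr' := d'.2
    rw [hd] at hbr
    rw [he'] at hbr'
    exact absurd (MultiDigraph.isBranchPath_cons.1 hbr).1
      ((MultiDigraph.isBranchPath_cons.1 hbr').2.2 e hed')

theorem IsRauzyScheme.exists_witness_evolution (hS : S.IsRauzyScheme W) (hW : IsRecurrent W)
    (hper : ¬ S.RevealsPeriodicity v W hv) (d : S.EvolutionEdge v W hv) :
    ∃ u, IsSubword u W ∧ ∀ s, (S.evolution v W hv).IsSymmetricPath s →
      u <:+: (S.evolution v W hv).frontWord s → d ∈ s := by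
  obtain ⟨⟨e | ⟨x, y⟩, he⟩, r, hd⟩ := MultiDigraph.exists_eq_cons d
  · obtain ⟨u, hu, hue⟩ := hS.exists_witness e.1
    refine ⟨u, hu, fun s hs hus => mem_of_mem_expand hd ?_⟩
    obtain ⟨a, b, hp, ha, hb⟩ := MultiDigraph.isSymmetricPath_iff.1 hs
    rw [hS.frontWord_completion hW hper hp ha hb] at hus
    obtain ⟨l, t, hlt⟩ := List.singleton_infix_iff _ _ |>.2
      (hue _ (hS.isSymmetricPath_completion hW hp ha hb) hus)
    obtain ⟨q₁, q₂, hq, -, -⟩ := exists_of_completion_eq (hv := hv) (r := [⟨.inl e, he⟩])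
      ⟨rfl, rfl⟩ (not_isEntry_src_inl hv e) (not_isExit_tgt_inl hv e) (by simp) hp hlt
    rw [← hq]
    simp
  · obtain ⟨t, ht, hxt, hFt⟩ := hS.exists_crossing hv x.2 y.2
    refine ⟨_, he, fun s hs hus => mem_of_mem_expand hd ?_⟩
    obtain ⟨a, b, hp, ha, hb⟩ := MultiDigraph.isSymmetricPath_iff.1 hs
    rw [hS.frontWord_completion hW hper hp ha hb, ← hFt] at hus
    obtain ⟨l, t, hlt⟩ := hxt.trans
      (hS.infix_of_infix ht (hS.isSymmetricPath_completion hW hp ha hb) hus)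
    obtain ⟨q₁, q₂, hq, -, -⟩ := exists_of_completion_eq (hv := hv)
      (r := [⟨.inl ⟨x.1, inEdge_ne hv x⟩, trivial⟩, ⟨.inr (x, y), he⟩,
        ⟨.inl ⟨y.1, outEdge_ne hv y⟩, trivial⟩])
      ⟨rfl, (split_tgt_inEdge hv x).symm, split_src_outEdge hv y, rfl⟩
      (not_isEntry_src_inl hv _) (not_isExit_tgt_inl hv _) (by simp) hp hlt
    rw [← hq]
    simp

end LabeledGraph

end Rauzy

theorem mainTheorem5 {A V E : Type*} [Finite A] (W : ℕ → A) (hW : Rauzy.IsRecurrent W)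
    (S : Rauzy.LabeledGraph A V E) (hS : S.IsRauzyScheme W)
    (v : E) (hv : S.IsSupportEdge v) (hper : ¬ S.RevealsPeriodicity v W hv) :
    (S.evolution v W hv).IsRauzyScheme W := by
  have hgraph := hS.isGraphWithWords_evolution (hv := hv) hW
  refine ⟨hgraph, ⟨hgraph.stronglyConnected, ?_⟩, ?_, ?_, ?_, ?_, ?_, ?_, ?_⟩
  · obtain ⟨a, ha⟩ := hS.exists_isDistributing_evolution hW hper
    obtain ⟨d, -, d', -, hne⟩ := ha.2
    exact ⟨d, d', hne⟩
  · intro a ha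
    have hletters := Rauzy.LabeledGraph.front_split_letters (hv := hv) hS
      (hS.isForward_of_isDistributing hW ha)
    constructor
    · intro d hda
      obtain ⟨e, r, hd⟩ := Rauzy.MultiDigraph.exists_eq_cons d
      obtain ⟨u, hu⟩ := hS.exists_front_evolution_eq hW hper hd
      have he := (Rauzy.MultiDigraph.contract_src hd).symm.trans (congrArg Subtype.val hda)
      rw [hu]
      simp [hletters.1 e.1 he]
    · intro d d' hda hda' hne
      obtain ⟨e, r, hd⟩ := Rauzy.MultiDigraph.exists_eq_cons d
      obtain ⟨u, hu⟩ := hS.exists_front_evolution_eq hW hper hd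
      have he := (Rauzy.MultiDigraph.contract_src hd).symm.trans (congrArg Subtype.val hda)
      obtain ⟨e', r', hd'⟩ := Rauzy.MultiDigraph.exists_eq_cons d'
      obtain ⟨u', hu'⟩ := hS.exists_front_evolution_eq hW hper hd'
      have he' := (Rauzy.MultiDigraph.contract_src hd').symm.trans (congrArg Subtype.val hda')
      rw [hu, hu', List.head?_append_of_ne_nil _ (hletters.1 e.1 he),
        List.head?_append_of_ne_nil _ (hletters.1 e'.1 he')]
      refine hletters.2 e.1 e'.1 he he' fun h => hne ?_
      obtain rfl := Subtype.ext h
      exact Rauzy.MultiDigraph.edge_ext_cons hd hd'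
  · intro a ha
    have hletters := Rauzy.LabeledGraph.back_split_letters (hv := hv) hS
      (hS.not_isForward_of_isCollecting hW ha)
    constructor
    · intro d hda
      obtain ⟨r, e, hd⟩ := Rauzy.MultiDigraph.exists_eq_concat d
      obtain ⟨u, hu⟩ := hS.exists_back_evolution_eq hW hper hd
      have he := (Rauzy.MultiDigraph.contract_tgt hd).symm.trans (congrArg Subtype.val hda)
      rw [hu]
      simp [hletters.1 e.1 he]
    · intro d d' hda hda' hne
      obtain ⟨r, e, hd⟩ := Rauzy.MultiDigraph.exists_eq_concat d
      obtain ⟨u, hu⟩ := hS.exists_back_evolution_eq hW hper hd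
      have he := (Rauzy.MultiDigraph.contract_tgt hd).symm.trans (congrArg Subtype.val hda)
      obtain ⟨r', e', hd'⟩ := Rauzy.MultiDigraph.exists_eq_concat d'
      obtain ⟨u', hu'⟩ := hS.exists_back_evolution_eq hW hper hd'
      have he' := (Rauzy.MultiDigraph.contract_tgt hd').symm.trans (congrArg Subtype.val hda')
      rw [hu, hu', List.getLast?_append_of_ne_nil _ (hletters.1 e.1 he),
        List.getLast?_append_of_ne_nil _ (hletters.1 e'.1 he')]
      refine hletters.2 e.1 e'.1 he he' fun h => hne ?_
      obtain rfl := Subtype.ext h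
      exact Rauzy.MultiDigraph.edge_ext_concat hd hd'
  · intro s hs
    obtain ⟨a, b, hp, ha, hb⟩ := Rauzy.MultiDigraph.isSymmetricPath_iff.1 hs
    rw [hS.frontWord_completion hW hper hp ha hb, hS.backWord_completion hW hper hp ha hb]
    exact hS.front_eq_back _ (hS.isSymmetricPath_completion hW hp ha hb)
  · intro k s t hs ht h
    obtain ⟨a, b, hp, ha, hb⟩ := Rauzy.MultiDigraph.isSymmetricPath_iff.1 hs
    obtain ⟨c, d, hq, hc, hd⟩ := Rauzy.MultiDigraph.isSymmetricPath_iff.1 ht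
    rw [hS.frontWord_completion hW hper hp ha hb, hS.frontWord_completion hW hper hq hc hd] at h
    exact hS.occursAtLeast_of_completion hW hp ha hb hq (hS.occurs_of_occurs k _ _
      (hS.isSymmetricPath_completion hW hp ha hb) (hS.isSymmetricPath_completion hW hq hc hd) h)
  · exact fun d => ⟨hS.isSubword_front_evolution hW hper d,
      hS.isSubword_back_evolution hW hper d⟩
  · exact fun u hu => hS.exists_symmetric_evolution hW hper hu
  · exact hS.exists_witness_evolution hW hper
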